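/- Let $N\ge 1$ be an integer, $m>N/2$ a real number, $\varrho\in(0,1)$, and $q_\star=\frac{N+2}{N+1}$. For real-valued functions on $\mathbb R^N$ put $$|v|_m=\Bigl(\int_{\mathbb R^N}(1+|\xi|^{2m})\,|v(\xi)|^2\,d\xi\Bigr)^{1/2},\qquad \|v\|_m=\bigl(|v|_m^2+|\nabla v|_m^2\bigr)^{1/2},$$ where $\nabla v$ is the weak gradient, and let $H^1_m(\mathbb R^N)=\{v\in H^1(\mathbb R^N) : \|v\|_m<\infty\}$, with norm $\|\cdot\|_m$. Let $\mathcal L v=\Delta v+\frac12\,\xi\cdot\nabla v+\frac N2\,v$, and let $(e^{\tau\mathcal L})_{\tau\ge0}$ be the semigroup it generates, that is, $e^{0\mathcal L}w=w$ and, for $\tau>0$, $$(e^{\tau\mathcal L}w)(\xi)=\frac{1}{(4\pi a(\tau))^{N/2}}\int_{\mathbb R^N}\exp\Bigl(-\frac{|\xi-e^{-\tau/2}\eta|^2}{4a(\tau)}\Bigr)w(\eta)\,d\eta,\qquad a(\tau)=1-e^{-\tau}.$$ Let $\chi\in C^\infty([0,\infty))$ satisfy $0\le\chi\le1$, $\chi(r)=1$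 for $r\le1$ and $\chi(r)=0$ for $r\ge4$, put $\chi_\varrho(r)=\chi(r/\varrho^2)$, and let $$F_\varrho(v)=\chi_\varrho(\|v\|_m^2)\,|\nabla v|^{q_\star},\qquad v\in H^1_m(\mathbb R^N).$$ Consider the initial-value problem $\partial_\tau v=\mathcal L v-F_\varrho(v)$, $v(0)=v_0\in H^1_m(\mathbb R^N)$. A global (mild) solution is a function $v\in C([0,\infty);H^1_m(\mathbb R^N))$ such that, for all $\tau\ge0$, $$v(\tau)=e^{\tau\mathcal L}v_0-\int_0^\tau e^{(\tau-s)\mathcal L}F_\varrho(v(s))\,ds ,$$ the integral being a convergent Bochner integral in $H^1_m(\mathbb R^N)$. Then: 1. For every $v_0\in H^1_m(\mathbb R^N)$ the problem has exactly one global mild solution $v\in C([0,\infty);H^1_m(\mathbb R^N))$. 2. For $\tau\ge0$ let $\varphi_\tau:H^1_m(\mathbb R^N)\to H^1_m(\mathbb R^N)$ be defined by $\varphi_\tau(v_0)=v(\tau)$. The maps $\varphi_\tau$ are globally Lipschitz continuous, uniformly in $\tau$ on compact intervals: for every $T\ge 0$ there is $L(T)<\infty$ such that $\|\varphi_\tau(v_0)-\varphi_\tau(\hat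 v_0)\|_m\le L(T)\,\|v_0-\hat v_0\|_m$ for all $\tau\in[0,T]$ and all $v_0,\hat v_0\in H^1_m(\mathbb R^N)$. 3. For every $\tau\ge0$ the map $\varphi_\tau$ is of class $C^1$ (in the Fréchet sense), and $(\varphi_\tau)_{\tau\ge0}$ is a $C^1$ semiflow in $H^1_m(\mathbb R^N)$: $\varphi_0=\mathrm{id}$, $\varphi_{\sigma+\tau}=\varphi_\sigma\circ\varphi_\tau$ for all $\sigma,\tau\ge0$, the map $(\tau,v_0)\mapsto\varphi_\tau(v_0)$ is continuous on $[0,\infty)\times H^1_m(\mathbb R^N)$, and each $\varphi_\tau$ is $C^1$. -/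

import Mathlib

open MeasureTheory
open scoped NNReal ENNReal ContDiff RealInnerProductSpace

noncomputable section

namespace ViscousHJ

/-- The space `ℝ^N` with its Euclidean norm. -/
abbrev E (N : ℕ) : Type := EuclideanSpace ℝ (Fin N)

/-- The weight `1 + |ξ|^{2m}`. -/
def weight (N : ℕ) (m : ℝ) (ξ : E N) : ℝ := 1 + ‖ξ‖ ^ (2 * m)

/-- The measure `(1 + |ξ|^{2m}) dξ`. -/
def weightMeasure (N : ℕ) (m : ℝ) : Measure (E N) :=
  volume.withDensity fun ξ => ENNReal.ofReal (weight N m ξ)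

/-- The weighted space `L²_m(ℝ^N) = L²(ℝ^N; (1 + |ξ|^{2m}) dξ)` of functions with values in `F`;
its norm is `|v|_m = (∫ (1 + |ξ|^{2m}) |v(ξ)|² dξ)^{1/2}`. -/
abbrev L2m (N : ℕ) (m : ℝ) (F : Type) [NormedAddCommGroup F] : Type :=
  Lp F 2 (weightMeasure N m)

/-- `w` is the weak (distributional) gradient of `v` on `ℝ^N`. -/
def IsWeakGradient {N : ℕ} (v : E N → ℝ) (w : E N → E N) : Prop :=
  ∀ φ : E N → ℝ, ContDiff ℝ ∞ φ → HasCompactSupport φ → ∀ e : E N,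
    ∫ ξ, v ξ * fderiv ℝ φ ξ e = - ∫ ξ, ⟪w ξ, e⟫ * φ ξ

lemma weight_pos (N : ℕ) (m : ℝ) (ξ : E N) : 0 < weight N m ξ := by
  unfold weight; positivity

lemma one_le_weight (N : ℕ) (m : ℝ) (ξ : E N) : 1 ≤ weight N m ξ := by
  unfold weight
  have : 0 ≤ ‖ξ‖ ^ (2 * m) := by positivity
  linarith

lemma measurable_weight (N : ℕ) (m : ℝ) : Measurable (weight N m) := by
  unfold weight; fun_prop

/-- Testing against a continuous compactly supported function is a continuous linear functional
on `L²_m`. -/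
lemma exists_inner_eq_integral {N : ℕ} {m : ℝ} {F : Type} [NormedAddCommGroup F]
    [InnerProductSpace ℝ F] (ψ : E N → F) (hψ : Continuous ψ) (hc : HasCompactSupport ψ) :
    ∃ g : L2m N m F, ∀ v : L2m N m F, ∫ ξ, ⟪v ξ, ψ ξ⟫ = ⟪v, g⟫ := by
  have hm := measurable_weight N m
  have hmem : MemLp (fun ξ => (weight N m ξ)⁻¹ • ψ ξ) 2 (weightMeasure N m) := by
    have hmeas : StronglyMeasurable (fun ξ => (weight N m ξ)⁻¹ • ψ ξ) :=
      hm.inv.stronglyMeasurable.smul hψ.stronglyMeasurable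
    rw [memLp_two_iff_integrable_sq_norm hmeas.aestronglyMeasurable, weightMeasure,
      integrable_withDensity_iff_integrable_smul' hm.ennreal_ofReal (by simp)]
    have hint : Integrable (fun ξ => ‖ψ ξ‖ ^ 2) (volume : Measure (E N)) :=
      (hψ.memLp_of_hasCompactSupport (p := 2) hc).integrable_norm_pow (by norm_num)
    refine hint.mono' ?_ (Filter.Eventually.of_forall fun ξ => ?_)
    · exact (hm.ennreal_ofReal.ennreal_toReal.stronglyMeasurable.smul
        (hmeas.norm.pow 2)).aestronglyMeasurable
    · have h0 := weight_pos N m ξ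
      have h1 := one_le_weight N m ξ
      have h2 : (weight N m ξ)⁻¹ ≤ 1 := inv_le_one_of_one_le₀ h1
      have h3 : ‖(weight N m ξ)⁻¹ • ψ ξ‖ = (weight N m ξ)⁻¹ * ‖ψ ξ‖ := by
        rw [norm_smul, norm_inv, Real.norm_of_nonneg h0.le]
      rw [ENNReal.toReal_ofReal h0.le, h3, mul_pow, smul_eq_mul,
        Real.norm_of_nonneg (by positivity)]
      calc weight N m ξ * ((weight N m ξ)⁻¹ ^ 2 * ‖ψ ξ‖ ^ 2)
          = (weight N m ξ)⁻¹ * ‖ψ ξ‖ ^ 2 := by field_simp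
        _ ≤ 1 * ‖ψ ξ‖ ^ 2 := by gcongr
        _ = ‖ψ ξ‖ ^ 2 := one_mul _
  refine ⟨hmem.toLp _, fun v => ?_⟩
  rw [L2.inner_def]
  have h1 : ∫ ξ, ⟪v ξ, (hmem.toLp _ : L2m N m F) ξ⟫ ∂(weightMeasure N m)
      = ∫ ξ, ⟪v ξ, (weight N m ξ)⁻¹ • ψ ξ⟫ ∂(weightMeasure N m) := by
    refine integral_congr_ae ?_
    filter_upwards [hmem.coeFn_toLp] with ξ hξ
    rw [hξ]
  rw [h1]
  unfold weightMeasure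
  rw [integral_withDensity_eq_integral_toReal_smul hm.ennreal_ofReal (by simp)]
  refine integral_congr_ae (Filter.Eventually.of_forall fun ξ => ?_)
  have := weight_pos N m ξ
  simp only [ENNReal.toReal_ofReal this.le, inner_smul_right, smul_eq_mul]
  field_simp

/-- For elements of `L²_m`, the weak gradient condition is a family of linear closed conditions. -/
lemma exists_isWeakGradient_iff (N : ℕ) (m : ℝ) :
    ∃ S : Set (L2m N m ℝ × L2m N m (E N)), ∀ (v : L2m N m ℝ) (w : L2m N m (E N)),
      IsWeakGradient v w ↔ ∀ p ∈ S, ⟪v, p.1⟫ + ⟪w, p.2⟫ = 0 := by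
  have key : ∀ (φ : E N → ℝ) (e : E N), ContDiff ℝ ∞ φ → HasCompactSupport φ →
      ∃ p : L2m N m ℝ × L2m N m (E N), ∀ (v : L2m N m ℝ) (w : L2m N m (E N)),
        ∫ ξ, v ξ * fderiv ℝ φ ξ e = ⟪v, p.1⟫ ∧ ∫ ξ, ⟪w ξ, e⟫ * φ ξ = ⟪w, p.2⟫ := by
    intro φ e hφ hc
    obtain ⟨g, hg⟩ := exists_inner_eq_integral (m := m) (fun ξ => fderiv ℝ φ ξ e)
      ((hφ.continuous_fderiv (by simp)).clm_apply continuous_const) (hc.fderiv_apply ℝ e)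
    obtain ⟨h, hh⟩ := exists_inner_eq_integral (m := m) (fun ξ => φ ξ • e)
      (hφ.continuous.smul continuous_const) hc.smul_right
    refine ⟨(g, h), fun v w => ⟨?_, ?_⟩⟩
    · rw [← hg v]
      refine integral_congr_ae (Filter.Eventually.of_forall fun ξ => ?_)
      simp [mul_comm]
    · rw [← hh w]
      refine integral_congr_ae (Filter.Eventually.of_forall fun ξ => ?_)
      simp [inner_smul_right, mul_comm]
  choose! p hp using key
  refine ⟨{q | ∃ φ e, ContDiff ℝ ∞ φ ∧ HasCompactSupport φ ∧ q = p φ e}, fun v w => ⟨?_, ?_⟩⟩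
  · rintro h q ⟨φ, e, hφ, hc, rfl⟩
    obtain ⟨h1, h2⟩ := hp φ e hφ hc v w
    have h3 := h φ hφ hc e
    rw [h1, h2] at h3
    linarith
  · intro h φ hφ hc e
    obtain ⟨h1, h2⟩ := hp φ e hφ hc v w
    have h3 := h _ ⟨φ, e, hφ, hc, rfl⟩
    rw [h1, h2]
    linarith

/-- The weighted Sobolev space `H¹_m(ℝ^N)`. A function `v` with weak gradient `∇v` is recorded as
the pair `(v, ∇v)` (the weak gradient is determined by `v`), and the norm inherited from the
`ℓ²`-product is `‖v‖_m = (|v|_m² + |∇v|_m²)^{1/2}`. -/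
def H1m (N : ℕ) (m : ℝ) : Submodule ℝ (WithLp 2 (L2m N m ℝ × L2m N m (E N))) where
  carrier := {u | IsWeakGradient u.fst u.snd}
  zero_mem' := by
    obtain ⟨S, hS⟩ := exists_isWeakGradient_iff N m
    refine (hS _ _).2 fun p _ => ?_
    simp
  add_mem' := by
    obtain ⟨S, hS⟩ := exists_isWeakGradient_iff N m
    intro a b ha hb
    refine (hS _ _).2 fun p hp => ?_
    have h1 := (hS _ _).1 ha p hp
    have h2 := (hS _ _).1 hb p hp
    simp only [WithLp.add_fst, WithLp.add_snd, inner_add_left]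
    linarith
  smul_mem' := by
    obtain ⟨S, hS⟩ := exists_isWeakGradient_iff N m
    intro c a ha
    refine (hS _ _).2 fun p hp => ?_
    have h1 := (hS _ _).1 ha p hp
    simp only [WithLp.smul_fst, WithLp.smul_snd, real_inner_smul_left]
    linear_combination c * h1

/-- `H¹_m` is complete, so that integrals of `H¹_m`-valued functions are meaningful. -/
instance instCompleteSpaceH1m (N : ℕ) (m : ℝ) : CompleteSpace (H1m N m) := by
  obtain ⟨S, hS⟩ := exists_isWeakGradient_iff N m
  have h : IsClosed (H1m N m : Set (WithLp 2 (L2m N m ℝ × L2m N m (E N)))) := by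
    have : (H1m N m : Set (WithLp 2 (L2m N m ℝ × L2m N m (E N))))
        = ⋂ p ∈ S, {u | ⟪u.fst, p.1⟫ + ⟪u.snd, p.2⟫ = 0} := by
      ext u
      simp only [Set.mem_iInter, Set.mem_ofPred_eq]
      exact hS _ _
    rw [this]
    refine isClosed_biInter fun p _ => isClosed_eq ?_ continuous_const
    have h1 : Continuous fun u : WithLp 2 (L2m N m ℝ × L2m N m (E N)) => u.fst :=
      (WithLp.fstL 2 ℝ _ _).continuous
    have h2 : Continuous fun u : WithLp 2 (L2m N m ℝ × L2m N m (E N)) => u.snd :=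
      (WithLp.sndL 2 ℝ _ _).continuous
    exact (h1.inner continuous_const).add (h2.inner continuous_const)
  exact h.completeSpace_coe

/-- The function underlying an element of `H¹_m`. -/
def H1m.fn {N : ℕ} {m : ℝ} (v : H1m N m) : E N → ℝ :=
  (v : WithLp 2 (L2m N m ℝ × L2m N m (E N))).fst

/-- The weak gradient of an element of `H¹_m`. -/
def H1m.grad {N : ℕ} {m : ℝ} (v : H1m N m) : E N → E N :=
  (v : WithLp 2 (L2m N m ℝ × L2m N m (E N))).snd

/-- The operator `𝓛f(ξ) = Δf(ξ) + ½ ξ·∇f(ξ) + (N/2) f(ξ)`. -/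
def opL {N : ℕ} (f : E N → ℝ) (ξ : E N) : ℝ :=
  Laplacian.laplacian f ξ + 1 / 2 * fderiv ℝ f ξ ξ + N / 2 * f ξ

/-- The kernel of `e^{τ𝓛}`, `τ > 0`:
`K_τ(ξ, η) = (4π a(τ))^{-N/2} exp(-|ξ - e^{-τ/2} η|² / (4 a(τ)))` with `a(τ) = 1 - e^{-τ}`. -/
def kernelL {N : ℕ} (τ : ℝ) (ξ η : E N) : ℝ :=
  (4 * Real.pi * (1 - Real.exp (-τ))) ^ (-(N : ℝ) / 2) *
    Real.exp (-‖ξ - Real.exp (-τ / 2) • η‖ ^ 2 / (4 * (1 - Real.exp (-τ))))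

lemma hasFDerivAt_gaussian {N : ℕ} (C b : ℝ) (p ξ : E N) :
    HasFDerivAt (fun ξ : E N => C * Real.exp (-‖ξ - p‖ ^ 2 / b))
      ((C * Real.exp (-‖ξ - p‖ ^ 2 / b) * (-2 / b)) • innerSL ℝ (ξ - p)) ξ := by
  have h1 : HasFDerivAt (fun ξ : E N => ‖ξ - p‖ ^ 2) ((2:ℝ) • innerSL ℝ (ξ - p)) ξ := by
    refine ((hasFDerivAt_id ξ).sub_const p).norm_sq.congr_fderiv ?_
    ext x
    simp
  refine ((h1.fun_neg.mul_const b⁻¹).exp.const_mul C).congr_fderiv ?_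
  ext x
  simp [div_eq_mul_inv]
  ring

lemma laplacian_gaussian {N : ℕ} (C b : ℝ) (p ξ : E N) :
    Laplacian.laplacian (fun ξ : E N => C * Real.exp (-‖ξ - p‖ ^ 2 / b)) ξ
      = C * Real.exp (-‖ξ - p‖ ^ 2 / b) * (4 / b ^ 2 * ‖ξ - p‖ ^ 2 - 2 / b * N) := by
  set f := fun ξ : E N => C * Real.exp (-‖ξ - p‖ ^ 2 / b) with hf
  have h1 : fderiv ℝ f = fun ξ => (f ξ * (-2 / b)) • innerSL ℝ (ξ - p) :=
    funext fun ξ => (hasFDerivAt_gaussian C b p ξ).fderiv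
  let B : E N →L[ℝ] E N →L[ℝ] ℝ := innerSL ℝ
  have h2 : HasFDerivAt (fderiv ℝ f) ((f ξ * (-2 / b)) • B +
      ((-2 / b) • ((f ξ * (-2 / b)) • B (ξ - p))).smulRight (B (ξ - p))) ξ := by
    rw [h1]
    have ha := (hasFDerivAt_gaussian C b p ξ).mul_const (-2 / b)
    have hb : HasFDerivAt (fun ξ : E N => B (ξ - p)) B ξ := by
      have h := (B.hasFDerivAt (x := ξ)).sub_const (B p)
      simpa only [map_sub] using h
    exact ha.smul hb
  have h3 : ∀ i : Fin N, iteratedFDeriv ℝ 2 f ξ ![EuclideanSpace.basisFun (Fin N) ℝ i,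
      EuclideanSpace.basisFun (Fin N) ℝ i] = f ξ * (4 / b ^ 2 * (ξ - p) i ^ 2 - 2 / b) := by
    intro i
    rw [iteratedFDeriv_two_apply, h2.fderiv]
    have hB : ∀ x y : E N, B x y = ⟪x, y⟫ := fun x y => innerSL_apply_apply ℝ x y
    simp only [add_apply, smul_apply, ContinuousLinearMap.smulRight_apply, smul_eq_mul, hB,
      EuclideanSpace.basisFun_apply, Matrix.cons_val_zero, Matrix.cons_val_one,
      EuclideanSpace.inner_single_right]
    simp
    ring
  rw [InnerProductSpace.laplacian_eq_iteratedFDeriv_orthonormalBasis f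
    (EuclideanSpace.basisFun (Fin N) ℝ)]
  simp only [h3]
  rw [← Finset.mul_sum, Finset.sum_sub_distrib, ← Finset.mul_sum, EuclideanSpace.real_norm_sq_eq]
  simp only [hf, Finset.sum_const, Finset.card_univ, Fintype.card_fin, nsmul_eq_mul, mul_comm,
    EuclideanSpace.real_norm_sq_eq]

/-- The kernel solves the linear equation `∂_τ K = 𝓛 K` in the variable `ξ`; this ties the
explicit formula for `e^{τ𝓛}` to the operator `𝓛`. -/
theorem hasDerivAt_kernelL {N : ℕ} (τ : ℝ) (hτ : 0 < τ) (ξ η : E N) :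
    HasDerivAt (fun t => kernelL t ξ η) (opL (fun ζ => kernelL τ ζ η) ξ) τ := by
  have ha : 0 < 1 - Real.exp (-τ) := by
    have : Real.exp (-τ) < 1 := by simpa using hτ
    linarith
  have hL : opL (fun ζ => kernelL τ ζ η) ξ = kernelL τ ξ η *
     (‖ξ - Real.exp (-τ / 2) • η‖ ^ 2 / (4 * (1 - Real.exp (-τ)) ^ 2)
      - N / (2 * (1 - Real.exp (-τ)))
      - ⟪ξ - Real.exp (-τ / 2) • η, ξ⟫ / (4 * (1 - Real.exp (-τ))) + N / 2) := by
    unfold opL kernelL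
    rw [laplacian_gaussian, (hasFDerivAt_gaussian _ _ _ ξ).fderiv]
    simp only [smul_apply, innerSL_apply_apply, smul_eq_mul]
    generalize (4 * Real.pi * (1 - Real.exp (-τ))) ^ (-(N : ℝ) / 2) *
      Real.exp (-‖ξ - Real.exp (-τ / 2) • η‖ ^ 2 / (4 * (1 - Real.exp (-τ)))) = K
    generalize 1 - Real.exp (-τ) = a at ha
    field_simp
    ring
  rw [hL]
  have h0 : HasDerivAt (fun t : ℝ => 1 - Real.exp (-t)) (Real.exp (-τ)) τ := by
    simpa using ((hasDerivAt_id τ).neg.exp.const_sub 1)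
  have h1 : HasDerivAt (fun t : ℝ => Real.exp (-t / 2)) (Real.exp (-τ/2) * (-1/2)) τ := by
    simpa using (((hasDerivAt_id τ).neg.div_const 2).exp)
  have h2 := ((h1.smul_const η).const_sub ξ).norm_sq
  have h3 := (h0.const_mul (4 * Real.pi)).rpow_const (p := -(N:ℝ)/2) (Or.inl (by positivity))
  have h4 := (h2.neg.div (h0.const_mul 4) (by positivity)).exp
  have h5 := h3.mul h4
  refine h5.congr_deriv ?_
  have he : Real.exp (-τ / 2) • η = ξ - (ξ - Real.exp (-τ / 2) • η) := by abel
  have h6 : ⟪ξ - Real.exp (-τ / 2) • η, -((Real.exp (-τ / 2) * (-1 / 2)) • η)⟫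
      = (⟪ξ - Real.exp (-τ / 2) • η, ξ⟫ - ‖ξ - Real.exp (-τ / 2) • η‖ ^ 2) / 2 := by
    rw [← real_inner_self_eq_norm_sq, ← inner_sub_right, ← he, inner_neg_right,
      real_inner_smul_right, real_inner_smul_right]
    ring
  have h7 : (4 * Real.pi * (1 - Real.exp (-τ))) ^ (-(N : ℝ) / 2 - 1)
      = (4 * Real.pi * (1 - Real.exp (-τ))) ^ (-(N : ℝ) / 2)
        / (4 * Real.pi * (1 - Real.exp (-τ))) := by
    rw [Real.rpow_sub_one (by positivity)]
  simp only [Pi.neg_apply, h6, h7, kernelL, Pi.div_apply]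
  generalize (4 * Real.pi * (1 - Real.exp (-τ))) ^ (-(N : ℝ) / 2) = P
  generalize Real.exp (-‖ξ - Real.exp (-τ / 2) • η‖ ^ 2 / (4 * (1 - Real.exp (-τ)))) = Q
  have h8 : Real.exp (-τ) = 1 - (1 - Real.exp (-τ)) := by ring
  generalize 1 - Real.exp (-τ) = a at ha h8
  rw [h8]
  generalize ‖ξ - Real.exp (-τ / 2) • η‖ = R
  have := Real.pi_pos
  field_simp
  ring

/-- The semigroup `e^{τ𝓛}`, `τ ≥ 0`, generated by `𝓛`, acting on (integrable) functions. -/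
def expL {N : ℕ} (τ : ℝ) (f : E N → ℝ) (ξ : E N) : ℝ :=
  if τ = 0 then f ξ else ∫ η, kernelL τ ξ η * f η

/-- The critical exponent `q⋆ = (N + 2) / (N + 1)`. -/
def qStar (N : ℕ) : ℝ := (N + 2) / (N + 1)

/-- A smooth cut-off on `[0, ∞)`, equal to `1` on `[0, 1]` and to `0` on `[4, ∞)`. -/
structure IsCutoff (χ : ℝ → ℝ) : Prop where
  smooth : ContDiffOn ℝ ∞ χ (Set.Ici 0)
  nonneg : ∀ r, 0 ≤ r → 0 ≤ χ r
  le_one : ∀ r, 0 ≤ r → χ r ≤ 1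
  eq_one : ∀ r, 0 ≤ r → r ≤ 1 → χ r = 1
  eq_zero : ∀ r, 4 ≤ r → χ r = 0

/-- The truncated nonlinearity `F_ρ(v) = χ(‖v‖_m² / ρ²) |∇v|^{q⋆}`. -/
def truncF {N : ℕ} {m : ℝ} (χ : ℝ → ℝ) (ρ : ℝ) (v : H1m N m) (ξ : E N) : ℝ :=
  χ (‖v‖ ^ 2 / ρ ^ 2) * ‖H1m.grad v ξ‖ ^ qStar N

/-- `v ∈ C([0, ∞); H¹_m)` is a mild solution of `∂_τ v = 𝓛v - F_ρ(v)`, `v(0) = v₀`: for all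
`τ ≥ 0`, `v(τ) = e^{τ𝓛} v₀ - ∫₀^τ e^{(τ-s)𝓛} F_ρ(v(s)) ds`, where `w = e^{τ𝓛} v₀` and
`g(s) = e^{(τ-s)𝓛} F_ρ(v(s))`, `0 ≤ s < τ`, are elements of `H¹_m` and the integral is a
(convergent) Bochner integral in `H¹_m`. -/
def IsMildSolution {N : ℕ} {m : ℝ} (χ : ℝ → ℝ) (ρ : ℝ) (v₀ : H1m N m)
    (v : C(ℝ≥0, H1m N m)) : Prop :=
  ∀ τ : ℝ≥0, ∃ (w : H1m N m) (g : ℝ → H1m N m),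
    H1m.fn w =ᵐ[volume] expL τ (H1m.fn v₀) ∧
    (∀ s : ℝ≥0, s < τ → H1m.fn (g s) =ᵐ[volume] expL ((τ : ℝ) - s) (truncF χ ρ (v s))) ∧
    IntervalIntegrable g volume 0 τ ∧
    v τ = w - ∫ s in (0 : ℝ)..τ, g s

/-- A continuous semiflow `(φ_τ)_{τ ≥ 0}` on `X` all of whose time-`τ` maps are of class `C¹`. -/
structure IsC1Semiflow {X : Type} [NormedAddCommGroup X] [NormedSpace ℝ X]
    (φ : ℝ≥0 → X → X) : Prop where
  zero : ∀ x, φ 0 x = x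
  add : ∀ σ τ x, φ (σ + τ) x = φ σ (φ τ x)
  continuous : Continuous fun p : ℝ≥0 × X => φ p.1 p.2
  contDiff : ∀ τ, ContDiff ℝ 1 (φ τ)

end ViscousHJ

end

/-!
Substituting `η ↦ e^{τ/2} (ξ - y)` in Mehler's formula exhibits `e^{τ𝓛}` as a Gaussian average, over
`y`, of dilations; hence it is a strongly continuous semigroup on `H¹_m`, and for `1 ≤ p ≤ 2` it
maps the weighted `Lᵖ` space into `H¹_m` with norm `O(τ^{-1/2 - (N/2)(1/p - 1/2)})` as `τ → 0`.
The truncated power `v ↦ θ(‖v‖_m²) |∇v|^q` is `C¹` and globally Lipschitz from `H¹_m` to the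
weighted `L^{2/q}` space, and for `p = 2/q` the singularity is integrable as soon as
`N (q - 1) < 2`.

Mild solutions on `[0, t]` are therefore the zeros of `u ↦ u + S * F(u) - T x` in `C([0, t], H¹_m)`,
where `T x` is the orbit of `x` under `e^{τ𝓛}` and `S * f` denotes Duhamel's integral.
Conjugation by `e^{λτ}`, with `λ → -∞`, makes the norm of `f ↦ S * f` arbitrarily small, so that
`u ↦ u + S * F(u)` is a bijection with Lipschitz inverse; by the inverse function theorem this
inverse is `C¹`. The solution map is its composition with the bounded linear map `x ↦ T x`.
-/

noncomputable section

namespace ViscousHJ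

open Set Filter Topology

section PerturbedIdentity

variable {𝕜 Z : Type*} [RCLike 𝕜] [NormedAddCommGroup Z] [NormedSpace 𝕜 Z] [CompleteSpace Z]
  {G : Z → Z} {K : ℝ≥0}

/-- The homeomorphism `z ↦ z + G z` of a Banach space, for a strict contraction `G`. -/
def idAddHomeomorph (𝕜 : Type*) [RCLike 𝕜] [NormedSpace 𝕜 Z] (hG : LipschitzWith K G)
    (hK : K < 1) : Z ≃ₜ Z :=
  ApproximatesLinearOn.toHomeomorph (f' := ContinuousLinearEquiv.refl 𝕜 Z) (fun z => z + G z)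
    (c := K)
    (LipschitzOnWith.approximatesLinearOn <| by
      convert! hG.lipschitzOnWith (s := univ) using 1
      ext z
      simp)
    (by
      rcases subsingleton_or_nontrivial Z with hZ | hZ
      · exact Or.inl hZ
      · right
        simpa [ContinuousLinearMap.nnnorm_id] using hK)

lemma lipschitzWith_idAddHomeomorph_symm (hG : LipschitzWith K G) (hK : K < 1) :
    LipschitzWith (1 - K)⁻¹ (idAddHomeomorph 𝕜 hG hK).symm := by
  have h := AntilipschitzWith.id.add_lipschitzWith hG (by simpa using hK)
  rw [inv_one] at h
  exact h.to_rightInverse (idAddHomeomorph 𝕜 hG hK).apply_symm_apply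

lemma contDiff_idAddHomeomorph_symm {n : WithTop ℕ∞} (hn : n ≠ 0) (hG : LipschitzWith K G)
    (hK : K < 1) (hGn : ContDiff 𝕜 n G) :
    ContDiff 𝕜 n (idAddHomeomorph 𝕜 hG hK).symm := by
  have hinv (z : Z) : ∃ A : Z ≃L[𝕜] Z,
      (A : Z →L[𝕜] Z) = ContinuousLinearMap.id 𝕜 Z + fderiv 𝕜 G z := by
    have hlt : ‖-fderiv 𝕜 G z‖ < 1 := by
      rw [norm_neg]
      exact (norm_fderiv_le_of_lipschitz 𝕜 hG).trans_lt (by exact_mod_cast hK)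
    refine ⟨ContinuousLinearEquiv.unitsEquiv 𝕜 Z (Units.oneSub _ hlt), ?_⟩
    ext x
    simp
  choose A hA using hinv
  refine Homeomorph.contDiff_symm _ (f₀' := A) (fun z => ?_) (contDiff_id.add hGn)
  rw [hA]
  exact (hasFDerivAt_id z).add (hGn.differentiable hn z).hasFDerivAt

end PerturbedIdentity

section Postcomposition

variable {𝕜 α X Y : Type*} [RCLike 𝕜] [TopologicalSpace α] [CompactSpace α]
  [NormedAddCommGroup X] [NormedSpace 𝕜 X] [NormedAddCommGroup Y] [NormedSpace 𝕜 Y]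

/-- The pointwise application `(A, u) ↦ (s ↦ A s (u s))` of operator-valued to vector-valued
functions on a compact space, as a continuous bilinear map. -/
def pointwiseApply (𝕜 α X Y : Type*) [RCLike 𝕜] [TopologicalSpace α] [CompactSpace α]
    [NormedAddCommGroup X] [NormedSpace 𝕜 X] [NormedAddCommGroup Y] [NormedSpace 𝕜 Y] :
    C(α, X →L[𝕜] Y) →L[𝕜] C(α, X) →L[𝕜] C(α, Y) :=
  LinearMap.mkContinuous₂ (E := C(α, X →L[𝕜] Y)) (F := C(α, X)) (G := C(α, Y)) (σ₁₃ := .id 𝕜)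
    (σ₂₃ := .id 𝕜)
    (LinearMap.mk₂ 𝕜 (fun A u => ⟨fun s => A s (u s), by fun_prop⟩)
      (fun _ _ _ => by ext; simp) (fun _ _ _ => by ext; simp)
      (fun _ _ _ => by ext; simp) (fun _ _ _ => by ext; simp)) 1 fun A u => by
    rw [ContinuousMap.norm_le _ (by positivity), one_mul]
    exact fun s => (A s).le_of_opNorm_le_of_le (A.norm_coe_le_norm s) (u.norm_coe_le_norm s)

lemma hasFDerivAt_postcomp {F : C(X, Y)} {F' : C(X, X →L[𝕜] Y)}
    (hF : ∀ x, HasFDerivAt F (F' x) x) (u : C(α, X)) :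
    HasFDerivAt (fun u : C(α, X) => F.comp u) (pointwiseApply 𝕜 α X Y (F'.comp u)) u := by
  let _ : NormedSpace ℝ X := NormedSpace.restrictScalars ℝ 𝕜 X
  rw [hasFDerivAt_iff_isLittleO_nhds_zero, Asymptotics.isLittleO_iff]
  intro ε hε
  have hcont : ContinuousAt (fun k : C(α, X) => F'.comp (u + k)) 0 :=
    ((ContinuousMap.continuous_postcomp F').comp (continuous_const_add u)).continuousAt
  obtain ⟨δ, hδ, hball⟩ := (Metric.continuousAt_iff (α := C(α, X)) (β := C(α, X →L[𝕜] Y))).1 hcont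
    ε hε
  filter_upwards [Metric.ball_mem_nhds (0 : C(α, X)) hδ] with h hh
  rw [ContinuousMap.norm_le _ (by positivity)]
  intro s
  have hhs : ‖h s‖ < δ := (h.norm_coe_le_norm s).trans_lt (by simpa using hh)
  have hF'ball : ∀ y ∈ Metric.ball (u s) δ, ‖F' y - F' (u s)‖ ≤ ε := fun y hy => by
    have hk : dist (ContinuousMap.const α (y - u s)) (0 : C(α, X)) < δ := by
      rw [dist_zero_right]
      refine ((ContinuousMap.norm_le _ (norm_nonneg (y - u s))).2 fun _ => le_rfl).trans_lt ?_
      rwa [← dist_eq_norm]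
    simpa [dist_eq_norm] using (ContinuousMap.dist_apply_le_dist s).trans (hball hk).le
  have hmean := (convex_ball (u s) δ).norm_image_sub_le_of_norm_hasFDerivWithin_le'
    (fun y _ => (hF y).hasFDerivWithinAt) hF'ball (Metric.mem_ball_self hδ)
    (y := u s + h s) (by simpa using hhs)
  rw [add_sub_cancel_left] at hmean
  exact hmean.trans (mul_le_mul_of_nonneg_left (h.norm_coe_le_norm s) hε.le)

lemma contDiff_postcomp {F : C(X, Y)} (hF : ContDiff 𝕜 1 F) :
    ContDiff 𝕜 1 (fun u : C(α, X) => F.comp u) := by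
  obtain ⟨F', hF'c, hF'⟩ := contDiff_one_iff_hasFDerivAt.1 hF
  exact contDiff_one_iff_hasFDerivAt.2 ⟨_, (pointwiseApply 𝕜 α X Y).continuous.comp
    (ContinuousMap.continuous_postcomp ⟨F', hF'c⟩), hasFDerivAt_postcomp (F' := ⟨F', hF'c⟩) hF'⟩

end Postcomposition

section Volterra

variable {X Y : Type*} [NormedAddCommGroup X] [NormedSpace ℝ X] [NormedAddCommGroup Y]
  [NormedSpace ℝ Y] {S : ℝ → Y →L[ℝ] X} {b : ℝ → ℝ} {f : ℝ → Y} {t τ : ℝ}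

/-- The convolution `∫₀^τ S(τ - s) f(s) ds` of a function with an operator-valued kernel. -/
def convolution (S : ℝ → Y →L[ℝ] X) (f : ℝ → Y) (τ : ℝ) : X :=
  ∫ s in (0 : ℝ)..τ, S (τ - s) (f s)

lemma convolution_eq_integral_comp_sub (S : ℝ → Y →L[ℝ] X) (f : ℝ → Y) (τ : ℝ) :
    convolution S f τ = ∫ r in (0 : ℝ)..τ, S r (f (τ - r)) := by
  simpa [convolution] using intervalIntegral.integral_comp_sub_left (a := 0) (b := τ)
    (fun r => S r (f (τ - r))) τ

lemma convolution_congr (hτ : 0 ≤ τ) {g : ℝ → Y} (h : EqOn f g (Icc 0 τ)) :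
    convolution S f τ = convolution S g τ :=
  intervalIntegral.integral_congr fun s hs => congrArg _ (h (by rwa [uIcc_of_le hτ] at hs))

lemma convolution_exp_smul (S : ℝ → Y →L[ℝ] X) (f : ℝ → Y) (lam τ : ℝ) :
    convolution (fun r => Real.exp (lam * r) • S r) (fun s => Real.exp (lam * s) • f s) τ
      = Real.exp (lam * τ) • convolution S f τ := by
  rw [convolution, convolution, ← intervalIntegral.integral_smul]
  congr with s
  rw [smul_apply, map_smul, smul_smul, ← Real.exp_add]
  ring_nf

/-- A strongly continuous operator-valued kernel on `(0, t]` whose singularity at `0` is dominated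
by the integrable function `b`. -/
structure IsVolterraKernel (S : ℝ → Y →L[ℝ] X) (b : ℝ → ℝ) (t : ℝ) : Prop where
  continuousOn : ContinuousOn (fun p : ℝ × Y => S p.1 p.2) (Ioi 0 ×ˢ univ)
  norm_le : ∀ r ∈ Ioc 0 t, ‖S r‖ ≤ b r
  integrableOn : IntegrableOn b (Ioc 0 t)

namespace IsVolterraKernel

lemma bound_nonneg (hS : IsVolterraKernel S b t) {r : ℝ} (hr : r ∈ Ioc 0 t) : 0 ≤ b r :=
  (norm_nonneg _).trans (hS.norm_le r hr)

lemma integral_bound_nonneg (hS : IsVolterraKernel S b t) : 0 ≤ ∫ r in Ioc 0 t, b r :=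
  setIntegral_nonneg measurableSet_Ioc fun _ hr => hS.bound_nonneg hr

lemma exp_smul (hS : IsVolterraKernel S b t) (lam : ℝ) :
    IsVolterraKernel (fun r => Real.exp (lam * r) • S r) (fun r => Real.exp (lam * r) * b r) t where
  continuousOn := by
    have h : Continuous fun p : ℝ × Y => Real.exp (lam * p.1) := by fun_prop
    exact h.continuousOn.smul hS.continuousOn
  norm_le r hr := by
    rw [norm_smul, Real.norm_eq_abs, Real.abs_exp]
    exact mul_le_mul_of_nonneg_left (hS.norm_le r hr) (Real.exp_pos _).le
  integrableOn := by
    have h : IntegrableOn b (Ioc 0 t) := hS.integrableOn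
    exact (h.continuousOn_mul_of_subset (K := Icc 0 t) (g := fun r => Real.exp (lam * r))
      (by fun_prop) isCompact_Icc measurableSet_Ioc Ioc_subset_Icc_self)

lemma continuousOn_comp_sub (hS : IsVolterraKernel S b t) {A : Set ℝ} (hA : A ⊆ Ioi 0)
    (hf : ContinuousOn (fun r => f (τ - r)) A) :
    ContinuousOn (fun r => S r (f (τ - r))) A :=
  hS.continuousOn.comp (f := fun r => (r, f (τ - r))) (continuousOn_id.prodMk hf)
    fun _ hr => ⟨hA hr, mem_univ _⟩

lemma intervalIntegrable_comp_sub (hS : IsVolterraKernel S b t) (hτ : τ ∈ Icc 0 t)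
    (hf : ContinuousOn f (Icc 0 τ)) :
    IntervalIntegrable (fun r => S r (f (τ - r))) volume 0 τ := by
  rw [intervalIntegrable_iff_integrableOn_Ioc_of_le hτ.1]
  have hsub : MapsTo (fun r => τ - r) (Ioc 0 τ) (Icc 0 τ) := fun r hr =>
    ⟨by linarith [hr.2], by linarith [hr.1]⟩
  obtain ⟨M, hM⟩ := isCompact_Icc.exists_bound_of_continuousOn hf
  refine Integrable.mono' ((hS.integrableOn.mono_set (Ioc_subset_Ioc_right hτ.2)).mul_const M)
    ((hS.continuousOn_comp_sub Ioc_subset_Ioi_self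
      (hf.comp (by fun_prop) hsub)).aestronglyMeasurable measurableSet_Ioc) ?_
  filter_upwards [ae_restrict_mem measurableSet_Ioc] with r hr
  exact (S r).le_of_opNorm_le_of_le (hS.norm_le r ⟨hr.1, hr.2.trans hτ.2⟩) (hM _ (hsub hr))

lemma intervalIntegrable (hS : IsVolterraKernel S b t) (hτ : τ ∈ Icc 0 t)
    (hf : ContinuousOn f (Icc 0 τ)) :
    IntervalIntegrable (fun s => S (τ - s) (f s)) volume 0 τ := by
  simpa using ((hS.intervalIntegrable_comp_sub hτ hf).comp_sub_left τ).symm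

lemma norm_convolution_le (hS : IsVolterraKernel S b t) (hτ : τ ∈ Icc 0 t) {M : ℝ}
    (hM : ∀ s, ‖f s‖ ≤ M) :
    ‖convolution S f τ‖ ≤ (∫ r in Ioc 0 t, b r) * M := by
  have hsub : Ioc (0 : ℝ) τ ⊆ Ioc 0 t := Ioc_subset_Ioc_right hτ.2
  have hM0 : 0 ≤ M := (norm_nonneg _).trans (hM 0)
  rw [convolution_eq_integral_comp_sub, intervalIntegral.integral_of_le hτ.1, ← integral_mul_const]
  calc ‖∫ r in Ioc (0 : ℝ) τ, S r (f (τ - r))‖ ≤ ∫ r in Ioc (0 : ℝ) τ, b r * M := by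
        refine norm_integral_le_of_norm_le ((hS.integrableOn.mono_set hsub).mul_const _) ?_
        filter_upwards [ae_restrict_mem measurableSet_Ioc] with r hr
        exact (S r).le_of_opNorm_le_of_le (hS.norm_le r (hsub hr)) (hM _)
    _ ≤ ∫ r in Ioc (0 : ℝ) t, b r * M := by
        refine setIntegral_mono_set (hS.integrableOn.mul_const _) ?_ hsub.eventuallyLE
        filter_upwards [ae_restrict_mem measurableSet_Ioc] with r hr
        exact mul_nonneg (hS.bound_nonneg hr) hM0

end IsVolterraKernel

lemma continuousAt_indicator_Iio {Z : Type*} [TopologicalSpace Z] [Zero Z] {g : ℝ → ℝ → Z}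
    {r τ₀ : ℝ} (hr : r ≠ τ₀) (hg : ContinuousAt (fun τ => g τ r) τ₀) :
    ContinuousAt (fun τ => (Iio τ).indicator (g τ) r) τ₀ := by
  rcases lt_or_gt_of_ne hr with h | h
  · refine hg.congr ?_
    filter_upwards [lt_mem_nhds h] with τ hτ
    rw [indicator_of_mem (mem_Iio.2 hτ)]
  · refine (continuousAt_const (y := (0 : Z))).congr ?_
    filter_upwards [gt_mem_nhds h] with τ hτ
    rw [indicator_of_notMem (by simpa using hτ.le)]

lemma intervalIntegral_eq_integral_indicator_Iio {g : ℝ → X} (hτ : τ ∈ Icc 0 t) :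
    ∫ r in (0 : ℝ)..τ, g r = ∫ r in Ioc 0 t, (Iio τ).indicator g r := by
  have h : Iio τ ∩ Ioc 0 t = Ioo 0 τ := by
    ext r
    have := hτ.2
    simp only [mem_inter_iff, mem_Iio, mem_Ioc, mem_Ioo]
    grind
  rw [integral_indicator measurableSet_Iio, Measure.restrict_restrict measurableSet_Iio, h,
    intervalIntegral.integral_of_le hτ.1, integral_Ioc_eq_integral_Ioo]

namespace IsVolterraKernel

lemma continuousOn_convolution (hS : IsVolterraKernel S b t) (hf : Continuous f) {M : ℝ}
    (hM : ∀ s, ‖f s‖ ≤ M) : ContinuousOn (convolution S f) (Icc 0 t) := by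
  have hcont (τ : ℝ) : ContinuousOn (fun r => S r (f (τ - r))) (Ioc 0 t) :=
    hS.continuousOn_comp_sub Ioc_subset_Ioi_self (by fun_prop)
  suffices Continuous fun τ => ∫ r in Ioc 0 t, (Iio τ).indicator (fun r => S r (f (τ - r))) r from
    this.continuousOn.congr fun τ hτ => by
      rw [convolution_eq_integral_comp_sub, intervalIntegral_eq_integral_indicator_Iio hτ]
  refine continuous_iff_continuousAt.2 fun τ₀ => continuousAt_of_dominated
    (bound := fun r => b r * M) (Eventually.of_forall fun τ => ?_)
    (Eventually.of_forall fun τ => ?_) (hS.integrableOn.mul_const M) ?_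
  · exact ((hcont τ).aestronglyMeasurable measurableSet_Ioc).indicator measurableSet_Iio
  · filter_upwards [ae_restrict_mem measurableSet_Ioc] with r hr
    exact (norm_indicator_le_norm_self _ _).trans
      ((S r).le_of_opNorm_le_of_le (hS.norm_le r hr) (hM _))
  · filter_upwards [Measure.ae_ne _ τ₀] with r hr
    exact continuousAt_indicator_Iio hr (by fun_prop)

/-- The Volterra operator `f ↦ (τ ↦ ∫₀^τ S(τ - s) f(s) ds)` on continuous functions on `[0, t]`. -/
def volterra (hS : IsVolterraKernel S b t) (ht : 0 ≤ t) : C(Icc 0 t, Y) →L[ℝ] C(Icc 0 t, X) :=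
  LinearMap.mkContinuous
    { toFun f := ⟨fun τ => convolution S (IccExtend ht f) τ,
        continuousOn_iff_continuous_domRestrict.1 (hS.continuousOn_convolution
          f.continuous.Icc_extend' fun s => f.norm_coe_le_norm _)⟩
      map_add' f g := by
        ext τ
        simp only [convolution, ContinuousMap.coe_mk, ContinuousMap.add_apply]
        rw [← intervalIntegral.integral_add
          (hS.intervalIntegrable τ.2 f.continuous.Icc_extend'.continuousOn)
          (hS.intervalIntegrable τ.2 g.continuous.Icc_extend'.continuousOn)]
        simp [IccExtend]
      map_smul' c f := by
        ext τ
        simp only [convolution, ContinuousMap.coe_mk, ContinuousMap.smul_apply, RingHom.id_apply]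
        rw [← intervalIntegral.integral_smul]
        simp [IccExtend] } (∫ r in Ioc 0 t, b r) fun f => by
    rw [ContinuousMap.norm_le _ (mul_nonneg hS.integral_bound_nonneg (norm_nonneg f))]
    exact fun τ => hS.norm_convolution_le τ.2 fun s => f.norm_coe_le_norm _

lemma volterra_apply (hS : IsVolterraKernel S b t) (ht : 0 ≤ t) (f : C(Icc 0 t, Y))
    (τ : Icc 0 t) : hS.volterra ht f τ = convolution S (IccExtend ht f) τ := rfl

lemma norm_volterra_le (hS : IsVolterraKernel S b t) (ht : 0 ≤ t) :
    ‖hS.volterra ht‖ ≤ ∫ r in Ioc 0 t, b r :=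
  LinearMap.mkContinuous_norm_le _ hS.integral_bound_nonneg _

end IsVolterraKernel

/-- Multiplication by the weight `s ↦ e^{lam s}` on continuous functions on `[0, t]`. -/
def expMul (X : Type*) [NormedAddCommGroup X] [NormedSpace ℝ X] (t lam : ℝ) :
    C(Icc 0 t, X) →L[ℝ] C(Icc 0 t, X) :=
  pointwiseApply ℝ (Icc 0 t) X X ⟨fun s => Real.exp (lam * s) • ContinuousLinearMap.id ℝ X,
    by fun_prop⟩

lemma expMul_apply (lam : ℝ) (u : C(Icc 0 t, X)) (s : Icc 0 t) :
    expMul X t lam u s = Real.exp (lam * s) • u s := rfl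

lemma expMul_expMul_neg (lam : ℝ) (u : C(Icc 0 t, X)) :
    expMul X t lam (expMul X t (-lam) u) = u := by
  ext s
  rw [expMul_apply, expMul_apply, smul_smul, ← Real.exp_add]
  simp

lemma expMul_neg_expMul (lam : ℝ) (u : C(Icc 0 t, X)) :
    expMul X t (-lam) (expMul X t lam u) = u := by
  simpa using expMul_expMul_neg (-lam) u

lemma volterra_expMul (hS : IsVolterraKernel S b t) (ht : 0 ≤ t) (lam : ℝ) (f : C(Icc 0 t, Y)) :
    (hS.exp_smul lam).volterra ht (expMul Y t lam f) = expMul X t lam (hS.volterra ht f) := by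
  ext τ
  rw [expMul_apply, IsVolterraKernel.volterra_apply, IsVolterraKernel.volterra_apply,
    ← convolution_exp_smul]
  refine convolution_congr τ.2.1 fun s hs => ?_
  have hs' : s ∈ Icc 0 t := ⟨hs.1, hs.2.trans τ.2.2⟩
  rw [IccExtend_of_mem ht _ hs', IccExtend_of_mem ht _ hs', expMul_apply]

lemma lipschitzWith_expMul_neg_comp_expMul {F : C(X, Y)} {L : ℝ≥0} (hL : LipschitzWith L F)
    (lam : ℝ) :
    LipschitzWith L fun u : C(Icc 0 t, X) => expMul Y t (-lam) (F.comp (expMul X t lam u)) := by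
  refine LipschitzWith.of_dist_le_mul fun u v =>
    (ContinuousMap.dist_le (by positivity)).2 fun s => ?_
  have h := hL.dist_le_mul (expMul X t lam u s) (expMul X t lam v s)
  rw [expMul_apply, expMul_apply, dist_smul₀, Real.norm_eq_abs, Real.abs_exp] at h
  rw [expMul_apply, expMul_apply, dist_smul₀, Real.norm_eq_abs, Real.abs_exp]
  calc Real.exp (-lam * s) * dist (F (expMul X t lam u s)) (F (expMul X t lam v s))
      ≤ Real.exp (-lam * s) * (L * (Real.exp (lam * s) * dist (u s) (v s))) := by gcongr; exact h
    _ = L * dist (u s) (v s) := by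
        rw [show L * dist (u s) (v s) = Real.exp (-lam * s + lam * s) * (L * dist (u s) (v s)) by
          simp, Real.exp_add]
        ring
    _ ≤ L * dist u v := by gcongr; exact ContinuousMap.dist_apply_le_dist s

lemma tendsto_integral_exp_mul_atBot (hb : IntegrableOn b (Ioc 0 t)) :
    Tendsto (fun lam : ℝ => ∫ r in Ioc 0 t, Real.exp (lam * r) * b r) atBot (𝓝 0) := by
  rw [show 𝓝 (0 : ℝ) = 𝓝 (∫ _ in Ioc (0 : ℝ) t, (0 : ℝ)) by simp]
  refine tendsto_integral_filter_of_dominated_convergence (fun r => ‖b r‖) ?_ ?_ hb.norm ?_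
  · exact Eventually.of_forall fun lam =>
      (by fun_prop : Continuous fun r => Real.exp (lam * r)).aestronglyMeasurable.mul
        hb.aestronglyMeasurable
  · filter_upwards [eventually_le_atBot 0] with lam hlam
    filter_upwards [ae_restrict_mem measurableSet_Ioc] with r hr
    rw [norm_mul, Real.norm_eq_abs, Real.abs_exp]
    exact mul_le_of_le_one_left (norm_nonneg _)
      (Real.exp_le_one_iff.2 (mul_nonpos_of_nonpos_of_nonneg hlam hr.1.le))
  · filter_upwards [ae_restrict_mem measurableSet_Ioc] with r hr
    simpa using (Real.tendsto_exp_atBot.comp (tendsto_id.atBot_mul_const hr.1)).mul_const (b r)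

lemma IsVolterraKernel.exists_norm_volterra_exp_smul_mul_lt_one (hS : IsVolterraKernel S b t)
    (ht : 0 ≤ t) (L : ℝ≥0) : ∃ lam : ℝ, ‖(hS.exp_smul lam).volterra ht‖₊ * L < 1 := by
  have h := (tendsto_integral_exp_mul_atBot hS.integrableOn).mul_const (L : ℝ)
  rw [zero_mul] at h
  obtain ⟨lam, hlam⟩ := (h.eventually (gt_mem_nhds one_pos)).exists
  refine ⟨lam, NNReal.coe_lt_coe.1 (lt_of_le_of_lt ?_ hlam)⟩
  push_cast
  gcongr
  exact (hS.exp_smul lam).norm_volterra_le ht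

theorem IsVolterraKernel.exists_resolvent [CompleteSpace X] (hS : IsVolterraKernel S b t)
    (ht : 0 ≤ t) {F : C(X, Y)} {L : ℝ≥0} (hF : ContDiff ℝ 1 F) (hL : LipschitzWith L F) :
    ∃ Ψ : C(Icc 0 t, X) → C(Icc 0 t, X), ContDiff ℝ 1 Ψ ∧ (∃ K, LipschitzWith K Ψ) ∧
      ∀ u g, u + hS.volterra ht (F.comp u) = g ↔ u = Ψ g := by
  obtain ⟨lam, hlam⟩ := hS.exists_norm_volterra_exp_smul_mul_lt_one ht L
  let V := (hS.exp_smul lam).volterra ht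
  let W : C(Icc 0 t, X) ≃ C(Icc 0 t, X) :=
    ⟨expMul X t lam, expMul X t (-lam), expMul_neg_expMul lam, expMul_expMul_neg lam⟩
  let G u := V (expMul Y t lam (F.comp (expMul X t (-lam) u)))
  have hG : ContDiff ℝ 1 G := V.contDiff.comp <| (expMul Y t lam).contDiff.comp <|
    (contDiff_postcomp hF).comp (expMul X t (-lam)).contDiff
  have hGL : LipschitzWith (‖V‖₊ * L) G := V.lipschitz.comp <| by
    simpa using lipschitzWith_expMul_neg_comp_expMul hL (-lam)
  let e := idAddHomeomorph ℝ hGL hlam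
  refine ⟨fun g => W.symm (e.symm (W g)), ?_, ?_, fun u g => ?_⟩
  · exact (expMul X t (-lam)).contDiff.comp <|
      (contDiff_idAddHomeomorph_symm one_ne_zero hGL hlam hG).comp (expMul X t lam).contDiff
  · exact ⟨_, (expMul X t (-lam)).lipschitz.comp <|
      (lipschitzWith_idAddHomeomorph_symm hGL hlam).comp (expMul X t lam).lipschitz⟩
  · have he : W (u + hS.volterra ht (F.comp u)) = e (W u) := by
      change expMul X t lam _ = expMul X t lam u + G (expMul X t lam u)
      simp only [G, V, expMul_neg_expMul, map_add]
      rw [volterra_expMul]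
    rw [← W.apply_eq_iff_eq, he, ← e.eq_symm_apply, ← W.eq_symm_apply]

end Volterra

section MildSolutions

variable {X Y : Type*} [NormedAddCommGroup X] [NormedSpace ℝ X] [NormedAddCommGroup Y]
  [NormedSpace ℝ Y]

/-- A strongly continuous semigroup `T` on `X` that extends to a family `S` of operators from `Y`
to `X` with an integrable singularity at time `0`; the values of `S` at times `τ ≤ 0` play no
role. -/
structure IsSmoothingSemigroup (T : ℝ≥0 → X →L[ℝ] X) (S : ℝ → Y →L[ℝ] X) : Prop where
  zero : ∀ x, T 0 x = x
  add : ∀ σ τ x, T (σ + τ) x = T σ (T τ x)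
  continuous : ∀ x, Continuous fun τ => T τ x
  comp : ∀ (σ : ℝ≥0) (τ : ℝ), 0 < τ → ∀ y, T σ (S τ y) = S (σ + τ) y
  bound : ∀ t, ∃ b : ℝ → ℝ, IntegrableOn b (Ioc 0 t) ∧ ∀ τ ∈ Ioc 0 t, ‖S τ‖ ≤ b τ

namespace IsSmoothingSemigroup

variable {T : ℝ≥0 → X →L[ℝ] X} {S : ℝ → Y →L[ℝ] X} [CompleteSpace X]

lemma exists_norm_le (h : IsSmoothingSemigroup T S) (t : ℝ≥0) : ∃ M, ∀ τ ≤ t, ‖T τ‖ ≤ M := by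
  obtain ⟨M, hM⟩ := banach_steinhaus (g := fun τ : Icc 0 t => T τ) fun x => by
    obtain ⟨C, hC⟩ := (isCompact_Icc (a := 0) (b := t)).exists_bound_of_continuousOn
      (h.continuous x).continuousOn
    exact ⟨C, fun τ => hC τ τ.2⟩
  exact ⟨M, fun τ hτ => hM ⟨τ, zero_le, hτ⟩⟩

lemma continuous_uncurry (h : IsSmoothingSemigroup T S) :
    Continuous fun p : ℝ≥0 × X => T p.1 p.2 := by
  refine continuous_iff_continuousAt.2 fun p₀ => ?_
  obtain ⟨M, hM⟩ := h.exists_norm_le (p₀.1 + 1)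
  have hlip (τ : ℝ≥0) (hτ : τ ∈ Iio (p₀.1 + 1)) : LipschitzOnWith M.toNNReal (T τ) univ :=
    ((T τ).lipschitz.weaken
      (NNReal.le_toNNReal_of_coe_le (hM τ (le_of_lt hτ)))).lipschitzOnWith
  exact (continuousOn_prod_of_continuousOn_lipschitzOnWith' _ _ hlip
    fun x _ => (h.continuous x).continuousOn).continuousAt
    (prod_mem_nhds (Iio_mem_nhds (by simp)) univ_mem)

lemma continuousOn_uncurry (h : IsSmoothingSemigroup T S) :
    ContinuousOn (fun p : ℝ × Y => S p.1 p.2) (Ioi 0 ×ˢ univ) := by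
  rintro ⟨τ₀, y₀⟩ ⟨hτ₀ : 0 < τ₀, -⟩
  have hcont : Continuous fun p : ℝ × Y => T (p.1 - τ₀ / 2).toNNReal (S (τ₀ / 2) p.2) :=
    h.continuous_uncurry.comp (f := fun p : ℝ × Y => ((p.1 - τ₀ / 2).toNNReal, S (τ₀ / 2) p.2))
      (by fun_prop)
  refine (hcont.continuousAt.congr ?_).continuousWithinAt
  filter_upwards [continuous_fst.continuousAt.eventually (lt_mem_nhds (half_lt_self hτ₀))]
    with p hp
  rw [h.comp _ _ (half_pos hτ₀), Real.coe_toNNReal _ (sub_nonneg.2 hp.le), sub_add_cancel]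

lemma exists_isVolterraKernel (h : IsSmoothingSemigroup T S) (t : ℝ) :
    ∃ b, IsVolterraKernel S b t := by
  obtain ⟨b, hbi, hb⟩ := h.bound t
  exact ⟨b, h.continuousOn_uncurry, hb, hbi⟩

/-- The semigroup orbits on `[0, t]`, as a continuous linear map of the initial value. -/
def orbit (h : IsSmoothingSemigroup T S) (t : ℝ≥0) : X →L[ℝ] C(Icc (0 : ℝ) t, X) :=
  LinearMap.mkContinuousOfExistsBound
    { toFun x := ⟨fun τ => T ⟨τ, τ.2.1⟩ x, (h.continuous x).comp (by fun_prop)⟩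
      map_add' _ _ := by ext; simp
      map_smul' _ _ := by ext; simp } <| by
    obtain ⟨M, hM⟩ := h.exists_norm_le t
    have hM0 : 0 ≤ M := (norm_nonneg _).trans (hM 0 zero_le)
    refine ⟨M, fun x => (ContinuousMap.norm_le _ (by positivity)).2 fun τ => ?_⟩
    exact (T ⟨τ, τ.2.1⟩).le_of_opNorm_le (hM _ τ.2.2) x

lemma orbit_apply (h : IsSmoothingSemigroup T S) (t : ℝ≥0) (x : X) (τ : Icc (0 : ℝ) t) :
    h.orbit t x τ = T ⟨τ, τ.2.1⟩ x := rfl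

lemma convolution_add (h : IsSmoothingSemigroup T S) (σ τ : ℝ≥0) {f : ℝ → Y}
    (hf : ContinuousOn f (Icc 0 (σ + τ))) :
    convolution S f (σ + τ) = T σ (convolution S f τ) + convolution S (fun s => f (s + τ)) σ := by
  obtain ⟨b, hS⟩ := h.exists_isVolterraKernel (σ + τ)
  have hστ : (τ : ℝ) ≤ σ + τ := le_add_of_nonneg_left σ.2
  have hint := hS.intervalIntegrable (right_mem_Icc.2 (by positivity)) hf
  have hint' := hS.intervalIntegrable (τ := τ) ⟨τ.coe_nonneg, hστ⟩
    (hf.mono (Icc_subset_Icc_right hστ))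
  have hmem : (τ : ℝ) ∈ uIcc 0 ((σ : ℝ) + τ) := by
    rw [uIcc_of_le (by positivity)]
    exact ⟨τ.coe_nonneg, hστ⟩
  have hpast : ∫ s in (0 : ℝ)..τ, S (σ + τ - s) (f s) = T σ (convolution S f τ) := by
    rw [convolution, ← ContinuousLinearMap.intervalIntegral_comp_comm _ hint']
    refine intervalIntegral.integral_congr_ae ?_
    filter_upwards [Measure.ae_ne _ (τ : ℝ)] with s hne hs
    rw [uIoc_of_le τ.coe_nonneg] at hs
    rw [h.comp _ _ (sub_pos.2 (lt_of_le_of_ne hs.2 hne)), add_sub_assoc]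
  have hfuture : ∫ s in (τ : ℝ)..(σ + τ), S (σ + τ - s) (f s)
      = convolution S (fun s => f (s + τ)) σ := by
    simpa [convolution] using (intervalIntegral.integral_comp_add_right (a := 0) (b := σ)
      (fun s => S (σ + τ - s) (f s)) τ).symm
  rw [← hpast, ← hfuture, convolution, intervalIntegral.integral_add_adjacent_intervals
    (hint.mono_set (uIcc_subset_uIcc_left hmem)) (hint.mono_set (uIcc_subset_uIcc_right hmem))]

end IsSmoothingSemigroup

/-- Mild solutions of `u' = Au - F(u)`, `u(0) = x`, on the time interval `[0, t]`, where `T` is the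
semigroup generated by `A` and `S` its extension to the range of `F`. -/
def IsMildOn (T : ℝ≥0 → X →L[ℝ] X) (S : ℝ → Y →L[ℝ] X) (F : X → Y) (x : X) (t : ℝ)
    (u : ℝ → X) : Prop :=
  ∀ τ ∈ Icc 0 t, u τ = T τ.toNNReal x - convolution S (fun s => F (u s)) τ

/-- Mild solutions of `u' = Au - F(u)`, `u(0) = x`, on `[0, ∞)`. -/
def IsMild (T : ℝ≥0 → X →L[ℝ] X) (S : ℝ → Y →L[ℝ] X) (F : X → Y) (x : X) (v : C(ℝ≥0, X)) : Prop :=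
  ∀ τ : ℝ≥0, v τ = T τ x - convolution S (fun s => F (v s.toNNReal)) τ

section

variable {T : ℝ≥0 → X →L[ℝ] X} {S : ℝ → Y →L[ℝ] X} {F : X → Y} {x : X} {t t' : ℝ} {u u' : ℝ → X}

lemma IsMildOn.mono (hu : IsMildOn T S F x t u) (h : t' ≤ t) : IsMildOn T S F x t' u :=
  fun τ hτ => hu τ ⟨hτ.1, hτ.2.trans h⟩

lemma IsMildOn.congr (hu : IsMildOn T S F x t u) (h : EqOn u u' (Icc 0 t)) :
    IsMildOn T S F x t u' := fun τ hτ => by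
  rw [← h hτ, hu τ hτ, convolution_congr hτ.1 fun s hs => congrArg F (h ⟨hs.1, hs.2.trans hτ.2⟩)]

lemma isMild_iff_forall_isMildOn {v : C(ℝ≥0, X)} :
    IsMild T S F x v ↔ ∀ t : ℝ≥0, IsMildOn T S F x t fun s => v s.toNNReal := by
  refine ⟨fun h t τ hτ => ?_, fun h τ => ?_⟩
  · simpa only [Real.coe_toNNReal _ hτ.1] using h τ.toNNReal
  · simpa only [Real.toNNReal_coe] using h τ τ ⟨τ.coe_nonneg, le_rfl⟩

end

variable [CompleteSpace X] {T : ℝ≥0 → X →L[ℝ] X} {S : ℝ → Y →L[ℝ] X} {F : C(X, Y)} {L : ℝ≥0}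
  {x : X} {t τ : ℝ≥0} {v : C(ℝ≥0, X)}

theorem IsMild.shift (h : IsSmoothingSemigroup T S) (hv : IsMild T S F x v) (τ : ℝ≥0) :
    IsMild T S F (v τ) ⟨fun σ => v (σ + τ), by fun_prop⟩ := fun σ => by
  have hshift : EqOn (fun s : ℝ => F (v (s + τ).toNNReal)) (fun s => F (v (s.toNNReal + τ)))
      (Icc 0 σ) := fun s hs => by
    beta_reduce
    rw [Real.toNNReal_add hs.1 τ.coe_nonneg, Real.toNNReal_coe]
  have hf : Continuous fun s : ℝ => F (v s.toNNReal) := by fun_prop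
  simp only [ContinuousMap.coe_mk]
  rw [hv (σ + τ), hv τ, NNReal.coe_add, h.convolution_add σ τ hf.continuousOn,
    convolution_congr σ.coe_nonneg hshift, h.add, map_sub]
  abel

namespace IsSmoothingSemigroup

theorem exists_solutionMap (h : IsSmoothingSemigroup T S) (hF : ContDiff ℝ 1 F)
    (hL : LipschitzWith L F) (t : ℝ≥0) :
    ∃ Φ : X → C(Icc (0 : ℝ) t, X), ContDiff ℝ 1 Φ ∧ (∃ K, LipschitzWith K Φ) ∧
      ∀ x (u : C(Icc (0 : ℝ) t, X)), IsMildOn T S F x t (IccExtend t.coe_nonneg u) ↔ u = Φ x := by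
  obtain ⟨b, hS⟩ := h.exists_isVolterraKernel t
  obtain ⟨Ψ, hΨ, ⟨K, hK⟩, hΨ'⟩ := hS.exists_resolvent t.coe_nonneg hF hL
  refine ⟨Ψ ∘ h.orbit t, hΨ.comp (h.orbit t).contDiff, ⟨_, hK.comp (h.orbit t).lipschitz⟩,
    fun x u => ?_⟩
  rw [Function.comp_apply, ← hΨ', ContinuousMap.ext_iff, IsMildOn, SetCoe.forall]
  refine forall₂_congr fun τ hτ => ?_
  rw [IccExtend_of_mem _ _ hτ, ContinuousMap.add_apply, hS.volterra_apply, orbit_apply,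
    eq_sub_iff_add_eq, Real.toNNReal_of_nonneg hτ.1]
  rfl

/-- The solution at time `t`, as a function of the initial value `x`, of `u' = Au - F(u)`,
`u(0) = x`, where `A` generates `T`. -/
def flow (h : IsSmoothingSemigroup T S) (hF : ContDiff ℝ 1 F) (hL : LipschitzWith L F) (t : ℝ≥0)
    (x : X) : X :=
  (h.exists_solutionMap hF hL t).choose x ⟨t, t.coe_nonneg, le_rfl⟩

variable (h : IsSmoothingSemigroup T S) (hF : ContDiff ℝ 1 F) (hL : LipschitzWith L F)

include h hF hL in
lemma eqOn_of_isMildOn {u u' : ℝ → X} (hu : IsMildOn T S F x t u)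
    (hu' : IsMildOn T S F x t u') (huc : ContinuousOn u (Icc 0 t))
    (huc' : ContinuousOn u' (Icc 0 t)) : EqOn u u' (Icc 0 t) := by
  obtain ⟨Φ, -, -, hΦ⟩ := h.exists_solutionMap hF hL t
  have key (w : ℝ → X) (hw : IsMildOn T S F x t w) (hwc : ContinuousOn w (Icc 0 t)) :
      EqOn w (IccExtend t.coe_nonneg (Φ x)) (Icc 0 t) := by
    have hext : EqOn w (IccExtend t.coe_nonneg ((Icc 0 (t : ℝ)).domRestrict w))
        (Icc 0 t) := fun s hs => by
      rw [IccExtend_of_mem _ _ hs, domRestrict_apply]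
    rwa [← (hΦ x ⟨_, hwc.domRestrict⟩).1 (hw.congr hext)]
  exact (key u hu huc).trans (key u' hu' huc').symm

lemma isMildOn_solutionMap (t : ℝ≥0) (x : X) :
    IsMildOn T S F x t (IccExtend t.coe_nonneg ((h.exists_solutionMap hF hL t).choose x)) :=
  ((h.exists_solutionMap hF hL t).choose_spec.2.2 x _).2 rfl

lemma flow_eq_solutionMap (hτ : τ ≤ t) (x : X) :
    h.flow hF hL τ x = (h.exists_solutionMap hF hL t).choose x ⟨τ, τ.coe_nonneg, hτ⟩ := by
  have hmem : (τ : ℝ) ∈ Icc (0 : ℝ) τ := right_mem_Icc.2 τ.coe_nonneg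
  have := h.eqOn_of_isMildOn hF hL (h.isMildOn_solutionMap hF hL τ x)
    ((h.isMildOn_solutionMap hF hL t x).mono (NNReal.coe_le_coe.2 hτ))
    (ContinuousMap.continuous _).Icc_extend'.continuousOn
    (ContinuousMap.continuous _).Icc_extend'.continuousOn hmem
  rwa [IccExtend_of_mem _ _ hmem,
    IccExtend_of_mem _ _ ⟨τ.coe_nonneg, NNReal.coe_le_coe.2 hτ⟩] at this

lemma contDiff_flow (t : ℝ≥0) : ContDiff ℝ 1 (h.flow hF hL t) := by
  let eval := ContinuousMap.evalCLM (M := X) ℝ (⟨t, t.coe_nonneg, le_rfl⟩ : Icc (0 : ℝ) t)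
  exact eval.contDiff.comp (h.exists_solutionMap hF hL t).choose_spec.1

lemma exists_lipschitzWith_flow (t : ℝ≥0) :
    ∃ K : ℝ≥0, ∀ τ ≤ t, LipschitzWith K (h.flow hF hL τ) := by
  obtain ⟨K, hK⟩ := (h.exists_solutionMap hF hL t).choose_spec.2.1
  refine ⟨K, fun τ hτ => LipschitzWith.of_dist_le_mul fun x y => ?_⟩
  rw [h.flow_eq_solutionMap hF hL hτ, h.flow_eq_solutionMap hF hL hτ]
  exact (ContinuousMap.dist_apply_le_dist _).trans (hK.dist_le_mul x y)

lemma continuous_flow_left (x : X) : Continuous fun τ => h.flow hF hL τ x := by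
  refine continuous_iff_continuousAt.2 fun τ₀ => ?_
  have hcont : Continuous fun τ : ℝ≥0 => IccExtend (τ₀ + 1).coe_nonneg
      ((h.exists_solutionMap hF hL (τ₀ + 1)).choose x) τ :=
    (ContinuousMap.continuous _).Icc_extend'.comp NNReal.continuous_coe
  refine hcont.continuousAt.congr ?_
  filter_upwards [Iio_mem_nhds (lt_add_one τ₀)] with τ hτ
  rw [h.flow_eq_solutionMap hF hL (le_of_lt hτ),
    IccExtend_of_mem _ _ ⟨τ.coe_nonneg, NNReal.coe_le_coe.2 (le_of_lt hτ)⟩]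

lemma continuous_flow : Continuous fun p : ℝ≥0 × X => h.flow hF hL p.1 p.2 := by
  refine continuous_iff_continuousAt.2 fun p₀ => ?_
  obtain ⟨K, hK⟩ := h.exists_lipschitzWith_flow hF hL (p₀.1 + 1)
  have hlip (τ : ℝ≥0) (hτ : τ ∈ Iio (p₀.1 + 1)) : LipschitzOnWith K (h.flow hF hL τ) univ :=
    (hK τ (le_of_lt hτ)).lipschitzOnWith
  exact (continuousOn_prod_of_continuousOn_lipschitzOnWith' _ K hlip
    fun x _ => (h.continuous_flow_left hF hL x).continuousOn).continuousAt
    (prod_mem_nhds (Iio_mem_nhds (by simp)) univ_mem)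

lemma isMild_iff_eq_flow : IsMild T S F x v ↔ ∀ τ, v τ = h.flow hF hL τ x := by
  have hsol (t : ℝ≥0) : IsMildOn T S F x t fun s => h.flow hF hL s.toNNReal x :=
    (h.isMildOn_solutionMap hF hL t x).congr fun s hs => by
      rw [IccExtend_of_mem _ _ hs,
        h.flow_eq_solutionMap hF hL (t := t) (Real.toNNReal_le_iff_le_coe.2 hs.2)]
      simp only [Real.coe_toNNReal _ hs.1]
  rw [isMild_iff_forall_isMildOn]
  refine ⟨fun hv τ => ?_, fun hv t => (hsol t).congr fun s _ => (hv _).symm⟩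
  have hcont := h.continuous_flow_left hF hL x
  simpa using h.eqOn_of_isMildOn hF hL (hv τ) (hsol τ) (by fun_prop) (by fun_prop)
    (right_mem_Icc.2 τ.coe_nonneg)

include h hF hL in
theorem existsUnique_isMild (x : X) : ∃! v, IsMild T S F x v :=
  ⟨⟨fun τ => h.flow hF hL τ x, h.continuous_flow_left hF hL x⟩,
    (h.isMild_iff_eq_flow hF hL).2 fun _ => rfl,
    fun _ hv => ContinuousMap.ext ((h.isMild_iff_eq_flow hF hL).1 hv)⟩

lemma flow_zero (x : X) : h.flow hF hL 0 x = x := by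
  obtain ⟨v, hv, -⟩ := h.existsUnique_isMild hF hL x
  rw [← (h.isMild_iff_eq_flow hF hL).1 hv, hv 0, h.zero]
  simp [convolution]

lemma flow_add (σ τ : ℝ≥0) (x : X) :
    h.flow hF hL (σ + τ) x = h.flow hF hL σ (h.flow hF hL τ x) := by
  obtain ⟨v, hv, -⟩ := h.existsUnique_isMild hF hL x
  rw [← (h.isMild_iff_eq_flow hF hL).1 hv, ← (h.isMild_iff_eq_flow hF hL).1 hv,
    ← (h.isMild_iff_eq_flow hF hL).1 (hv.shift h τ)]
  rfl

end IsSmoothingSemigroup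

theorem IsSmoothingSemigroup.isC1Semiflow_flow {X : Type} [NormedAddCommGroup X] [NormedSpace ℝ X]
    [CompleteSpace X] {T : ℝ≥0 → X →L[ℝ] X} {S : ℝ → Y →L[ℝ] X} {F : C(X, Y)}
    (h : IsSmoothingSemigroup T S) (hF : ContDiff ℝ 1 F) (hL : LipschitzWith L F) :
    IsC1Semiflow (h.flow hF hL) where
  zero := h.flow_zero hF hL
  add := h.flow_add hF hL
  continuous := h.continuous_flow hF hL
  contDiff := h.contDiff_flow hF hL

end MildSolutions

section SignedPower

variable {V : Type*} [NormedAddCommGroup V] [InnerProductSpace ℝ V]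

/-- The signed power `a ↦ |a|^{θ-1} a`. -/
def signedPow (θ : ℝ) (a : V) : V := ‖a‖ ^ (θ - 1) • a

lemma rpow_sub_one_mul_self {θ : ℝ} (hθ : θ ≠ 0) (r : ℝ) : r ^ (θ - 1) * r = r ^ θ := by
  rcases eq_or_ne r 0 with rfl | hr
  · rw [mul_zero, Real.zero_rpow hθ]
  · rw [Real.rpow_sub_one hr, div_mul_cancel₀ _ hr]

lemma norm_signedPow {θ : ℝ} (hθ : θ ≠ 0) (a : V) : ‖signedPow θ a‖ = ‖a‖ ^ θ := by
  rw [signedPow, norm_smul, Real.norm_of_nonneg (by positivity), rpow_sub_one_mul_self hθ]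

lemma norm_signedPow_sub_le_of_norm_le {θ : ℝ} (hθ : 0 < θ) (hθ1 : θ ≤ 1) {a b : V}
    (hab : ‖b‖ ≤ ‖a‖) :
    ‖signedPow θ a - signedPow θ b‖ ≤ 2 * (‖a‖ ^ (θ - 1) * ‖a - b‖) := by
  have hsplit : signedPow θ a - signedPow θ b
      = ‖a‖ ^ (θ - 1) • (a - b) - (‖b‖ ^ (θ - 1) - ‖a‖ ^ (θ - 1)) • b := by
    rw [signedPow, signedPow, smul_sub, sub_smul]; abel
  have hb : ‖(‖b‖ ^ (θ - 1) - ‖a‖ ^ (θ - 1)) • b‖ = ‖b‖ ^ θ - ‖a‖ ^ (θ - 1) * ‖b‖ := by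
    rcases eq_or_ne b 0 with rfl | hb
    · simp [Real.zero_rpow hθ.ne']
    have hmono := Real.rpow_le_rpow_of_nonpos (norm_pos_iff.2 hb) hab (sub_nonpos.2 hθ1)
    rw [norm_smul, Real.norm_of_nonneg (sub_nonneg.2 hmono), sub_mul,
      rpow_sub_one_mul_self hθ.ne']
  calc ‖signedPow θ a - signedPow θ b‖
      ≤ ‖a‖ ^ (θ - 1) * ‖a - b‖ + (‖b‖ ^ θ - ‖a‖ ^ (θ - 1) * ‖b‖) := by
        rw [hsplit, ← hb]
        refine (norm_sub_le _ _).trans_eq ?_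
        rw [norm_smul, Real.norm_of_nonneg (by positivity)]
    _ ≤ ‖a‖ ^ (θ - 1) * ‖a - b‖ + ‖a‖ ^ (θ - 1) * (‖a‖ - ‖b‖) := by
        rw [mul_sub, rpow_sub_one_mul_self hθ.ne']
        gcongr
    _ ≤ 2 * (‖a‖ ^ (θ - 1) * ‖a - b‖) := by
        rw [two_mul]
        gcongr
        exact norm_sub_norm_le a b

lemma rpow_sub_one_mul_le {θ r d : ℝ} (hθ : 0 < θ) (hθ1 : θ ≤ 1) (hd : 0 ≤ d)
    (hdr : d ≤ 2 * r) : r ^ (θ - 1) * d ≤ 2 * d ^ θ := by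
  rcases hd.eq_or_lt with rfl | hd
  · simp [Real.zero_rpow hθ.ne']
  calc r ^ (θ - 1) * d ≤ (2⁻¹ * d) ^ (θ - 1) * d := by
        gcongr ?_ * d
        exact Real.rpow_le_rpow_of_nonpos (by positivity) (by linarith) (by linarith)
    _ = 2 ^ (1 - θ) * d ^ θ := by
        rw [Real.mul_rpow (by norm_num) hd.le, Real.inv_rpow (by norm_num),
          ← Real.rpow_neg (by norm_num), neg_sub, mul_assoc, rpow_sub_one_mul_self hθ.ne']
    _ ≤ 2 * d ^ θ := by
        gcongr
        exact Real.rpow_le_self_of_one_le one_le_two (by linarith)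

lemma norm_signedPow_sub_le {θ : ℝ} (hθ : 0 < θ) (hθ1 : θ ≤ 1) (a b : V) :
    ‖signedPow θ a - signedPow θ b‖ ≤ 4 * ‖a - b‖ ^ θ := by
  wlog hab : ‖b‖ ≤ ‖a‖ generalizing a b
  · rw [norm_sub_rev, norm_sub_rev a b]
    exact this b a (le_of_not_ge hab)
  have hdist : ‖a - b‖ ≤ 2 * ‖a‖ := (norm_sub_le a b).trans (by linarith)
  have hpow := rpow_sub_one_mul_le hθ hθ1 (norm_nonneg (a - b)) hdist
  have hsub := norm_signedPow_sub_le_of_norm_le hθ hθ1 hab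
  linarith

lemma continuous_signedPow {θ : ℝ} (hθ : 0 < θ) (hθ1 : θ ≤ 1) :
    Continuous (signedPow θ : V → V) := by
  refine continuous_iff_continuousAt.2 fun b => tendsto_iff_norm_sub_tendsto_zero.2 ?_
  refine squeeze_zero (fun _ => norm_nonneg _) (fun a => norm_signedPow_sub_le hθ hθ1 a b) ?_
  have hcont : Continuous fun a : V => 4 * ‖a - b‖ ^ θ :=
    continuous_const.mul ((continuous_id.sub continuous_const).norm.rpow_const
      fun _ => Or.inr hθ.le)
  simpa [Real.zero_rpow hθ.ne'] using hcont.tendsto b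

lemma abs_norm_add_rpow_sub_le {q : ℝ} (hq : 1 < q) (hq2 : q ≤ 2) (a h : V) :
    |‖a + h‖ ^ q - ‖a‖ ^ q - q * ⟪signedPow (q - 1) a, h⟫| ≤ q * 4 * ‖h‖ ^ q := by
  have hderiv : ∀ x : V, HasFDerivAt (fun y : V => ‖y‖ ^ q)
      (q • innerSL ℝ (signedPow (q - 1) x)) x := fun x => by
    convert hasFDerivAt_norm_rpow x hq using 1
    rw [signedPow, map_smul, smul_smul, sub_sub, one_add_one_eq_two]
  have hosc : ∀ x ∈ Metric.closedBall a ‖h‖, ‖q • innerSL ℝ (signedPow (q - 1) x)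
      - q • innerSL ℝ (signedPow (q - 1) a)‖ ≤ q * 4 * ‖h‖ ^ (q - 1) := fun x hx => by
    rw [← smul_sub, ← map_sub, norm_smul, innerSL_apply_norm, mul_assoc,
      Real.norm_of_nonneg (by linarith)]
    refine mul_le_mul_of_nonneg_left ?_ (by linarith)
    refine (norm_signedPow_sub_le (by linarith) (by linarith) x a).trans ?_
    rw [mem_closedBall_iff_norm] at hx
    gcongr
  have hmvt := (convex_closedBall a ‖h‖).norm_image_sub_le_of_norm_hasFDerivWithin_le'
    (fun x _ => (hderiv x).hasFDerivWithinAt) hosc (Metric.mem_closedBall_self (norm_nonneg h))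
    (show a + h ∈ Metric.closedBall a ‖h‖ by simp)
  rw [add_sub_cancel_left, mul_assoc, rpow_sub_one_mul_self (by linarith)] at hmvt
  exact hmvt

end SignedPower

section Superposition

variable {α V W : Type*} [MeasurableSpace α] {μ : Measure α} [NormedAddCommGroup V]
  [NormedAddCommGroup W] {p : ℝ≥0∞} {θ : ℝ}

lemma memLp_norm_rpow (hθ : 0 < θ) {g : α → V} (hg : MemLp g p μ) :
    MemLp (fun x => ‖g x‖ ^ θ) (p / ENNReal.ofReal θ) μ := by
  simpa only [ENNReal.toReal_ofReal hθ.le] using hg.norm_rpow_div (ENNReal.ofReal θ)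

lemma norm_Lp_le_mul_rpow_of_norm_le (hθ : 0 < θ) (h : Lp V p μ)
    (G : Lp W (p / ENNReal.ofReal θ) μ) {C : ℝ} (hle : ∀ᵐ x ∂μ, ‖G x‖ ≤ C * ‖h x‖ ^ θ) :
    ‖G‖ ≤ C * ‖h‖ ^ θ := by
  have hpow := memLp_norm_rpow hθ (Lp.memLp h)
  have hnorm : ‖hpow.toLp _‖ = ‖h‖ ^ θ := by
    rw [Lp.norm_toLp, eLpNorm_norm_rpow _ hθ,
      ENNReal.div_mul_cancel (ENNReal.ofReal_pos.2 hθ).ne' ENNReal.ofReal_ne_top,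
      ← ENNReal.toReal_rpow, Lp.norm_def]
  rw [← hnorm]
  refine Lp.norm_le_mul_norm_of_ae_le_mul ?_
  filter_upwards [hle, hpow.coeFn_toLp] with x hx hx'
  rwa [hx', Real.norm_of_nonneg (by positivity)]

variable {Φ : V → W}

lemma memLp_superposition (hθ : 0 < θ) (hΦ : Continuous Φ) (hgrowth : ∀ a, ‖Φ a‖ ≤ ‖a‖ ^ θ)
    (g : Lp V p μ) : MemLp (fun x => Φ (g x)) (p / ENNReal.ofReal θ) μ :=
  (memLp_norm_rpow hθ (Lp.memLp g)).mono'
    (hΦ.comp_aestronglyMeasurable (Lp.aestronglyMeasurable g)) (.of_forall fun x => hgrowth (g x))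

/-- The superposition (Nemytskii) operator `g ↦ Φ ∘ g` from `L^p` to `L^{p/θ}` attached to a
continuous map `Φ` of growth at most `|a|^θ`. -/
def superposition (hθ : 0 < θ) (hΦ : Continuous Φ) (hgrowth : ∀ a, ‖Φ a‖ ≤ ‖a‖ ^ θ)
    (g : Lp V p μ) : Lp W (p / ENNReal.ofReal θ) μ :=
  (memLp_superposition hθ hΦ hgrowth g).toLp

lemma coeFn_superposition (hθ : 0 < θ) (hΦ : Continuous Φ) (hgrowth : ∀ a, ‖Φ a‖ ≤ ‖a‖ ^ θ)
    (g : Lp V p μ) : superposition hθ hΦ hgrowth g =ᵐ[μ] fun x => Φ (g x) :=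
  (memLp_superposition hθ hΦ hgrowth g).coeFn_toLp

lemma norm_superposition_le (hθ : 0 < θ) (hΦ : Continuous Φ) (hgrowth : ∀ a, ‖Φ a‖ ≤ ‖a‖ ^ θ)
    (g : Lp V p μ) : ‖superposition hθ hΦ hgrowth g‖ ≤ ‖g‖ ^ θ := by
  rw [← one_mul (‖g‖ ^ θ)]
  refine norm_Lp_le_mul_rpow_of_norm_le hθ g _ ?_
  filter_upwards [coeFn_superposition hθ hΦ hgrowth g] with x hx
  rw [hx, one_mul]
  exact hgrowth (g x)

lemma norm_superposition_sub_le (hθ : 0 < θ) (hΦ : Continuous Φ)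
    (hgrowth : ∀ a, ‖Φ a‖ ≤ ‖a‖ ^ θ) {C : ℝ} (hΦC : ∀ a b, ‖Φ a - Φ b‖ ≤ C * ‖a - b‖ ^ θ)
    (g h : Lp V p μ) :
    ‖superposition hθ hΦ hgrowth g - superposition hθ hΦ hgrowth h‖ ≤ C * ‖g - h‖ ^ θ := by
  refine norm_Lp_le_mul_rpow_of_norm_le hθ (g - h) _ ?_
  filter_upwards [coeFn_superposition hθ hΦ hgrowth g, coeFn_superposition hθ hΦ hgrowth h,
    Lp.coeFn_sub g h, Lp.coeFn_sub (superposition hθ hΦ hgrowth g) (superposition hθ hΦ hgrowth h)]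
    with x hg hh hsub hsub'
  rw [hsub', hsub, Pi.sub_apply, Pi.sub_apply, hg, hh]
  exact hΦC (g x) (h x)

lemma continuous_superposition [Fact (1 ≤ p)] [Fact (1 ≤ p / ENNReal.ofReal θ)] (hθ : 0 < θ)
    (hΦ : Continuous Φ) (hgrowth : ∀ a, ‖Φ a‖ ≤ ‖a‖ ^ θ) {C : ℝ}
    (hΦC : ∀ a b, ‖Φ a - Φ b‖ ≤ C * ‖a - b‖ ^ θ) :
    Continuous (superposition hθ hΦ hgrowth : Lp V p μ → Lp W (p / ENNReal.ofReal θ) μ) := by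
  refine continuous_iff_continuousAt.2 fun h => tendsto_iff_norm_sub_tendsto_zero.2 ?_
  refine squeeze_zero (fun _ => norm_nonneg _)
    (fun g => norm_superposition_sub_le hθ hΦ hgrowth hΦC g h) ?_
  have hcont : Continuous fun g : Lp V p μ => C * ‖g - h‖ ^ θ :=
    continuous_const.mul ((continuous_id.sub continuous_const).norm.rpow_const
      fun _ => Or.inr hθ.le)
  simpa [Real.zero_rpow hθ.ne'] using hcont.tendsto h

end Superposition

section PowerOperator

variable {α V : Type*} [MeasurableSpace α] {μ : Measure α} [NormedAddCommGroup V]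
  {p : ℝ≥0∞} {q : ℝ}

/-- The Nemytskii operator `g ↦ |g|^q` from `L^p` to `L^{p/q}`. -/
def powOp (hq : 0 < q) : Lp V p μ → Lp ℝ (p / ENNReal.ofReal q) μ :=
  superposition hq (continuous_norm.rpow_const fun _ => Or.inr hq.le)
    fun a => (Real.norm_of_nonneg (by positivity)).le

lemma coeFn_powOp (hq : 0 < q) (g : Lp V p μ) : powOp hq g =ᵐ[μ] fun x => ‖g x‖ ^ q :=
  coeFn_superposition _ _ _ g

lemma norm_powOp_le (hq : 0 < q) (g : Lp V p μ) : ‖powOp hq g‖ ≤ ‖g‖ ^ q :=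
  norm_superposition_le _ _ _ g

variable [InnerProductSpace ℝ V]

/-- The Nemytskii operator `g ↦ |g|^{θ-1} g` from `L^p` to `L^{p/θ}`. -/
def signedPowOp {θ : ℝ} (hθ : 0 < θ) (hθ1 : θ ≤ 1) :
    Lp V p μ → Lp V (p / ENNReal.ofReal θ) μ :=
  superposition hθ (continuous_signedPow hθ hθ1) fun a => (norm_signedPow hθ.ne' a).le

lemma holderTriple_div_ofReal (hq : 1 < q) :
    ENNReal.HolderTriple (p / ENNReal.ofReal (q - 1)) p (p / ENNReal.ofReal q) where
  inv_add_inv_eq_inv := by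
    have hq0 : ENNReal.ofReal q ≠ 0 := (ENNReal.ofReal_pos.2 (by linarith)).ne'
    have hq1 : ENNReal.ofReal (q - 1) ≠ 0 := (ENNReal.ofReal_pos.2 (by linarith)).ne'
    rw [ENNReal.inv_div (.inl ENNReal.ofReal_ne_top) (.inl hq1),
      ENNReal.inv_div (.inl ENNReal.ofReal_ne_top) (.inl hq0), ← one_div, ← ENNReal.add_div,
      ← ENNReal.ofReal_one, ← ENNReal.ofReal_add (by linarith) zero_le_one, sub_add_cancel]

lemma one_le_div_ofReal_sub_one (hp : 1 ≤ p / ENNReal.ofReal q) :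
    1 ≤ p / ENNReal.ofReal (q - 1) :=
  hp.trans (ENNReal.div_le_div_left (ENNReal.ofReal_le_ofReal (by linarith)) p)

variable [Fact (1 ≤ p)] [Fact (1 ≤ p / ENNReal.ofReal q)]

/-- The derivative `h ↦ q |g|^{q-2} g·h` of `g ↦ |g|^q`. -/
def powOpDeriv (hq : 1 < q) (hq2 : q ≤ 2) (g : Lp V p μ) :
    Lp V p μ →L[ℝ] Lp ℝ (p / ENNReal.ofReal q) μ :=
  haveI : Fact (1 ≤ p / ENNReal.ofReal (q - 1)) := ⟨one_le_div_ofReal_sub_one Fact.out⟩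
  haveI := holderTriple_div_ofReal (p := p) hq
  q • (innerSL ℝ : V →L[ℝ] V →L[ℝ] ℝ).holderL μ (p / ENNReal.ofReal (q - 1)) p
    (p / ENNReal.ofReal q) (signedPowOp (sub_pos.2 hq) (by linarith) g)

lemma continuous_powOpDeriv (hq : 1 < q) (hq2 : q ≤ 2) :
    Continuous (powOpDeriv hq hq2 : Lp V p μ → _) := by
  have : Fact (1 ≤ p / ENNReal.ofReal (q - 1)) := ⟨one_le_div_ofReal_sub_one Fact.out⟩
  have := holderTriple_div_ofReal (p := p) hq
  exact ((ContinuousLinearMap.continuous _).comp (continuous_superposition _ _ _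
    (norm_signedPow_sub_le (sub_pos.2 hq) (by linarith)))).const_smul q

lemma coeFn_powOpDeriv_apply (hq : 1 < q) (hq2 : q ≤ 2) (g h : Lp V p μ) :
    powOpDeriv hq hq2 g h =ᵐ[μ] fun x => q * ⟪signedPow (q - 1) (g x), h x⟫ := by
  have := holderTriple_div_ofReal (p := p) hq
  have hdef : powOpDeriv hq hq2 g h = q • (innerSL ℝ : V →L[ℝ] V →L[ℝ] ℝ).holder
      (p / ENNReal.ofReal q) (signedPowOp (sub_pos.2 hq) (by linarith) g) h := rfl
  rw [hdef]
  refine (Lp.coeFn_smul q _).trans ?_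
  filter_upwards [(innerSL ℝ : V →L[ℝ] V →L[ℝ] ℝ).coeFn_holder (r := p / ENNReal.ofReal q)
    (signedPowOp (sub_pos.2 hq) (by linarith) g) h,
    coeFn_superposition (sub_pos.2 hq) (continuous_signedPow (sub_pos.2 hq) (by linarith))
      (fun a => (norm_signedPow (sub_pos.2 hq).ne' a).le) g] with x hholder hpow
  rw [Pi.smul_apply, hholder, signedPowOp, hpow, innerSL_apply_apply, smul_eq_mul]

lemma norm_powOpDeriv_le (hq : 1 < q) (hq2 : q ≤ 2) (g : Lp V p μ) :
    ‖powOpDeriv hq hq2 g‖ ≤ q * ‖g‖ ^ (q - 1) := by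
  have : Fact (1 ≤ p / ENNReal.ofReal (q - 1)) := ⟨one_le_div_ofReal_sub_one Fact.out⟩
  have := holderTriple_div_ofReal (p := p) hq
  have hq0 : 0 ≤ q := by linarith
  refine ContinuousLinearMap.opNorm_le_bound _ (by positivity) fun h => ?_
  change ‖q • (innerSL ℝ : V →L[ℝ] V →L[ℝ] ℝ).holder (p / ENNReal.ofReal q)
    (signedPowOp (sub_pos.2 hq) (by linarith) g) h‖ ≤ _
  rw [norm_smul, Real.norm_of_nonneg hq0, mul_assoc]
  gcongr
  refine (ContinuousLinearMap.norm_holder_apply_apply_le _ _ h).trans ?_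
  gcongr
  calc ‖(innerSL ℝ : V →L[ℝ] V →L[ℝ] ℝ)‖ * ‖signedPowOp (sub_pos.2 hq) (by linarith) g‖
      ≤ 1 * ‖g‖ ^ (q - 1) := mul_le_mul (norm_innerSL_le ℝ) (norm_superposition_le _ _ _ g)
        (norm_nonneg _) zero_le_one
    _ = ‖g‖ ^ (q - 1) := one_mul _

lemma norm_powOp_add_sub_le (hq : 1 < q) (hq2 : q ≤ 2) (g h : Lp V p μ) :
    ‖powOp (zero_lt_one.trans hq) (g + h) - powOp (zero_lt_one.trans hq) g
      - powOpDeriv hq hq2 g h‖ ≤ q * 4 * ‖h‖ ^ q := by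
  have hq0 : 0 < q := zero_lt_one.trans hq
  refine norm_Lp_le_mul_rpow_of_norm_le hq0 h _ ?_
  filter_upwards [coeFn_powOp hq0 g, coeFn_powOp hq0 (g + h), coeFn_powOpDeriv_apply hq hq2 g h,
    Lp.coeFn_add g h, Lp.coeFn_sub (powOp hq0 (g + h)) (powOp hq0 g),
    Lp.coeFn_sub (powOp hq0 (g + h) - powOp hq0 g) (powOpDeriv hq hq2 g h)]
    with x hg hgh hderiv hadd hsub hsub'
  rw [hsub', Pi.sub_apply, hsub, Pi.sub_apply, hgh, hg, hderiv, hadd, Pi.add_apply]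
  exact abs_norm_add_rpow_sub_le hq hq2 (g x) (h x)

lemma hasFDerivAt_powOp (hq : 1 < q) (hq2 : q ≤ 2) (g : Lp V p μ) :
    HasFDerivAt (powOp (zero_lt_one.trans hq)) (powOpDeriv hq hq2 g) g := by
  have hlittle : (fun h : Lp V p μ => ‖h‖ ^ q) =o[𝓝 0] fun h => h := by
    refine Asymptotics.isLittleO_norm_right.1 ?_
    have hcont : Continuous fun h : Lp V p μ => ‖h‖ ^ (q - 1) :=
      continuous_norm.rpow_const fun _ => Or.inr (by linarith)
    have hzero : Tendsto (fun h : Lp V p μ => ‖h‖ ^ (q - 1)) (𝓝 0) (𝓝 0) := by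
      simpa [Real.zero_rpow (sub_pos.2 hq).ne'] using hcont.tendsto 0
    refine ((Asymptotics.isLittleO_one_iff ℝ).2 hzero).mul_isBigO
      (Asymptotics.isBigO_refl (fun h : Lp V p μ => ‖h‖) _) |>.congr (fun h => ?_) fun h => ?_
    · exact rpow_sub_one_mul_self (by linarith) _
    · exact one_mul _
  rw [hasFDerivAt_iff_isLittleO_nhds_zero]
  refine (Asymptotics.IsBigO.of_bound (q * 4) (.of_forall fun h => ?_)).trans_isLittleO hlittle
  rw [Real.norm_of_nonneg (by positivity)]
  exact norm_powOp_add_sub_le hq hq2 g h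

end PowerOperator

section Truncation

variable {X Y : Type*} [NormedAddCommGroup X] [InnerProductSpace ℝ X] [NormedAddCommGroup Y]
  [NormedSpace ℝ Y] {θ : ℝ → ℝ} {P : X → Y}

lemma contDiff_truncation (hθ : ContDiffOn ℝ 1 θ (Ici 0)) (hP : ContDiff ℝ 1 P) :
    ContDiff ℝ 1 fun x => θ (‖x‖ ^ 2) • P x :=
  (hθ.comp_contDiff (contDiff_norm_sq ℝ) fun x => sq_nonneg ‖x‖).smul hP

lemma norm_fderiv_comp_norm_sq_le (hθ : ContDiffOn ℝ 1 θ (Ici 0)) (x : X) :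
    ‖fderiv ℝ (fun y : X => θ (‖y‖ ^ 2)) x‖ ≤ ‖derivWithin θ (Ici 0) (‖x‖ ^ 2)‖ * (2 * ‖x‖) := by
  have hderiv := ((hθ.differentiableOn one_ne_zero) (‖x‖ ^ 2)
    (sq_nonneg ‖x‖)).hasDerivWithinAt.comp_hasFDerivAt x
    (hasStrictFDerivAt_norm_sq x).hasFDerivAt (.of_forall fun y => sq_nonneg ‖y‖)
  change ‖fderiv ℝ (θ ∘ fun y : X => ‖y‖ ^ 2) x‖ ≤ _
  rw [hderiv.fderiv, norm_smul, ← Nat.cast_smul_eq_nsmul ℝ, norm_smul, innerSL_apply_norm]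
  simp

lemma exists_lipschitzWith_truncation (hθ : ContDiffOn ℝ 1 θ (Ici 0)) {R : ℝ}
    (hθR : ∀ r, R ≤ r → θ r = 0) (hP : ContDiff ℝ 1 P) {M M' : ℝ}
    (hPM : ∀ x, ‖x‖ ^ 2 ≤ R → ‖P x‖ ≤ M) (hPM' : ∀ x, ‖x‖ ^ 2 ≤ R → ‖fderiv ℝ P x‖ ≤ M') :
    ∃ L : ℝ≥0, LipschitzWith L fun x => θ (‖x‖ ^ 2) • P x := by
  obtain ⟨A, hA⟩ := (isCompact_Icc (a := (0 : ℝ)) (b := R)).exists_bound_of_continuousOn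
    (hθ.continuousOn.mono Icc_subset_Ici_self)
  obtain ⟨B, hB⟩ := (isCompact_Icc (a := (0 : ℝ)) (b := R)).exists_bound_of_continuousOn
    ((hθ.continuousOn_derivWithin (uniqueDiffOn_Ici 0) le_rfl).mono Icc_subset_Ici_self)
  have hθ' : ContDiff ℝ 1 fun x : X => θ (‖x‖ ^ 2) :=
    hθ.comp_contDiff (contDiff_norm_sq ℝ) fun x => sq_nonneg ‖x‖
  have hbound : ∀ x, ‖fderiv ℝ (fun x => θ (‖x‖ ^ 2) • P x) x‖
      ≤ max 0 (A * M' + B * (2 * √R) * M) := fun x => by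
    rcases le_or_gt (‖x‖ ^ 2) R with hx | hx
    · have hA' := hA _ ⟨sq_nonneg ‖x‖, hx⟩
      have hB' := hB _ ⟨sq_nonneg ‖x‖, hx⟩
      refine le_max_of_le_right ?_
      rw [fderiv_fun_smul (hθ'.differentiable one_ne_zero x) (hP.differentiable one_ne_zero x)]
      refine (norm_add_le _ _).trans (add_le_add ?_ ?_)
      · rw [norm_smul]
        exact mul_le_mul hA' (hPM' x hx) (norm_nonneg _) ((norm_nonneg _).trans hA')
      · have hB0 : 0 ≤ B := (norm_nonneg _).trans hB'
        rw [ContinuousLinearMap.norm_smulRight_apply]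
        refine mul_le_mul ((norm_fderiv_comp_norm_sq_le hθ x).trans ?_) (hPM x hx)
          (norm_nonneg _) (by positivity)
        gcongr
        exact Real.le_sqrt_of_sq_le hx
    · have hzero : (fun x => θ (‖x‖ ^ 2) • P x) =ᶠ[𝓝 x] fun _ => 0 := by
        filter_upwards [(continuous_norm.pow 2).continuousAt.eventually (lt_mem_nhds hx)]
          with y hy
        rw [hθR (‖y‖ ^ 2) hy.le, zero_smul]
      rw [hzero.fderiv_eq, fderiv_fun_const, Pi.zero_apply, norm_zero]
      exact le_max_left _ _
  exact ⟨⟨_, le_max_left _ _⟩, lipschitzWith_of_nnnorm_fderiv_le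
    ((contDiff_truncation hθ hP).differentiable one_ne_zero) hbound⟩

end Truncation

section Weight

variable {N : ℕ} {m : ℝ}

lemma add_rpow_le {a b r : ℝ} (ha : 0 ≤ a) (hb : 0 ≤ b) (hr : 0 ≤ r) :
    (a + b) ^ r ≤ 2 ^ r * (a ^ r + b ^ r) :=
  calc (a + b) ^ r ≤ (2 * max a b) ^ r := by gcongr; linarith [le_max_left a b, le_max_right a b]
    _ = 2 ^ r * max a b ^ r := Real.mul_rpow zero_le_two (le_max_of_le_left ha)
    _ ≤ 2 ^ r * (a ^ r + b ^ r) := by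
      gcongr
      rcases max_cases a b with h | h <;> rw [h.1]
      exacts [le_add_of_nonneg_right (by positivity), le_add_of_nonneg_left (by positivity)]

lemma weight_mono (hm : 0 ≤ m) {x y : E N} (h : ‖x‖ ≤ ‖y‖) : weight N m x ≤ weight N m y := by
  unfold weight
  gcongr

lemma weight_add_le (hm : 0 ≤ m) (x y : E N) :
    weight N m (x + y) ≤ 2 ^ (2 * m) * (weight N m x * weight N m y) := by
  have hxy : ‖x + y‖ ^ (2 * m) ≤ 2 ^ (2 * m) * (‖x‖ ^ (2 * m) + ‖y‖ ^ (2 * m)) :=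
    (Real.rpow_le_rpow (norm_nonneg _) (norm_add_le x y) (by positivity)).trans
      (add_rpow_le (norm_nonneg x) (norm_nonneg y) (by positivity))
  have hconst : (1 : ℝ) ≤ 2 ^ (2 * m) := Real.one_le_rpow one_le_two (by positivity)
  have hprod : 0 ≤ ‖x‖ ^ (2 * m) * ‖y‖ ^ (2 * m) := by positivity
  unfold weight
  nlinarith

lemma continuous_weight (hm : 0 ≤ m) : Continuous (weight N m) :=
  continuous_const.add (continuous_norm.rpow_const fun _ => Or.inr (by positivity))

lemma volume_le_weightMeasure : (volume : Measure (E N)) ≤ weightMeasure N m := by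
  conv_lhs => rw [← withDensity_one (μ := (volume : Measure (E N)))]
  exact withDensity_mono (.of_forall fun ξ => by simpa using one_le_weight N m ξ)

lemma volume_absolutelyContinuous_weightMeasure :
    (volume : Measure (E N)) ≪ weightMeasure N m :=
  Measure.absolutelyContinuous_of_le volume_le_weightMeasure

lemma weightMeasure_absolutelyContinuous_volume :
    weightMeasure N m ≪ (volume : Measure (E N)) :=
  withDensity_absolutelyContinuous _ _

lemma isLocallyFiniteMeasure_weightMeasure (hm : 0 ≤ m) :
    IsLocallyFiniteMeasure (weightMeasure N m) :=
  IsLocallyFiniteMeasure.withDensity_ofReal (continuous_weight hm)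

lemma lintegral_weightMeasure (f : E N → ℝ≥0∞) :
    ∫⁻ ξ, f ξ ∂weightMeasure N m = ∫⁻ ξ, ENNReal.ofReal (weight N m ξ) * f ξ :=
  lintegral_withDensity_eq_lintegral_mul_non_measurable _
    (measurable_weight N m).ennreal_ofReal (by simp) f

lemma nonneg_of_half_lt (hm : (N : ℝ) / 2 < m) : 0 ≤ m :=
  le_trans (by positivity) hm.le

lemma integrable_inv_weight (hm : (N : ℝ) / 2 < m) :
    Integrable fun ξ : E N => (weight N m ξ)⁻¹ := by
  have hdecay : Integrable fun ξ : E N => 2 ^ (2 * m) * (1 + ‖ξ‖) ^ (-(2 * m)) := by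
    refine (integrable_one_add_norm ?_).const_mul _
    rw [finrank_euclideanSpace, Fintype.card_fin]
    linarith
  refine hdecay.mono' (measurable_weight N m).inv.aestronglyMeasurable (.of_forall fun ξ => ?_)
  have hw := weight_pos N m ξ
  have hle : (1 + ‖ξ‖) ^ (2 * m) ≤ 2 ^ (2 * m) * weight N m ξ := by
    have hm0 := nonneg_of_half_lt hm
    simpa only [Real.one_rpow, weight] using
      add_rpow_le zero_le_one (norm_nonneg ξ) (by positivity : 0 ≤ 2 * m)
  rw [Real.norm_of_nonneg (by positivity), Real.rpow_neg (by positivity), ← div_eq_mul_inv,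
    inv_eq_one_div, div_le_div_iff₀ hw (by positivity), one_mul]
  exact hle

lemma le_mul_rpow_add_inv {t w p : ℝ} (ht : 0 ≤ t) (hw : 1 ≤ w) (hp1 : 1 ≤ p) (hp2 : p ≤ 2) :
    t ≤ w * t ^ p + w⁻¹ := by
  have : 0 < w := by positivity
  rcases le_total 1 t with h | h
  · calc t = 1 * t ^ (1 : ℝ) := by simp
      _ ≤ w * t ^ p := by gcongr
      _ ≤ w * t ^ p + w⁻¹ := le_add_of_nonneg_right (by positivity)
  · have hpow : t ^ 2 ≤ t ^ p := by
      rw [← Real.rpow_two]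
      exact Real.rpow_le_rpow_of_exponent_ge_of_imp ht h hp2 fun _ h0 => by linarith
    have hamgm : t ≤ w * t ^ 2 + w⁻¹ := by
      rw [← sub_nonneg]
      have : w * t ^ 2 + w⁻¹ - t = w * (t - w⁻¹ / 2) ^ 2 + 3 / 4 * w⁻¹ := by
        field_simp; ring
      rw [this]; positivity
    exact hamgm.trans (by gcongr)

lemma integrable_of_memLp_weightMeasure {F : Type*} [NormedAddCommGroup F]
    (hm : (N : ℝ) / 2 < m) {p : ℝ≥0∞} (hp1 : 1 ≤ p) (hp2 : p ≤ 2) {f : E N → F}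
    (hf : MemLp f p (weightMeasure N m)) : Integrable f := by
  have hp : p ≠ ⊤ := ne_top_of_le_ne_top (by norm_num) hp2
  have hpow : Integrable (fun ξ => ‖f ξ‖ ^ p.toReal) (weightMeasure N m) :=
    hf.integrable_norm_rpow (zero_lt_one.trans_le hp1).ne' hp
  rw [weightMeasure, integrable_withDensity_iff_integrable_smul'
    (measurable_weight N m).ennreal_ofReal (by simp)] at hpow
  refine (hpow.add (integrable_inv_weight hm)).mono'
    (hf.1.mono_ac volume_absolutelyContinuous_weightMeasure) (.of_forall fun ξ => ?_)
  rw [Pi.add_apply, ENNReal.toReal_ofReal (weight_pos N m ξ).le, smul_eq_mul]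
  exact le_mul_rpow_add_inv (norm_nonneg _) (one_le_weight N m ξ)
    (by simpa using ENNReal.toReal_mono hp hp1) (by simpa using ENNReal.toReal_mono (by simp) hp2)

lemma integrable_L2m {F : Type} [NormedAddCommGroup F] (hm : (N : ℝ) / 2 < m) (f : L2m N m F) :
    Integrable (f : E N → F) :=
  integrable_of_memLp_weightMeasure hm one_le_two le_rfl (Lp.memLp f)

end Weight

section StrongContinuity

lemma continuous_apply_of_dense {P X Y : Type*} [TopologicalSpace P] [NormedAddCommGroup X]
    [NormedSpace ℝ X] [NormedAddCommGroup Y] [NormedSpace ℝ Y] {T : P → X →L[ℝ] Y} {C : P → ℝ}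
    (hC : Continuous C) (hT : ∀ p, ‖T p‖ ≤ C p) {D : Set X} (hD : Dense D)
    (hcont : ∀ x ∈ D, Continuous fun p => T p x) (x : X) : Continuous fun p => T p x := by
  refine continuous_iff_continuousAt.2 fun p₀ => Metric.continuousAt_iff'.2 fun ε hε => ?_
  have : 0 < |C p₀| + 1 := by positivity
  obtain ⟨g, hgD, hxg⟩ := hD.exists_dist_lt x (show 0 < ε / (4 * (|C p₀| + 1)) by positivity)
  have hclose : ∀ p, C p < |C p₀| + 1 → dist (T p x) (T p g) ≤ ε / 4 := fun p hp => by
    rw [dist_eq_norm] at hxg ⊢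
    rw [← map_sub]
    calc ‖T p (x - g)‖ ≤ (|C p₀| + 1) * (ε / (4 * (|C p₀| + 1))) :=
          (T p).le_of_opNorm_le_of_le ((hT p).trans hp.le) hxg.le
      _ = ε / 4 := by field_simp
  have hCp₀ : C p₀ < |C p₀| + 1 := (le_abs_self _).trans_lt (lt_add_one _)
  filter_upwards [(hC.tendsto p₀).eventually_lt_const hCp₀,
    Metric.continuousAt_iff'.1 (hcont g hgD).continuousAt (ε / 4) (by positivity)] with p hp hgp
  calc dist (T p x) (T p₀ x) ≤ dist (T p x) (T p g) + dist (T p g) (T p₀ g)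
        + dist (T p₀ g) (T p₀ x) := dist_triangle4 ..
    _ < ε / 4 + ε / 4 + ε / 4 + ε / 4 := by
      linarith [hclose p hp, hclose p₀ hCp₀, dist_comm (T p₀ g) (T p₀ x)]
    _ = ε := by ring

end StrongContinuity

section Dilation

variable {N : ℕ} {m : ℝ} {F : Type} [NormedAddCommGroup F]

/-- The affine map `ξ ↦ β (ξ - y)`. Restricting to `β ≥ 1` makes composition with it bounded on
the weighted spaces, since the weight is radially increasing. -/
def affineDilation (β : Ici (1 : ℝ)) (y ξ : E N) : E N := (β : ℝ) • (ξ - y)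

lemma continuous_affineDilation (β : Ici (1 : ℝ)) (y : E N) : Continuous (affineDilation β y) := by
  unfold affineDilation; fun_prop

lemma coe_pos_of_one_le (β : Ici (1 : ℝ)) : 0 < (β : ℝ) := one_pos.trans_le β.2

lemma norm_sub_le_norm_affineDilation (β : Ici (1 : ℝ)) (y ξ : E N) :
    ‖ξ - y‖ ≤ ‖affineDilation β y ξ‖ := by
  rw [affineDilation, norm_smul, Real.norm_of_nonneg (coe_pos_of_one_le β).le]
  exact le_mul_of_one_le_left (norm_nonneg _) β.2

lemma map_affineDilation_volume (β : Ici (1 : ℝ)) (y : E N) :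
    Measure.map (affineDilation β y) volume = ENNReal.ofReal (((β : ℝ) ^ N)⁻¹) • volume := by
  have hβ := coe_pos_of_one_le β
  have hcomp : affineDilation β y = (fun ξ => (β : ℝ) • ξ) ∘ fun ξ => ξ - y := rfl
  rw [hcomp, ← Measure.map_map (by fun_prop) (by fun_prop),
    (measurePreserving_sub_right volume y).map_eq, Measure.map_addHaar_smul _ hβ.ne',
    finrank_euclideanSpace, Fintype.card_fin, abs_of_pos (by positivity)]

lemma integral_comp_affineDilation {G : Type*} [NormedAddCommGroup G] [NormedSpace ℝ G]
    (β : Ici (1 : ℝ)) (y : E N) (f : E N → G) :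
    ∫ ξ, f (affineDilation β y ξ) = ((β : ℝ) ^ N)⁻¹ • ∫ ξ, f ξ := by
  have hβ := coe_pos_of_one_le β
  simp only [affineDilation]
  rw [integral_sub_right_eq_self (μ := (volume : Measure (E N))) (fun ξ => f ((β : ℝ) • ξ)) y,
    Measure.integral_comp_smul, finrank_euclideanSpace, Fintype.card_fin,
    abs_of_pos (by positivity)]

lemma weight_le_mul_weight_affineDilation (hm : 0 ≤ m) (β : Ici (1 : ℝ)) (y ξ : E N) :
    weight N m ξ ≤ 2 ^ (2 * m) * weight N m y * weight N m (affineDilation β y ξ) :=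
  calc weight N m ξ = weight N m (y + (ξ - y)) := by rw [add_sub_cancel]
    _ ≤ 2 ^ (2 * m) * (weight N m y * weight N m (ξ - y)) := weight_add_le hm _ _
    _ = 2 ^ (2 * m) * weight N m y * weight N m (ξ - y) := by ring
    _ ≤ _ := by
      have := weight_pos N m y
      gcongr
      exact weight_mono hm (norm_sub_le_norm_affineDilation β y ξ)

lemma map_affineDilation_weightMeasure_le (hm : 0 ≤ m) (β : Ici (1 : ℝ)) (y : E N) :
    Measure.map (affineDilation β y) (weightMeasure N m)
      ≤ ENNReal.ofReal (2 ^ (2 * m) * weight N m y) • weightMeasure N m := by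
  have hA := (continuous_affineDilation β y).measurable
  set c := ENNReal.ofReal (2 ^ (2 * m) * weight N m y)
  refine Measure.le_iff.2 fun s hs => ?_
  let h : E N → ℝ≥0∞ := fun η => ENNReal.ofReal (weight N m η) * s.indicator 1 η
  have hh : Measurable h :=
    (measurable_weight N m).ennreal_ofReal.mul (measurable_one.indicator hs)
  rw [Measure.map_apply hA hs, Measure.smul_apply, smul_eq_mul, ← lintegral_indicator_one hs,
    ← lintegral_indicator_one (hA hs), lintegral_weightMeasure, lintegral_weightMeasure]
  calc ∫⁻ ξ, ENNReal.ofReal (weight N m ξ) * (affineDilation β y ⁻¹' s).indicator 1 ξ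
      ≤ ∫⁻ ξ, c * h (affineDilation β y ξ) := by
        refine lintegral_mono fun ξ => ?_
        have := weight_pos N m y
        simp only [h, c, ← mul_assoc]
        rw [← ENNReal.ofReal_mul (by positivity)]
        exact mul_le_mul' (ENNReal.ofReal_le_ofReal
          (weight_le_mul_weight_affineDilation hm β y ξ)) le_rfl
    _ = c * (ENNReal.ofReal ((β : ℝ) ^ N)⁻¹ * ∫⁻ η, h η) := by
        rw [lintegral_const_mul c (f := fun ξ => h (affineDilation β y ξ)) (hh.comp hA),
          ← lintegral_map hh hA, map_affineDilation_volume,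
          lintegral_smul_measure, smul_eq_mul]
    _ ≤ c * ∫⁻ η, h η := by
        gcongr
        exact mul_le_of_le_one_left' (ENNReal.ofReal_le_one.2
          (inv_le_one_of_one_le₀ (one_le_pow₀ β.2)))

lemma quasiMeasurePreserving_affineDilation (hm : 0 ≤ m) (β : Ici (1 : ℝ)) (y : E N) :
    Measure.QuasiMeasurePreserving (affineDilation β y) (weightMeasure N m) (weightMeasure N m) :=
  ⟨(continuous_affineDilation β y).measurable,
    Measure.absolutelyContinuous_of_le_smul (map_affineDilation_weightMeasure_le hm β y)⟩

lemma memLp_comp_affineDilation (hm : 0 ≤ m) (β : Ici (1 : ℝ)) (y : E N) {p : ℝ≥0∞} {f : E N → F}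
    (hf : MemLp f p (weightMeasure N m)) :
    MemLp (fun ξ => f (affineDilation β y ξ)) p (weightMeasure N m) :=
  (hf.of_measure_le_smul ENNReal.ofReal_ne_top
    (map_affineDilation_weightMeasure_le hm β y)).comp_of_map
      (continuous_affineDilation β y).measurable.aemeasurable

lemma eLpNorm_comp_affineDilation_le (hm : 0 ≤ m) (β : Ici (1 : ℝ)) (y : E N) {f : E N → F}
    (hf : MemLp f 2 (weightMeasure N m)) :
    eLpNorm (fun ξ => f (affineDilation β y ξ)) 2 (weightMeasure N m)
      ≤ ENNReal.ofReal (√(2 ^ (2 * m) * weight N m y)) * eLpNorm f 2 (weightMeasure N m) := by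
  have hle := map_affineDilation_weightMeasure_le hm β y
  have hmap := eLpNorm_le_of_measure_le_smul hle (f := f) (p := 2)
  rw [eLpNorm_map_measure (hf.of_measure_le_smul ENNReal.ofReal_ne_top hle).1
    (continuous_affineDilation β y).measurable.aemeasurable] at hmap
  refine hmap.trans_eq ?_
  have := weight_pos N m y
  rw [smul_eq_mul, Real.sqrt_eq_rpow, ← ENNReal.ofReal_rpow_of_pos (by positivity)]
  congr 2
  simp

variable [NormedSpace ℝ F]

/-- The operator `f ↦ f(β(· - y))` on `L²_m`. -/
def dilate (hm : 0 ≤ m) (β : Ici (1 : ℝ)) (y : E N) : L2m N m F →L[ℝ] L2m N m F :=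
  let D : L2m N m F → L2m N m F := fun f => (memLp_comp_affineDilation hm β y (Lp.memLp f)).toLp
  have hD (f : L2m N m F) : D f =ᵐ[weightMeasure N m] fun ξ => f (affineDilation β y ξ) :=
    (memLp_comp_affineDilation hm β y (Lp.memLp f)).coeFn_toLp
  have hae := quasiMeasurePreserving_affineDilation hm β y
  LinearMap.mkContinuous
    { toFun := D
      map_add' := fun f g => Lp.ext <| by
        filter_upwards [hD (f + g), hD f, hD g, Lp.coeFn_add (D f) (D g),
          hae.ae (Lp.coeFn_add f g)] with ξ h1 h2 h3 h4 h5
        rw [h1, h4, h5, Pi.add_apply, Pi.add_apply, h2, h3]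
      map_smul' := fun c f => Lp.ext <| by
        filter_upwards [hD (c • f), hD f, Lp.coeFn_smul c (D f),
          hae.ae (Lp.coeFn_smul c f)] with ξ h1 h2 h3 h4
        rw [RingHom.id_apply, h1, h3, h4, Pi.smul_apply, Pi.smul_apply, h2] }
    (√(2 ^ (2 * m) * weight N m y)) fun f => by
      have hle := eLpNorm_comp_affineDilation_le hm β y (Lp.memLp f)
      simp only [LinearMap.coe_mk, AddHom.coe_mk, D]
      rw [Lp.norm_toLp, Lp.norm_def, ← ENNReal.toReal_ofReal (Real.sqrt_nonneg _),
        ← ENNReal.toReal_mul]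
      exact ENNReal.toReal_mono (ENNReal.mul_ne_top ENNReal.ofReal_ne_top (Lp.eLpNorm_ne_top f)) hle

lemma coeFn_dilate (hm : 0 ≤ m) (β : Ici (1 : ℝ)) (y : E N) (f : L2m N m F) :
    dilate hm β y f =ᵐ[weightMeasure N m] fun ξ => f (affineDilation β y ξ) :=
  (memLp_comp_affineDilation hm β y (Lp.memLp f)).coeFn_toLp

lemma norm_dilate_le (hm : 0 ≤ m) (β : Ici (1 : ℝ)) (y : E N) :
    ‖(dilate hm β y : L2m N m F →L[ℝ] L2m N m F)‖ ≤ √(2 ^ (2 * m) * weight N m y) := by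
  unfold dilate
  exact LinearMap.mkContinuous_norm_le _ (Real.sqrt_nonneg _) _

lemma coeFn_dilate_of_ae_eq (hm : 0 ≤ m) (β : Ici (1 : ℝ)) (y : E N) {f : L2m N m F} {g : E N → F}
    (hfg : f =ᵐ[weightMeasure N m] g) :
    dilate hm β y f =ᵐ[weightMeasure N m] fun ξ => g (affineDilation β y ξ) :=
  (coeFn_dilate hm β y f).trans ((quasiMeasurePreserving_affineDilation hm β y).ae_eq_comp hfg)

omit [NormedSpace ℝ F] in
lemma support_comp_affineDilation_subset {g : E N → F} {R r : ℝ}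
    (hg : Function.support g ⊆ Metric.closedBall 0 R) (β : Ici (1 : ℝ)) {y : E N} (hy : ‖y‖ ≤ r) :
    Function.support (fun ξ => g (affineDilation β y ξ)) ⊆ Metric.closedBall 0 (R + r) :=
  fun ξ hξ => by
    have hξR := (norm_sub_le_norm_affineDilation β y ξ).trans (mem_closedBall_zero_iff.1 (hg hξ))
    rw [mem_closedBall_zero_iff]
    linarith [norm_sub_norm_le ξ y]

lemma continuous_dilate_of_hasCompactSupport (hm : 0 ≤ m) {g : E N → F} (hg : Continuous g)
    (hgc : HasCompactSupport g) {f : L2m N m F} (hfg : f =ᵐ[weightMeasure N m] g) :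
    Continuous fun p : Ici (1 : ℝ) × E N => dilate hm p.1 p.2 f := by
  have := isLocallyFiniteMeasure_weightMeasure (N := N) hm
  have hdil (p : Ici (1 : ℝ) × E N) := coeFn_dilate_of_ae_eq hm p.1 p.2 hfg
  refine continuous_iff_continuousAt.2 fun p₀ => Metric.continuousAt_iff'.2 fun ε hε => ?_
  obtain ⟨R, hR⟩ := hgc.isCompact.isBounded.exists_norm_le
  let K := Metric.closedBall (0 : E N) (R + (‖p₀.2‖ + 1))
  have hsupp (p : Ici (1 : ℝ) × E N) (hp : ‖p.2‖ ≤ ‖p₀.2‖ + 1) :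
      Function.support (fun ξ => g (affineDilation p.1 p.2 ξ)) ⊆ K :=
    support_comp_affineDilation_subset (fun ξ hξ =>
      mem_closedBall_zero_iff.2 (hR _ (subset_tsupport g hξ))) p.1 hp
  set V := weightMeasure N m K ^ (1 / (2 : ℝ≥0∞).toReal)
  have hV : V ≠ ⊤ := ENNReal.rpow_ne_top_of_nonneg (by positivity)
    (isCompact_closedBall _ _).measure_lt_top.ne
  obtain ⟨c, hc, hcV⟩ : ∃ c > 0, c * V.toReal < ε :=
    ⟨ε / (V.toReal + 1), by positivity, by
      rw [div_mul_eq_mul_div, div_lt_iff₀ (by positivity)]; nlinarith [V.toReal_nonneg]⟩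
  have hjoint : Continuous (Function.uncurry fun (p : Ici (1 : ℝ) × E N) (ξ : E N) =>
      g (affineDilation p.1 p.2 ξ)) := by
    unfold affineDilation; fun_prop
  obtain ⟨U, hU, hUK⟩ := (isCompact_closedBall _ _ : IsCompact K).mem_uniformity_of_prod
    (s := univ) hjoint.continuousOn (mem_univ p₀) (Metric.dist_mem_uniformity hc)
  rw [nhdsWithin_univ] at hU
  filter_upwards [hU, (continuous_snd.norm.tendsto p₀).eventually_le_const (lt_add_one _)]
    with p hpU hp
  have hp₀ : ‖p₀.2‖ ≤ ‖p₀.2‖ + 1 := by linarith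
  have hdist (ξ : E N) :
      dist (g (affineDilation p.1 p.2 ξ)) (g (affineDilation p₀.1 p₀.2 ξ)) ≤ c := by
    by_cases hξ : ξ ∈ K
    · exact (hUK p hpU ξ hξ).le
    · rw [Function.notMem_support.1 fun h => hξ (hsupp p hp h),
        Function.notMem_support.1 fun h => hξ (hsupp p₀ hp₀ h), dist_self]
      exact hc.le
  rw [dist_eq_norm, Lp.norm_def,
    eLpNorm_congr_ae ((Lp.coeFn_sub _ _).trans ((hdil p).sub (hdil p₀)))]
  refine (ENNReal.toReal_mono (by finiteness) (eLpNorm_sub_le_of_dist_bdd _ (by simp)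
    Metric.isClosed_closedBall.measurableSet hc.le hdist (hsupp p hp) (hsupp p₀ hp₀))).trans_lt ?_
  rwa [ENNReal.toReal_mul, ENNReal.toReal_ofReal hc.le]

lemma continuous_dilate (hm : 0 ≤ m) (f : L2m N m F) :
    Continuous fun p : Ici (1 : ℝ) × E N => dilate hm p.1 p.2 f := by
  have := isLocallyFiniteMeasure_weightMeasure (N := N) hm
  have hw := continuous_weight (N := N) hm
  have hC : Continuous fun p : Ici (1 : ℝ) × E N => √(2 ^ (2 * m) * weight N m p.2) := by fun_prop
  refine continuous_apply_of_dense hC (fun p => norm_dilate_le (F := F) hm p.1 p.2)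
    (Lp.dense_hasCompactSupport_contDiff (μ := weightMeasure N m) ENNReal.ofNat_ne_top) ?_ f
  rintro f ⟨g, hfg, hgc, hg⟩
  exact continuous_dilate_of_hasCompactSupport hm hg.continuous hgc hfg

end Dilation

section HeatKernel

variable {N : ℕ} {a b : ℝ}

/-- The heat kernel `(4πa)^{-N/2} e^{-|z|²/(4a)}` at time `a`. The kernel of `e^{τ𝓛}` is
`heatKernel (1 - e^{-τ}) (ξ - e^{-τ/2} η)`. -/
def heatKernel (a : ℝ) (z : E N) : ℝ :=
  (4 * Real.pi * a) ^ (-(N : ℝ) / 2) * Real.exp (-‖z‖ ^ 2 / (4 * a))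

lemma heatKernel_pos (ha : 0 < a) (z : E N) : 0 < heatKernel a z := by
  unfold heatKernel
  positivity

@[fun_prop]
lemma continuous_heatKernel (a : ℝ) : Continuous (heatKernel a : E N → ℝ) := by
  unfold heatKernel
  fun_prop

lemma norm_heatKernel_le (ha : 0 < a) (z : E N) :
    ‖heatKernel a z‖ ≤ (4 * Real.pi * a) ^ (-(N : ℝ) / 2) := by
  rw [Real.norm_of_nonneg (heatKernel_pos ha z).le, heatKernel]
  refine mul_le_of_le_one_right (by positivity) (Real.exp_le_one_iff.2 ?_)
  exact div_nonpos_of_nonpos_of_nonneg (by simp) (by positivity)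

lemma integral_exp_neg_norm_sq_div (hb : 0 < b) :
    ∫ z : E N, Real.exp (-‖z‖ ^ 2 / b) = (Real.pi * b) ^ ((N : ℝ) / 2) := by
  have h := GaussianFourier.integral_rexp_neg_mul_sq_norm (V := E N) (b := 1 / b) (by positivity)
  rw [finrank_euclideanSpace, Fintype.card_fin, div_div_eq_mul_div, div_one] at h
  rw [← h]
  congr 1 with z
  ring_nf

lemma integrable_exp_neg_norm_sq_div (hb : 0 < b) :
    Integrable fun z : E N => Real.exp (-‖z‖ ^ 2 / b) := by
  refine not_imp_comm.1 integral_undef ?_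
  rw [integral_exp_neg_norm_sq_div hb]
  positivity

lemma integrable_heatKernel (ha : 0 < a) : Integrable (heatKernel a : E N → ℝ) :=
  (integrable_exp_neg_norm_sq_div (by positivity)).const_mul _

lemma integral_heatKernel (ha : 0 < a) : ∫ z : E N, heatKernel a z = 1 := by
  unfold heatKernel
  rw [integral_const_mul, integral_exp_neg_norm_sq_div (by positivity), neg_div,
    Real.rpow_neg (by positivity), show Real.pi * (4 * a) = 4 * Real.pi * a by ring]
  exact inv_mul_cancel₀ (by positivity)

lemma heatKernel_eq_rpow_mul (ha : 0 < a) (z : E N) :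
    heatKernel a z = a ^ (-(N : ℝ) / 2) * heatKernel 1 ((√a)⁻¹ • z) := by
  unfold heatKernel
  rw [norm_smul, norm_inv, Real.norm_of_nonneg (Real.sqrt_nonneg a), mul_pow, inv_pow,
    Real.sq_sqrt ha.le, Real.mul_rpow (by positivity) ha.le,
    show -((a)⁻¹ * ‖z‖ ^ 2) / (4 * 1) = -‖z‖ ^ 2 / (4 * a) by field_simp, mul_one]
  ring

lemma sqrt_pow_mul_rpow_neg_half (ha : 0 < a) (N : ℕ) : √a ^ N * a ^ (-(N : ℝ) / 2) = 1 := by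
  rw [← Real.rpow_natCast, Real.sqrt_eq_rpow, ← Real.rpow_mul ha.le, ← Real.rpow_add ha,
    show 1 / 2 * (N : ℝ) + -(N : ℝ) / 2 = 0 by ring, Real.rpow_zero]

lemma sqrt_pow_mul_heatKernel (ha : 0 < a) (z : E N) :
    √a ^ N * heatKernel a (√a • z) = heatKernel 1 z := by
  rw [heatKernel_eq_rpow_mul ha, inv_smul_smul₀ (Real.sqrt_ne_zero'.2 ha), ← mul_assoc,
    sqrt_pow_mul_rpow_neg_half ha, one_mul]

lemma norm_sq_div_add_norm_sq_div (ha : 0 < a) (hb : 0 < b) (α : ℝ) (x w : E N) :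
    ‖x - α • w‖ ^ 2 / (4 * a) + ‖w‖ ^ 2 / (4 * b)
      = ‖x‖ ^ 2 / (4 * (a + α ^ 2 * b))
        + ‖w - (α * b / (a + α ^ 2 * b)) • x‖ ^ 2 / (4 * (a * b / (a + α ^ 2 * b))) := by
  have : 0 < a + α ^ 2 * b := by positivity
  simp only [norm_sub_sq_real, real_inner_smul_right, norm_smul, mul_pow, Real.norm_eq_abs, sq_abs,
    real_inner_comm x w]
  field_simp
  ring

lemma heatKernel_mul_heatKernel (ha : 0 < a) (hb : 0 < b) (α : ℝ) (x w : E N) :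
    heatKernel a (x - α • w) * heatKernel b w
      = heatKernel (a + α ^ 2 * b) x
        * heatKernel (a * b / (a + α ^ 2 * b)) (w - (α * b / (a + α ^ 2 * b)) • x) := by
  have hsq := norm_sq_div_add_norm_sq_div ha hb α x w
  have : 0 < a + α ^ 2 * b := by positivity
  unfold heatKernel
  rw [mul_mul_mul_comm, mul_mul_mul_comm ((4 * Real.pi * (a + α ^ 2 * b)) ^ _), ← Real.exp_add,
    ← Real.exp_add, ← Real.mul_rpow (by positivity) (by positivity),
    ← Real.mul_rpow (by positivity) (by positivity)]
  congr 2
  · field_simp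
  · simp only [neg_div]
    linarith

lemma integral_heatKernel_mul_heatKernel (ha : 0 < a) (hb : 0 < b) (α : ℝ) (x : E N) :
    ∫ w, heatKernel a (x - α • w) * heatKernel b w = heatKernel (a + α ^ 2 * b) x := by
  simp only [heatKernel_mul_heatKernel ha hb]
  rw [integral_const_mul, integral_sub_right_eq_self (heatKernel (_ : ℝ)),
    integral_heatKernel (by positivity), mul_one]

lemma integrable_heatKernel_sub_smul_mul (ha : 0 < a) {f : E N → ℝ} (hf : Integrable f) (α : ℝ)
    (ξ : E N) : Integrable fun η => heatKernel a (ξ - α • η) * f η :=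
  hf.bdd_mul (by fun_prop) (Eventually.of_forall fun _ => norm_heatKernel_le ha _)

lemma integrable_prod_smul_comp_sub_smul {V : Type*} [NormedAddCommGroup V] [NormedSpace ℝ V]
    {k : E N → V} (hk : Integrable k) (hkc : Continuous k) {f : E N → ℝ} (hf : Integrable f)
    (α : ℝ) :
    Integrable (fun p : E N × E N => f p.2 • k (p.1 - α • p.2)) (volume.prod volume) := by
  have hmeas : AEStronglyMeasurable (fun p : E N × E N => f p.2 • k (p.1 - α • p.2))
      (volume.prod volume) :=
    hf.1.comp_snd.smul (Continuous.aestronglyMeasurable (by fun_prop))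
  refine (integrable_prod_iff' hmeas).2 ⟨Eventually.of_forall fun η =>
    (hk.comp_sub_right (α • η)).smul (f η), ?_⟩
  have hnorm : ∀ η, ∫ ξ, ‖f η • k (ξ - α • η)‖ = ‖f η‖ * ∫ z, ‖k z‖ := fun η => by
    simp only [norm_smul]
    rw [integral_const_mul, integral_sub_right_eq_self (‖k ·‖)]
  simpa only [hnorm] using hf.norm.mul_const _

lemma integrable_prod_heatKernel_sub_smul_mul (ha : 0 < a) {f : E N → ℝ} (hf : Integrable f)
    (α : ℝ) :
    Integrable (fun p : E N × E N => heatKernel a (p.1 - α • p.2) * f p.2)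
      (volume.prod volume) := by
  simpa only [smul_eq_mul, mul_comm] using
    integrable_prod_smul_comp_sub_smul (integrable_heatKernel ha) (continuous_heatKernel a) hf α

end HeatKernel

section GaussianBounds

variable {N : ℕ} {m a : ℝ}

lemma rpow_le_exp {t s : ℝ} (ht : 0 ≤ t) (hs : 0 ≤ s) :
    t ^ s ≤ Real.exp (2 * s ^ 2) * Real.exp (t ^ 2 / 8) := by
  calc t ^ s ≤ (Real.exp t) ^ s :=
        Real.rpow_le_rpow ht (by linarith [Real.add_one_le_exp t]) hs
    _ = Real.exp (t * s) := (Real.exp_mul t s).symm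
    _ ≤ Real.exp (2 * s ^ 2 + t ^ 2 / 8) := by
        refine Real.exp_le_exp.2 ?_
        nlinarith [sq_nonneg (t - 4 * s)]
    _ = _ := Real.exp_add _ _

lemma exists_one_add_norm_mul_weight_le_exp (N : ℕ) (hm : 0 ≤ m) : ∃ C, 0 < C ∧ ∀ z : E N,
    (1 + ‖z‖) * weight N m z ≤ C * Real.exp (‖z‖ ^ 2 / 8) := by
  refine ⟨4 * Real.exp (2 * (2 * m + 1) ^ 2), by positivity, fun z => ?_⟩
  have hpow : ∀ s, 0 ≤ s → s ≤ 2 * m + 1 →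
      ‖z‖ ^ s ≤ Real.exp (2 * (2 * m + 1) ^ 2) * Real.exp (‖z‖ ^ 2 / 8) := fun s hs hs' =>
    (rpow_le_exp (norm_nonneg z) hs).trans (by gcongr)
  have hsum : (1 + ‖z‖) * weight N m z
      = ‖z‖ ^ (0 : ℝ) + ‖z‖ ^ (1 : ℝ) + ‖z‖ ^ (2 * m) + ‖z‖ ^ (2 * m + 1) := by
    rw [Real.rpow_zero, Real.rpow_one, Real.rpow_add_one' (norm_nonneg z) (by linarith), weight]
    ring
  rw [hsum]
  linarith [hpow 0 le_rfl (by linarith), hpow 1 zero_le_one (by linarith),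
    hpow (2 * m) (by linarith) (by linarith), hpow (2 * m + 1) (by linarith) le_rfl]

lemma heatKernel_mul_exp (ha : 0 < a) (z : E N) :
    heatKernel a z * Real.exp (‖z‖ ^ 2 / (8 * a))
      = (4 * Real.pi * a) ^ (-(N : ℝ) / 2) * Real.exp (-‖z‖ ^ 2 / (8 * a)) := by
  rw [heatKernel, mul_assoc, ← Real.exp_add]
  congr 2
  field_simp
  ring

end GaussianBounds

section MehlerKernel

variable {N : ℕ} {σ τ : ℝ}

lemma one_sub_exp_neg_pos (hτ : 0 < τ) : 0 < 1 - Real.exp (-τ) :=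
  sub_pos.2 (Real.exp_lt_one_iff.2 (neg_neg_of_pos hτ))

lemma one_sub_exp_neg_le_one (τ : ℝ) : 1 - Real.exp (-τ) ≤ 1 :=
  sub_le_self 1 (Real.exp_nonneg _)

lemma kernelL_eq_heatKernel (τ : ℝ) (ξ η : E N) :
    kernelL τ ξ η = heatKernel (1 - Real.exp (-τ)) (ξ - Real.exp (-τ / 2) • η) := rfl

lemma expL_zero (f : E N → ℝ) : expL 0 f = f :=
  funext fun _ => if_pos rfl

lemma expL_of_pos (hτ : 0 < τ) (f : E N → ℝ) (ξ : E N) :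
    expL τ f ξ
      = ∫ η, heatKernel (1 - Real.exp (-τ)) (ξ - Real.exp (-τ / 2) • η) * f η :=
  if_neg hτ.ne'

lemma integral_kernelL_mul_kernelL (hσ : 0 < σ) (hτ : 0 < τ) (ξ η : E N) :
    ∫ ζ, kernelL σ ξ ζ * kernelL τ ζ η = kernelL (σ + τ) ξ η := by
  have hvar : 1 - Real.exp (-(σ + τ))
      = (1 - Real.exp (-σ)) + Real.exp (-σ / 2) ^ 2 * (1 - Real.exp (-τ)) := by
    rw [← Real.exp_nat_mul, mul_sub, ← Real.exp_add]
    push_cast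
    ring_nf
  have hscale : Real.exp (-(σ + τ) / 2) = Real.exp (-σ / 2) * Real.exp (-τ / 2) := by
    rw [← Real.exp_add]
    ring_nf
  simp only [kernelL_eq_heatKernel]
  rw [← integral_add_right_eq_self _ (Real.exp (-τ / 2) • η), hvar, hscale, mul_smul,
    ← integral_heatKernel_mul_heatKernel (one_sub_exp_neg_pos hσ) (one_sub_exp_neg_pos hτ)]
  simp only [smul_add, add_sub_cancel_right, sub_sub, add_comm]

lemma integrable_expL (hτ : 0 ≤ τ) {f : E N → ℝ} (hf : Integrable f) :
    Integrable (expL τ f) := by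
  rcases hτ.eq_or_lt with rfl | hτ
  · rwa [expL_zero]
  · simp_rw [funext (expL_of_pos hτ f)]
    exact (integrable_prod_heatKernel_sub_smul_mul (one_sub_exp_neg_pos hτ) hf _).integral_prod_left

lemma expL_congr_ae (hτ : 0 ≤ τ) {f g : E N → ℝ} (h : f =ᵐ[volume] g) :
    expL τ f =ᵐ[volume] expL τ g := by
  rcases hτ.eq_or_lt with rfl | hτ
  · rwa [expL_zero, expL_zero]
  · refine Eventually.of_forall fun ξ => ?_
    rw [expL_of_pos hτ, expL_of_pos hτ]
    exact integral_congr_ae (h.mono fun η hη => congrArg (_ * ·) hη)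

lemma expL_expL (hσ : 0 < σ) (hτ : 0 < τ) {f : E N → ℝ} (hf : Integrable f) :
    expL σ (expL τ f) = expL (σ + τ) f := by
  funext ξ
  have hInt : Integrable (Function.uncurry fun ζ η => kernelL σ ξ ζ * (kernelL τ ζ η * f η))
      (volume.prod volume) := by
    refine (integrable_prod_heatKernel_sub_smul_mul (one_sub_exp_neg_pos hτ) hf _).bdd_mul ?_
      (Eventually.of_forall fun p => norm_heatKernel_le (one_sub_exp_neg_pos hσ) _)
    simp only [kernelL_eq_heatKernel]
    exact Continuous.aestronglyMeasurable (by fun_prop)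
  calc expL σ (expL τ f) ξ
      = ∫ ζ, ∫ η, kernelL σ ξ ζ * (kernelL τ ζ η * f η) := by
        simp only [expL_of_pos hσ, expL_of_pos hτ, ← integral_const_mul, kernelL_eq_heatKernel]
    _ = ∫ η, ∫ ζ, kernelL σ ξ ζ * (kernelL τ ζ η * f η) := integral_integral_swap hInt
    _ = ∫ η, kernelL (σ + τ) ξ η * f η := by
        simp only [← mul_assoc, integral_mul_const, integral_kernelL_mul_kernelL hσ hτ]
    _ = expL (σ + τ) f ξ := (expL_of_pos (add_pos hσ hτ) f ξ).symm

end MehlerKernel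

section Sobolev

variable {N : ℕ} {m : ℝ}

lemma locallyIntegrable_L2m {F : Type} [NormedAddCommGroup F] (f : L2m N m F) :
    LocallyIntegrable f :=
  ((Lp.memLp f).mono_measure volume_le_weightMeasure).locallyIntegrable one_le_two

lemma IsWeakGradient.congr {v v' : E N → ℝ} {w w' : E N → E N} (h : IsWeakGradient v w)
    (hv : v' =ᵐ[volume] v) (hw : w' =ᵐ[volume] w) : IsWeakGradient v' w' := by
  intro φ hφ hφc e
  have hleft : ∫ ξ, v' ξ * fderiv ℝ φ ξ e = ∫ ξ, v ξ * fderiv ℝ φ ξ e :=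
    integral_congr_ae (hv.mono fun ξ hξ => by simp only [hξ])
  have hright : ∫ ξ, ⟪w' ξ, e⟫ * φ ξ = ∫ ξ, ⟪w ξ, e⟫ * φ ξ :=
    integral_congr_ae (hw.mono fun ξ hξ => by simp only [hξ])
  rw [hleft, hright, h φ hφ hφc e]

lemma IsWeakGradient.ae_eq {v : E N → ℝ} {w w' : E N → E N} (h : IsWeakGradient v w)
    (h' : IsWeakGradient v w') (hw : LocallyIntegrable w) (hw' : LocallyIntegrable w') :
    w =ᵐ[volume] w' := by
  refine ae_eq_of_integral_contDiff_smul_eq hw hw' fun φ hφ hφc => ext_inner_right ℝ fun e => ?_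
  have hinner {u : E N → E N} (hu : LocallyIntegrable u) :
      ⟪∫ ξ, φ ξ • u ξ, e⟫ = ∫ ξ, ⟪u ξ, e⟫ * φ ξ := by
    rw [real_inner_comm, ← integral_inner
      (hu.integrable_smul_left_of_hasCompactSupport hφ.continuous hφc)]
    simp only [real_inner_smul_right, real_inner_comm e, mul_comm]
  rw [hinner hw, hinner hw', ← neg_inj, ← h φ hφ hφc e, ← h' φ hφ hφc e]

lemma affineDilation_inv_smul_add (β : Ici (1 : ℝ)) (y ξ : E N) :
    (β : ℝ)⁻¹ • affineDilation β y ξ + y = ξ := by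
  rw [affineDilation, inv_smul_smul₀ (coe_pos_of_one_le β).ne', sub_add_cancel]

lemma fderiv_eq_mul_fderiv_affineDilation {φ : E N → ℝ} (hφ : Differentiable ℝ φ)
    (β : Ici (1 : ℝ)) (y ξ e : E N) :
    fderiv ℝ φ ξ e
      = β * fderiv ℝ (fun η => φ ((β : ℝ)⁻¹ • η + y)) (affineDilation β y ξ) e := by
  have hinner := ((hasFDerivAt_id (𝕜 := ℝ) (affineDilation β y ξ)).const_smul (β : ℝ)⁻¹).add_const y
  have hcomp := (hφ _).hasFDerivAt.comp _ hinner
  have hderiv : fderiv ℝ (fun η => φ ((β : ℝ)⁻¹ • η + y)) (affineDilation β y ξ) = _ := hcomp.fderiv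
  rw [hderiv]
  simp [affineDilation_inv_smul_add, mul_inv_cancel_left₀ (coe_pos_of_one_le β).ne']

lemma IsWeakGradient.comp_affineDilation {v : E N → ℝ} {w : E N → E N} (h : IsWeakGradient v w)
    (β : Ici (1 : ℝ)) (y : E N) :
    IsWeakGradient (fun ξ => v (affineDilation β y ξ))
      (fun ξ => (β : ℝ) • w (affineDilation β y ξ)) := by
  intro φ hφ hφc e
  have hβ := (coe_pos_of_one_le β).ne'
  let ψ : E N → ℝ := fun η => φ ((β : ℝ)⁻¹ • η + y)
  have hψ : ContDiff ℝ ∞ ψ := hφ.comp (by fun_prop)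
  have hψc : HasCompactSupport ψ := hφc.comp_homeomorph
    ((Homeomorph.smulOfNeZero (β : ℝ)⁻¹ (inv_ne_zero hβ)).trans (Homeomorph.addRight y))
  have hφψ (ξ : E N) : φ ξ = ψ (affineDilation β y ξ) :=
    congrArg φ (affineDilation_inv_smul_add β y ξ).symm
  have hder := fderiv_eq_mul_fderiv_affineDilation (hφ.differentiable (by simp)) β y
  calc ∫ ξ, v (affineDilation β y ξ) * fderiv ℝ φ ξ e
      = β * ∫ ξ, v (affineDilation β y ξ) * fderiv ℝ ψ (affineDilation β y ξ) e := by
        rw [← integral_const_mul]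
        simp only [hder, mul_left_comm, ψ]
    _ = -(β * ∫ ξ, ⟪w (affineDilation β y ξ), e⟫ * ψ (affineDilation β y ξ)) := by
        rw [integral_comp_affineDilation β y (fun η => v η * fderiv ℝ ψ η e),
          integral_comp_affineDilation β y (fun η => ⟪w η, e⟫ * ψ η), h ψ hψ hψc e, smul_neg,
          mul_neg]
    _ = -∫ ξ, ⟪(β : ℝ) • w (affineDilation β y ξ), e⟫ * φ ξ := by
        rw [← integral_const_mul]
        simp only [real_inner_smul_left, hφψ, mul_assoc]

variable (N m) in
/-- The inclusion of `H¹_m` into `L²_m`; `H1m.fn v` is its value as a function. -/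
def H1m.fnL : H1m N m →L[ℝ] L2m N m ℝ :=
  WithLp.fstL 2 ℝ _ _ ∘L (H1m N m).subtypeL

variable (N m) in
/-- The weak gradient `H¹_m → L²_m`; `H1m.grad v` is its value as a function. -/
def H1m.gradL : H1m N m →L[ℝ] L2m N m (E N) :=
  WithLp.sndL 2 ℝ _ _ ∘L (H1m N m).subtypeL

lemma H1m.norm_sq_eq (v : H1m N m) : ‖v‖ ^ 2 = ‖H1m.fnL N m v‖ ^ 2 + ‖H1m.gradL N m v‖ ^ 2 :=
  WithLp.prod_norm_sq_eq_of_L2 _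

lemma H1m.norm_gradL_le (v : H1m N m) : ‖H1m.gradL N m v‖ ≤ ‖v‖ :=
  (sq_le_sq₀ (norm_nonneg _) (norm_nonneg v)).1
    (by linarith [H1m.norm_sq_eq v, sq_nonneg ‖H1m.fnL N m v‖])

lemma H1m.ext_fn {v w : H1m N m} (h : H1m.fn v =ᵐ[volume] H1m.fn w) : v = w := by
  have hgrad : H1m.grad v =ᵐ[volume] H1m.grad w :=
    (v.2.congr h.symm .rfl : IsWeakGradient (H1m.fn w) (H1m.grad v)).ae_eq w.2
      (locallyIntegrable_L2m _) (locallyIntegrable_L2m _)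
  have hae := (weightMeasure_absolutelyContinuous_volume (N := N) (m := m)).ae_le
  exact Subtype.ext ((WithLp.equiv 2 _).injective
    (Prod.ext (Lp.ext (hae h)) (Lp.ext (hae hgrad))))

lemma isWeakGradient_dilate (hm : 0 ≤ m) (β : Ici (1 : ℝ)) (y : E N) (v : H1m N m) :
    IsWeakGradient (dilate hm β y (H1m.fnL N m v))
      ((β : ℝ) • dilate hm β y (H1m.gradL N m v) : L2m N m (E N)) := by
  have hae := (volume_absolutelyContinuous_weightMeasure (N := N) (m := m)).ae_le
  refine (v.2.comp_affineDilation β y).congr (hae (coeFn_dilate hm β y _)) (hae ?_)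
  filter_upwards [Lp.coeFn_smul (β : ℝ) (dilate hm β y (H1m.gradL N m v)),
    coeFn_dilate hm β y (H1m.gradL N m v)] with ξ hsmul hdil
  rw [hsmul, Pi.smul_apply, hdil]
  rfl

/-- The operator `v ↦ v(β(· - y))` on `H¹_m`. -/
def dilateH1 (hm : 0 ≤ m) (β : Ici (1 : ℝ)) (y : E N) : H1m N m →L[ℝ] H1m N m :=
  ((WithLp.prodContinuousLinearEquiv 2 ℝ _ _).symm.toContinuousLinearMap ∘L
    (dilate hm β y ∘L H1m.fnL N m).prod
      ((β : ℝ) • dilate hm β y ∘L H1m.gradL N m)).codRestrict _ (isWeakGradient_dilate hm β y)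

lemma fnL_dilateH1 (hm : 0 ≤ m) (β : Ici (1 : ℝ)) (y : E N) (v : H1m N m) :
    H1m.fnL N m (dilateH1 hm β y v) = dilate hm β y (H1m.fnL N m v) := rfl

lemma gradL_dilateH1 (hm : 0 ≤ m) (β : Ici (1 : ℝ)) (y : E N) (v : H1m N m) :
    H1m.gradL N m (dilateH1 hm β y v) = (β : ℝ) • dilate hm β y (H1m.gradL N m v) := rfl

lemma norm_dilateH1_apply_le (hm : 0 ≤ m) (β : Ici (1 : ℝ)) (y : E N) (v : H1m N m) :
    ‖dilateH1 hm β y v‖ ≤ β * √(2 ^ (2 * m) * weight N m y) * ‖v‖ := by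
  have hβ : (1 : ℝ) ≤ β := β.2
  set c := √(2 ^ (2 * m) * weight N m y)
  have hfn : ‖dilate hm β y (H1m.fnL N m v)‖ ≤ β * (c * ‖H1m.fnL N m v‖) :=
    (ContinuousLinearMap.le_of_opNorm_le _ (norm_dilate_le hm β y) _).trans
      (le_mul_of_one_le_left (by positivity) hβ)
  have hgrad : ‖(β : ℝ) • dilate hm β y (H1m.gradL N m v)‖ ≤ β * (c * ‖H1m.gradL N m v‖) := by
    rw [norm_smul, Real.norm_of_nonneg (coe_pos_of_one_le β).le]
    gcongr
    exact ContinuousLinearMap.le_of_opNorm_le _ (norm_dilate_le hm β y) _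
  refine le_of_sq_le_sq ?_ (by positivity)
  rw [H1m.norm_sq_eq, fnL_dilateH1, gradL_dilateH1, mul_pow, H1m.norm_sq_eq v]
  calc _ ≤ (β * (c * ‖H1m.fnL N m v‖)) ^ 2 + (β * (c * ‖H1m.gradL N m v‖)) ^ 2 := by gcongr
    _ = _ := by ring

lemma continuous_dilateH1 (hm : 0 ≤ m) (v : H1m N m) :
    Continuous fun p : Ici (1 : ℝ) × E N => dilateH1 hm p.1 p.2 v :=
  Continuous.subtype_mk ((WithLp.prod_continuous_toLp 2 _ _).comp
    ((continuous_dilate hm (H1m.fnL N m v)).prodMk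
      ((continuous_subtype_val.comp continuous_fst).smul
        (continuous_dilate hm (H1m.gradL N m v))))) _

lemma dilateH1_one_zero (hm : 0 ≤ m) (v : H1m N m) :
    dilateH1 hm ⟨1, self_mem_Ici⟩ (0 : E N) v = v := by
  refine H1m.ext_fn ((volume_absolutelyContinuous_weightMeasure (m := m)).ae_le
    ((coeFn_dilate hm _ 0 (H1m.fnL N m v)).trans (Eventually.of_forall fun ξ => ?_)))
  simp only [affineDilation, one_smul, sub_zero]
  rfl

end Sobolev

section HeatSemigroup

variable {N : ℕ} {m : ℝ}

lemma integrable_heatKernel_mul_sqrt_weight (hm : 0 ≤ m) :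
    Integrable fun z : E N => heatKernel 1 z * √(2 ^ (2 * m) * weight N m z) := by
  obtain ⟨C, _, hC⟩ := exists_one_add_norm_mul_weight_le_exp N hm
  have hw := continuous_weight (N := N) hm
  have hdom : Integrable fun z : E N => 2 ^ (2 * m) * C *
      ((4 * Real.pi * 1) ^ (-(N : ℝ) / 2) * Real.exp (-‖z‖ ^ 2 / (8 * 1))) :=
    ((integrable_exp_neg_norm_sq_div (by norm_num)).const_mul _).const_mul _
  refine hdom.mono' (Continuous.aestronglyMeasurable (by fun_prop))
    (Eventually.of_forall fun z => ?_)
  have hG := (heatKernel_pos one_pos z).le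
  have hw1 := one_le_weight N m z
  have h2m : (1 : ℝ) ≤ 2 ^ (2 * m) := Real.one_le_rpow one_le_two (by positivity)
  have hwC : weight N m z ≤ C * Real.exp (‖z‖ ^ 2 / 8) :=
    (le_mul_of_one_le_left (by positivity) (by linarith [norm_nonneg z])).trans (hC z)
  rw [← heatKernel_mul_exp one_pos, mul_one, Real.norm_of_nonneg (by positivity)]
  calc heatKernel 1 z * √(2 ^ (2 * m) * weight N m z)
      ≤ heatKernel 1 z * (2 ^ (2 * m) * (C * Real.exp (‖z‖ ^ 2 / 8))) := by
        gcongr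
        exact (Real.sqrt_le_self_iff.2
          (Or.inr (one_le_mul_of_one_le_of_one_le h2m hw1))).trans (by gcongr)
    _ = _ := by ring

/-- The factor `e^{τ/2}` by which `e^{τ𝓛}` dilates. -/
def dilationFactor (τ : ℝ≥0) : Ici (1 : ℝ) :=
  ⟨Real.exp (τ / 2), Real.one_le_exp (by positivity)⟩

@[fun_prop]
lemma continuous_dilationFactor : Continuous dilationFactor :=
  Continuous.subtype_mk (by fun_prop) _

/-- Substituting `η = e^{τ/2} (ξ - √a(τ) z)` in the kernel representation writes `e^{τ𝓛} v` as the
integral over `z` of this `H¹_m`-valued function. -/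
def heatIntegrand (hm : 0 ≤ m) (τ : ℝ≥0) (v : H1m N m) (z : E N) : H1m N m :=
  (heatKernel 1 z * Real.exp (τ / 2) ^ N) •
    dilateH1 hm (dilationFactor τ) (√(1 - Real.exp (-τ)) • z) v

lemma continuous_heatIntegrand (hm : 0 ≤ m) (v : H1m N m) :
    Continuous fun p : ℝ≥0 × E N => heatIntegrand hm p.1 v p.2 := by
  have hdil := (continuous_dilateH1 hm v).comp (f := fun p : ℝ≥0 × E N =>
    (dilationFactor p.1, √(1 - Real.exp (-p.1)) • p.2)) (by fun_prop)
  have hscalar : Continuous fun p : ℝ≥0 × E N => heatKernel 1 p.2 * Real.exp (p.1 / 2) ^ N := by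
    fun_prop
  exact hscalar.smul hdil

lemma norm_heatIntegrand_le (hm : 0 ≤ m) (τ : ℝ≥0) (v : H1m N m) (z : E N) :
    ‖heatIntegrand hm τ v z‖ ≤ Real.exp (τ / 2) ^ (N + 1) * ‖v‖ *
      (heatKernel 1 z * √(2 ^ (2 * m) * weight N m z)) := by
  have hG := (heatKernel_pos one_pos z).le
  have hweight : weight N m (√(1 - Real.exp (-τ)) • z) ≤ weight N m z := by
    refine weight_mono hm ?_
    rw [norm_smul, Real.norm_of_nonneg (Real.sqrt_nonneg _)]
    exact mul_le_of_le_one_left (norm_nonneg _)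
      (Real.sqrt_le_one.2 (one_sub_exp_neg_le_one τ))
  rw [heatIntegrand, norm_smul, Real.norm_of_nonneg (by positivity)]
  calc _ ≤ heatKernel 1 z * Real.exp (τ / 2) ^ N *
        (Real.exp (τ / 2) * √(2 ^ (2 * m) * weight N m z) * ‖v‖) := by
        gcongr
        exact (norm_dilateH1_apply_le hm _ _ v).trans (by gcongr; exact le_rfl)
    _ = _ := by ring

lemma integrable_heatIntegrand (hm : 0 ≤ m) (τ : ℝ≥0) (v : H1m N m) :
    Integrable (heatIntegrand hm τ v) :=
  have := secondCountableTopologyEither_of_left (E N) (H1m N m)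
  ((integrable_heatKernel_mul_sqrt_weight hm).const_mul _).mono'
    ((continuous_heatIntegrand hm v).comp (Continuous.prodMk_right τ)).aestronglyMeasurable
    (Eventually.of_forall (norm_heatIntegrand_le hm τ v))

/-- The semigroup `e^{τ𝓛}` on `H¹_m`, as a superposition of dilations and translations. -/
def heat (hm : 0 ≤ m) (τ : ℝ≥0) : H1m N m →L[ℝ] H1m N m :=
  LinearMap.mkContinuous
    { toFun := fun v => ∫ z, heatIntegrand hm τ v z
      map_add' := fun v w => by
        rw [← integral_add (integrable_heatIntegrand hm τ v) (integrable_heatIntegrand hm τ w)]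
        simp only [heatIntegrand, map_add, smul_add]
      map_smul' := fun c v => by
        rw [RingHom.id_apply, ← integral_smul]
        simp only [heatIntegrand, map_smul, smul_comm c] }
    (Real.exp (τ / 2) ^ (N + 1) * ∫ z : E N, heatKernel 1 z * √(2 ^ (2 * m) * weight N m z))
    fun v => by
      refine (norm_integral_le_of_norm_le
        ((integrable_heatKernel_mul_sqrt_weight hm).const_mul _)
        (Eventually.of_forall (norm_heatIntegrand_le hm τ v))).trans_eq ?_
      rw [integral_const_mul]
      ring

lemma heat_apply (hm : 0 ≤ m) (τ : ℝ≥0) (v : H1m N m) :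
    heat hm τ v = ∫ z, heatIntegrand hm τ v z := rfl

lemma dilationFactor_zero : dilationFactor 0 = ⟨1, self_mem_Ici⟩ :=
  Subtype.ext (by simp [dilationFactor])

lemma heat_zero (hm : 0 ≤ m) (v : H1m N m) : heat hm 0 v = v := by
  have hconst (z : E N) : heatIntegrand hm 0 v z = heatKernel 1 z • v := by
    simp [heatIntegrand, dilationFactor_zero, dilateH1_one_zero]
  simp only [heat_apply, hconst]
  rw [integral_smul_const, integral_heatKernel one_pos, one_smul]

lemma continuous_heat (hm : 0 ≤ m) (v : H1m N m) : Continuous fun τ => heat hm τ v := by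
  refine continuous_iff_continuousAt.2 fun τ₀ => ?_
  simp only [heat_apply]
  refine continuousAt_of_dominated (bound := fun z =>
    Real.exp ((τ₀ + 1 : ℝ≥0) / 2) ^ (N + 1) * ‖v‖ *
      (heatKernel 1 z * √(2 ^ (2 * m) * weight N m z)))
    (Eventually.of_forall fun τ => (integrable_heatIntegrand hm τ v).1) ?_
    ((integrable_heatKernel_mul_sqrt_weight hm).const_mul _)
    (Eventually.of_forall fun z =>
      ((continuous_heatIntegrand hm v).comp (Continuous.prodMk_left z)).continuousAt)
  filter_upwards [eventually_le_nhds (lt_add_one τ₀)] with τ hτ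
  refine Eventually.of_forall fun z => (norm_heatIntegrand_le hm τ v z).trans ?_
  have hG := (heatKernel_pos one_pos z).le
  gcongr

end HeatSemigroup

section HeatIdentification

variable {N : ℕ} {m : ℝ}

lemma integral_eq_mul_integral_comp_sub_smul {c : ℝ} (hc : 0 < c) (k : E N → ℝ) (x : E N) :
    ∫ η, k η = c ^ N * ∫ z, k (x - c • z) := by
  rw [Measure.integral_comp_smul (μ := volume) (fun z => k (x - z)),
    integral_sub_left_eq_self k volume x, finrank_euclideanSpace, Fintype.card_fin,
    abs_of_pos (by positivity), smul_eq_mul, mul_inv_cancel_left₀ (by positivity)]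

lemma expL_eq_integral_heatKernel_one {τ : ℝ≥0} (hτ : 0 < τ) (f : E N → ℝ) (ξ : E N) :
    expL τ f ξ = ∫ z, heatKernel 1 z * Real.exp (τ / 2) ^ N *
      f (affineDilation (dilationFactor τ) (√(1 - Real.exp (-τ)) • z) ξ) := by
  have ha := one_sub_exp_neg_pos (NNReal.coe_pos.2 hτ)
  have hinv : Real.exp (-τ / 2) = (Real.exp (τ / 2))⁻¹ := by rw [← Real.exp_neg, neg_div]
  have hdil (z : E N) : affineDilation (dilationFactor τ) (√(1 - Real.exp (-τ)) • z) ξ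
      = Real.exp (τ / 2) • ξ - (Real.exp (τ / 2) * √(1 - Real.exp (-τ))) • z := by
    rw [affineDilation, dilationFactor, smul_sub, smul_smul]
  rw [expL_of_pos (NNReal.coe_pos.2 hτ), integral_eq_mul_integral_comp_sub_smul
    (c := Real.exp (τ / 2) * √(1 - Real.exp (-τ))) (by positivity) _ (Real.exp (τ / 2) • ξ),
    ← integral_const_mul]
  refine integral_congr_ae (Eventually.of_forall fun z => ?_)
  simp only [hdil, smul_sub, smul_smul, hinv, inv_mul_cancel₀ (Real.exp_ne_zero _),
    inv_mul_cancel_left₀ (Real.exp_ne_zero _), one_smul, sub_sub_cancel,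
    ← sqrt_pow_mul_heatKernel ha z]
  ring

lemma integrable_prod_heatKernel_mul_comp_affineDilation {f : E N → ℝ} (hf : Integrable f)
    (hfm : StronglyMeasurable f) (β : Ici (1 : ℝ)) (s : ℝ) :
    Integrable (fun p : E N × E N => heatKernel 1 p.1 * (β : ℝ) ^ N *
      f (affineDilation β (s • p.1) p.2)) (volume.prod volume) := by
  have hβ := coe_pos_of_one_le β
  have hmap : Continuous fun p : E N × E N => affineDilation β (s • p.1) p.2 := by
    unfold affineDilation; fun_prop
  have hmeas : AEStronglyMeasurable (fun p : E N × E N => heatKernel 1 p.1 * (β : ℝ) ^ N *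
      f (affineDilation β (s • p.1) p.2)) (volume.prod volume) :=
    (Continuous.aestronglyMeasurable (by fun_prop)).mul
      (hfm.comp_measurable hmap.measurable).aestronglyMeasurable
  have hslice (z : E N) : Integrable fun ξ => f (affineDilation β (s • z) ξ) :=
    (hf.comp_smul hβ.ne').comp_sub_right (s • z)
  refine (integrable_prod_iff hmeas).2 ⟨Eventually.of_forall fun z =>
    (hslice z).const_mul (heatKernel 1 z * (β : ℝ) ^ N), ?_⟩
  have hnorm (z : E N) : ∫ ξ, ‖heatKernel 1 z * (β : ℝ) ^ N * f (affineDilation β (s • z) ξ)‖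
      = heatKernel 1 z * ∫ ξ, ‖f ξ‖ := by
    simp only [norm_mul, norm_pow, Real.norm_of_nonneg hβ.le,
      Real.norm_of_nonneg (heatKernel_pos one_pos z).le]
    rw [integral_const_mul, integral_comp_affineDilation β (s • z) (fun ξ => ‖f ξ‖), smul_eq_mul,
      mul_assoc, mul_inv_cancel_left₀ (by positivity)]
  simp only [hnorm]
  exact (integrable_heatKernel one_pos).mul_const _

lemma coeFn_fnL_heatIntegrand (hm : 0 ≤ m) (τ : ℝ≥0) (v : H1m N m) (z : E N) :
    H1m.fn (heatIntegrand hm τ v z) =ᵐ[volume] fun ξ => heatKernel 1 z * Real.exp (τ / 2) ^ N *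
      H1m.fn v (affineDilation (dilationFactor τ) (√(1 - Real.exp (-τ)) • z) ξ) := by
  refine (volume_absolutelyContinuous_weightMeasure (m := m)).ae_le ?_
  refine (Lp.coeFn_smul (heatKernel 1 z * Real.exp (τ / 2) ^ N) (dilate hm (dilationFactor τ)
    (√(1 - Real.exp (-τ)) • z) (H1m.fnL N m v))).trans ?_
  filter_upwards [coeFn_dilate hm (dilationFactor τ) (√(1 - Real.exp (-τ)) • z)
    (H1m.fnL N m v)] with ξ hξ
  rw [Pi.smul_apply, hξ, smul_eq_mul]
  rfl

lemma integral_mul_fn_heat (hm : 0 ≤ m) (τ : ℝ≥0) (v : H1m N m) {ψ : E N → ℝ}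
    (hψ : Continuous ψ) (hψc : HasCompactSupport ψ) :
    ∫ ξ, ψ ξ * H1m.fn (heat hm τ v) ξ = ∫ z, ∫ ξ, ψ ξ * (heatKernel 1 z * Real.exp (τ / 2) ^ N *
      H1m.fn v (affineDilation (dilationFactor τ) (√(1 - Real.exp (-τ)) • z) ξ)) := by
  obtain ⟨g, hg⟩ := exists_inner_eq_integral (m := m) ψ hψ hψc
  have htest (u : H1m N m) : ∫ ξ, ψ ξ * H1m.fn u ξ = innerSL ℝ g (H1m.fnL N m u) := by
    rw [innerSL_apply_apply, real_inner_comm, ← hg]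
    rfl
  rw [htest, heat_apply, ← ContinuousLinearMap.integral_comp_comm _
    (integrable_heatIntegrand hm τ v), ← ContinuousLinearMap.integral_comp_comm _
    ((H1m.fnL N m).integrable_comp (integrable_heatIntegrand hm τ v))]
  refine integral_congr_ae (Eventually.of_forall fun z => (htest _).symm.trans ?_)
  exact integral_congr_ae ((coeFn_fnL_heatIntegrand hm τ v z).mono fun ξ hξ => by simp only [hξ])

theorem fn_heat (hm : (N : ℝ) / 2 < m) (τ : ℝ≥0) (v : H1m N m) :
    H1m.fn (heat (nonneg_of_half_lt hm) τ v) =ᵐ[volume] expL τ (H1m.fn v) := by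
  have hm0 := nonneg_of_half_lt hm
  rcases eq_zero_or_pos τ with rfl | hτ
  · rw [heat_zero, NNReal.coe_zero, expL_zero]
  have hv : Integrable (H1m.fn v) := integrable_L2m hm (H1m.fnL N m v)
  refine ae_eq_of_integral_contDiff_smul_eq (locallyIntegrable_L2m (H1m.fnL N m _))
    (integrable_expL τ.coe_nonneg hv).locallyIntegrable fun ψ hψ hψc => ?_
  obtain ⟨C, hC⟩ := hψ.continuous.bounded_above_of_compact_support hψc
  have hprod := (integrable_prod_heatKernel_mul_comp_affineDilation hv
    (Lp.stronglyMeasurable (H1m.fnL N m v)) (dilationFactor τ) (√(1 - Real.exp (-τ)))).bdd_mul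
    (hψ.continuous.comp continuous_snd).aestronglyMeasurable
    (Eventually.of_forall fun p => hC p.2)
  simp only [smul_eq_mul]
  refine (integral_mul_fn_heat hm0 τ v hψ.continuous hψc).trans
    ((integral_integral_swap hprod).trans ?_)
  simp only [expL_eq_integral_heatKernel_one hτ, ← integral_const_mul]

lemma heat_add (hm : (N : ℝ) / 2 < m) (σ τ : ℝ≥0) (v : H1m N m) :
    heat (nonneg_of_half_lt hm) (σ + τ) v
      = heat (nonneg_of_half_lt hm) σ (heat (nonneg_of_half_lt hm) τ v) := by
  rcases eq_zero_or_pos σ with rfl | hσ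
  · rw [zero_add, heat_zero]
  rcases eq_zero_or_pos τ with rfl | hτ
  · rw [add_zero, heat_zero]
  have hv : Integrable (H1m.fn v) := integrable_L2m hm (H1m.fnL N m v)
  refine H1m.ext_fn ((fn_heat hm (σ + τ) v).trans ?_)
  rw [NNReal.coe_add, ← expL_expL (NNReal.coe_pos.2 hσ) (NNReal.coe_pos.2 hτ) hv]
  exact (expL_congr_ae σ.coe_nonneg (fn_heat hm τ v).symm).trans (fn_heat hm σ _).symm

end HeatIdentification

section WeakGradientIntegral

variable {N : ℕ}

lemma isWeakGradient_of_hasFDerivAt {u : E N → ℝ} {w : E N → E N}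
    (hu : ∀ ξ, HasFDerivAt u (innerSL ℝ (w ξ)) ξ) (hw : Continuous w) : IsWeakGradient u w := by
  intro φ hφ hc e
  have hu' : Differentiable ℝ u := fun ξ => (hu ξ).differentiableAt
  have hφ' : Continuous fun ξ => fderiv ℝ φ ξ e :=
    (hφ.continuous_fderiv (by simp)).clm_apply continuous_const
  have hderiv : ∀ ξ, ⟪w ξ, e⟫ = fderiv ℝ u ξ e := fun ξ => by
    rw [(hu ξ).fderiv, innerSL_apply_apply]
  have hint : Integrable fun ξ => ⟪w ξ, e⟫ * φ ξ :=
    ((hw.inner continuous_const).mul hφ.continuous).integrable_of_hasCompactSupport hc.mul_left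
  simp only [hderiv] at hint ⊢
  exact integral_mul_fderiv_eq_neg_fderiv_mul_of_integrable hint
    ((hu'.continuous.mul hφ').integrable_of_hasCompactSupport (hc.fderiv_apply ℝ e).mul_left)
    ((hu'.continuous.mul hφ.continuous).integrable_of_hasCompactSupport hc.mul_left)
    (fun ξ _ => hu' ξ) (fun ξ _ => hφ.differentiable (by simp) ξ)

lemma IsWeakGradient.integral {α : Type*} [MeasurableSpace α] {μ : Measure α} [SFinite μ]
    {u : α → E N → ℝ} {w : α → E N → E N} (h : ∀ η, IsWeakGradient (u η) (w η))
    (hu : Integrable (fun p : E N × α => u p.2 p.1) (volume.prod μ))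
    (hw : Integrable (fun p : E N × α => w p.2 p.1) (volume.prod μ)) :
    IsWeakGradient (fun ξ => ∫ η, u η ξ ∂μ) (fun ξ => ∫ η, w η ξ ∂μ) := by
  intro φ hφ hc e
  have hφ' : Continuous fun ξ => fderiv ℝ φ ξ e :=
    (hφ.continuous_fderiv (by simp)).clm_apply continuous_const
  obtain ⟨C, hC⟩ := hφ.continuous.bounded_above_of_compact_support hc
  obtain ⟨C', hC'⟩ := hφ'.bounded_above_of_compact_support (hc.fderiv_apply ℝ e)
  have hint : Integrable (Function.uncurry fun ξ η => u η ξ * fderiv ℝ φ ξ e) (volume.prod μ) :=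
    hu.mul_bdd hφ'.aestronglyMeasurable.comp_fst
      (Eventually.of_forall fun p => hC' p.1)
  have hint' : Integrable (Function.uncurry fun ξ η => ⟪w η ξ, e⟫ * φ ξ) (volume.prod μ) :=
    (hw.inner_const e).mul_bdd hφ.continuous.aestronglyMeasurable.comp_fst
      (Eventually.of_forall fun p => hC p.1)
  have hinner : ∀ᵐ ξ, ⟪∫ η, w η ξ ∂μ, e⟫ = ∫ η, ⟪w η ξ, e⟫ ∂μ :=
    hw.prod_right_ae.mono fun ξ hξ => by
      simp only [real_inner_comm e]
      exact (integral_inner hξ e).symm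
  calc ∫ ξ, (∫ η, u η ξ ∂μ) * fderiv ℝ φ ξ e
      = ∫ ξ, ∫ η, u η ξ * fderiv ℝ φ ξ e ∂μ := by simp only [integral_mul_const]
    _ = ∫ η, (∫ ξ, u η ξ * fderiv ℝ φ ξ e) ∂μ := integral_integral_swap hint
    _ = -∫ η, (∫ ξ, ⟪w η ξ, e⟫ * φ ξ) ∂μ := by simp only [h _ φ hφ hc e, integral_neg]
    _ = -∫ ξ, ∫ η, ⟪w η ξ, e⟫ * φ ξ ∂μ := by rw [integral_integral_swap hint']
    _ = -∫ ξ, ⟪∫ η, w η ξ ∂μ, e⟫ * φ ξ := by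
        congr 1
        refine integral_congr_ae (hinner.mono fun ξ hξ => ?_)
        simp only [hξ, integral_mul_const]

end WeakGradientIntegral

section GradientKernel

variable {N : ℕ} {m a τ : ℝ}

/-- The gradient of the heat kernel. -/
def gradHeatKernel (a : ℝ) (z : E N) : E N :=
  (heatKernel a z * (-2 / (4 * a))) • z

@[fun_prop]
lemma continuous_gradHeatKernel (a : ℝ) : Continuous (gradHeatKernel a : E N → E N) := by
  unfold gradHeatKernel
  fun_prop

lemma hasFDerivAt_heatKernel_sub (a : ℝ) (p ξ : E N) :
    HasFDerivAt (fun ξ => heatKernel a (ξ - p)) (innerSL ℝ (gradHeatKernel a (ξ - p))) ξ := by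
  rw [gradHeatKernel, map_smul]
  exact hasFDerivAt_gaussian _ _ p ξ

lemma norm_gradHeatKernel (ha : 0 < a) (z : E N) :
    ‖gradHeatKernel a z‖
      = a ^ (-((N : ℝ) + 1) / 2) * (‖(√a)⁻¹ • z‖ / 2 * heatKernel 1 ((√a)⁻¹ • z)) := by
  have hpow : a ^ (-((N : ℝ) + 1) / 2) = a ^ (-(N : ℝ) / 2) * (√a)⁻¹ := by
    rw [Real.sqrt_eq_rpow, ← Real.rpow_neg ha.le, ← Real.rpow_add ha]
    ring_nf
  have hsqrt : a⁻¹ = (√a)⁻¹ * (√a)⁻¹ := by rw [← mul_inv, Real.mul_self_sqrt ha.le]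
  have hfactor : ‖-2 / (4 * a)‖ = a⁻¹ / 2 := by
    rw [norm_div, norm_neg, Real.norm_two, Real.norm_of_nonneg (by positivity)]
    field_simp
    norm_num
  rw [gradHeatKernel, norm_smul, norm_mul, hfactor, Real.norm_of_nonneg (heatKernel_pos ha z).le,
    heatKernel_eq_rpow_mul ha, norm_smul, norm_inv, Real.norm_of_nonneg (Real.sqrt_nonneg a), hpow,
    hsqrt]
  ring

lemma norm_heatKernel_le_rpow_mul (ha : 0 < a) (ha1 : a ≤ 1) (z : E N) :
    ‖heatKernel a z‖
      ≤ a ^ (-((N : ℝ) + 1) / 2) * ((1 + ‖(√a)⁻¹ • z‖) * heatKernel 1 ((√a)⁻¹ • z)) := by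
  have hK := (heatKernel_pos one_pos ((√a)⁻¹ • z)).le
  rw [Real.norm_of_nonneg (heatKernel_pos ha z).le, heatKernel_eq_rpow_mul ha]
  refine mul_le_mul (Real.rpow_le_rpow_of_exponent_ge ha ha1 (by linarith)) ?_ hK (by positivity)
  exact le_mul_of_one_le_left hK (by simp)

lemma norm_gradHeatKernel_le_rpow_mul (ha : 0 < a) (z : E N) :
    ‖gradHeatKernel a z‖
      ≤ a ^ (-((N : ℝ) + 1) / 2) * ((1 + ‖(√a)⁻¹ • z‖) * heatKernel 1 ((√a)⁻¹ • z)) := by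
  rw [norm_gradHeatKernel ha]
  have hK := (heatKernel_pos one_pos ((√a)⁻¹ • z)).le
  gcongr
  linarith [norm_nonneg ((√a)⁻¹ • z)]

lemma exists_sqrt_weight_mul_heatKernel_le (N : ℕ) (hm : 0 ≤ m) : ∃ C : ℝ, 0 < C ∧
    ∀ a, 0 < a → a ≤ 1 → ∀ z : E N,
      √(weight N m z) * ((1 + ‖(√a)⁻¹ • z‖) * heatKernel 1 ((√a)⁻¹ • z))
        ≤ C * Real.exp (-‖z‖ ^ 2 / (8 * a)) := by
  obtain ⟨C, hC, hCle⟩ := exists_one_add_norm_mul_weight_le_exp N hm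
  refine ⟨C * (4 * Real.pi * 1) ^ (-(N : ℝ) / 2), by positivity, fun a ha ha1 z => ?_⟩
  have hnorm : ‖(√a)⁻¹ • z‖ = (√a)⁻¹ * ‖z‖ := by
    rw [norm_smul, norm_inv, Real.norm_of_nonneg (Real.sqrt_nonneg a)]
  have hzy : ‖z‖ ≤ ‖(√a)⁻¹ • z‖ := by
    rw [hnorm]
    exact le_mul_of_one_le_left (norm_nonneg z)
      ((one_le_inv₀ (Real.sqrt_pos.2 ha)).2 (Real.sqrt_le_one.2 ha1))
  have hweight : √(weight N m z) ≤ weight N m ((√a)⁻¹ • z) :=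
    ((Real.sqrt_le_left (weight_pos N m z).le).2
      (le_self_pow₀ (one_le_weight N m z) two_ne_zero)).trans (weight_mono hm hzy)
  have hgauss := heatKernel_mul_exp one_pos ((√a)⁻¹ • z)
  have hexp : -‖(√a)⁻¹ • z‖ ^ 2 / (8 * 1) = -‖z‖ ^ 2 / (8 * a) := by
    rw [hnorm, mul_pow, inv_pow, Real.sq_sqrt ha.le]
    field_simp
  rw [hexp, mul_one] at hgauss
  have hK := (heatKernel_pos one_pos ((√a)⁻¹ • z)).le
  set y := (√a)⁻¹ • z
  calc √(weight N m z) * ((1 + ‖y‖) * heatKernel 1 y)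
      ≤ weight N m y * ((1 + ‖y‖) * heatKernel 1 y) := by gcongr
    _ = (1 + ‖y‖) * weight N m y * heatKernel 1 y := by ring
    _ ≤ C * Real.exp (‖y‖ ^ 2 / 8) * heatKernel 1 y := mul_le_mul_of_nonneg_right (hCle y) hK
    _ = C * (heatKernel 1 y * Real.exp (‖y‖ ^ 2 / 8)) := by ring
    _ = _ := by rw [hgauss]; ring

lemma exists_sqrt_weight_mul_norm_kernel_le (N : ℕ) (hm : 0 ≤ m) : ∃ C : ℝ, 0 < C ∧
    ∀ a, 0 < a → a ≤ 1 → ∀ z : E N,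
      √(weight N m z) * ‖heatKernel a z‖
        ≤ C * a ^ (-((N : ℝ) + 1) / 2) * Real.exp (-‖z‖ ^ 2 / (8 * a)) ∧
      √(weight N m z) * ‖gradHeatKernel a z‖
        ≤ C * a ^ (-((N : ℝ) + 1) / 2) * Real.exp (-‖z‖ ^ 2 / (8 * a)) := by
  obtain ⟨C, hC, hCle⟩ := exists_sqrt_weight_mul_heatKernel_le N hm
  have hscale : ∀ a, 0 < a → a ≤ 1 → ∀ z : E N, ∀ t : ℝ,
      t ≤ a ^ (-((N : ℝ) + 1) / 2) * ((1 + ‖(√a)⁻¹ • z‖) * heatKernel 1 ((√a)⁻¹ • z)) →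
      √(weight N m z) * t
        ≤ C * a ^ (-((N : ℝ) + 1) / 2) * Real.exp (-‖z‖ ^ 2 / (8 * a)) := by
    intro a ha ha1 z t ht
    calc √(weight N m z) * t
        ≤ √(weight N m z) * (a ^ (-((N : ℝ) + 1) / 2) *
            ((1 + ‖(√a)⁻¹ • z‖) * heatKernel 1 ((√a)⁻¹ • z))) := by gcongr
      _ = a ^ (-((N : ℝ) + 1) / 2) * (√(weight N m z) *
            ((1 + ‖(√a)⁻¹ • z‖) * heatKernel 1 ((√a)⁻¹ • z))) := by ring
      _ ≤ a ^ (-((N : ℝ) + 1) / 2) * (C * Real.exp (-‖z‖ ^ 2 / (8 * a))) :=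
          mul_le_mul_of_nonneg_left (hCle a ha ha1 z) (by positivity)
      _ = _ := by ring
  exact ⟨C, hC, fun a ha ha1 z =>
    ⟨hscale a ha ha1 z _ (norm_heatKernel_le_rpow_mul ha ha1 z),
      hscale a ha ha1 z _ (norm_gradHeatKernel_le_rpow_mul ha z)⟩⟩

lemma integrable_gradHeatKernel (ha : 0 < a) (ha1 : a ≤ 1) :
    Integrable (gradHeatKernel a : E N → E N) := by
  obtain ⟨C, -, hCle⟩ := exists_sqrt_weight_mul_norm_kernel_le N (le_refl (0 : ℝ))
  refine Integrable.mono' ((integrable_exp_neg_norm_sq_div (b := 8 * a) (by positivity)).const_mul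
    (C * a ^ (-((N : ℝ) + 1) / 2))) (continuous_gradHeatKernel a).aestronglyMeasurable
    (Eventually.of_forall fun z => le_trans ?_ (hCle a ha ha1 z).2)
  exact le_mul_of_one_le_left (norm_nonneg _) (Real.one_le_sqrt.2 (one_le_weight N 0 z))

/-- The gradient of `e^{τ𝓛} f`, in which the derivatives fall on the kernel. -/
def gradExpL (τ : ℝ) (f : E N → ℝ) (ξ : E N) : E N :=
  ∫ η, f η • gradHeatKernel (1 - Real.exp (-τ)) (ξ - Real.exp (-τ / 2) • η)

lemma integrable_prod_smul_gradHeatKernel (hτ : 0 < τ) {f : E N → ℝ} (hf : Integrable f) :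
    Integrable (fun p : E N × E N =>
      f p.2 • gradHeatKernel (1 - Real.exp (-τ)) (p.1 - Real.exp (-τ / 2) • p.2))
      (volume.prod volume) :=
  integrable_prod_smul_comp_sub_smul
    (integrable_gradHeatKernel (one_sub_exp_neg_pos hτ) (one_sub_exp_neg_le_one τ))
    (continuous_gradHeatKernel _) hf _

lemma integrable_gradExpL (hτ : 0 < τ) {f : E N → ℝ} (hf : Integrable f) :
    Integrable (gradExpL τ f) :=
  (integrable_prod_smul_gradHeatKernel hτ hf).integral_prod_left

theorem isWeakGradient_expL (hτ : 0 < τ) {f : E N → ℝ} (hf : Integrable f) :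
    IsWeakGradient (expL τ f) (gradExpL τ f) := by
  rw [funext (expL_of_pos hτ f)]
  refine IsWeakGradient.integral (fun η => isWeakGradient_of_hasFDerivAt (fun ξ => ?_) ?_)
    (integrable_prod_heatKernel_sub_smul_mul (one_sub_exp_neg_pos hτ) hf _)
    (integrable_prod_smul_gradHeatKernel hτ hf)
  · rw [map_smul]
    exact (hasFDerivAt_heatKernel_sub _ _ ξ).mul_const (f η)
  · fun_prop

end GradientKernel

section Young

variable {α β : Type*} [MeasurableSpace α] [MeasurableSpace β] {p r s : ℝ}

lemma mul_eq_rpow_mul_rpow_mul_rpow (hp : 0 < p) (hps : p ≤ s) (hr : 0 < r) (hrs : r ≤ s)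
    (k t : ℝ≥0∞) :
    k * t = (k ^ r * t ^ p) ^ (1 / s) * (t ^ p) ^ (1 / p - 1 / s) * (k ^ r) ^ (1 / r - 1 / s) := by
  have hs : 0 < s := hp.trans_le hps
  have hroot : ∀ {u : ℝ}, 0 < u → u ≤ s → ∀ x : ℝ≥0∞,
      (x ^ u) ^ (1 / s) * (x ^ u) ^ (1 / u - 1 / s) = x := fun hu hus x => by
    rw [← ENNReal.rpow_add_of_nonneg _ _ (by positivity)
      (sub_nonneg.2 (one_div_le_one_div_of_le hu hus)), add_sub_cancel, one_div,
      ENNReal.rpow_rpow_inv hu.ne']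
  rw [ENNReal.mul_rpow_of_nonneg _ _ (by positivity)]
  nth_rw 1 [← hroot hr hrs k, ← hroot hp hps t]
  ring

lemma rpow_lintegral_mul_le {ν : Measure β} (hp : 0 < p) (hps : p ≤ s) (hr : 0 < r) (hrs : r ≤ s)
    (hprs : 1 / p + 1 / r = 1 + 1 / s) {k h : β → ℝ≥0∞} (hk : AEMeasurable k ν)
    (hh : AEMeasurable h ν) :
    (∫⁻ y, k y * h y ∂ν) ^ s
      ≤ (∫⁻ y, k y ^ r * h y ^ p ∂ν) * (∫⁻ y, h y ^ p ∂ν) ^ (s / p - 1)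
        * (∫⁻ y, k y ^ r ∂ν) ^ (s / r - 1) := by
  have hs : 0 < s := hp.trans_le hps
  have hholder := ENNReal.lintegral_prod_norm_pow_le (μ := ν) (Finset.univ : Finset (Fin 3))
    (f := ![fun y => k y ^ r * h y ^ p, fun y => h y ^ p, fun y => k y ^ r])
    (p := ![1 / s, 1 / p - 1 / s, 1 / r - 1 / s])
    (by
      intro i _
      fin_cases i
      exacts [(hk.pow_const r).mul (hh.pow_const p), hh.pow_const p, hk.pow_const r])
    (by
      simp only [Fin.sum_univ_three, Matrix.cons_val]
      linarith)
    (by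
      intro i _
      fin_cases i
      exacts [one_div_nonneg.2 hs.le, sub_nonneg.2 (one_div_le_one_div_of_le hp hps),
        sub_nonneg.2 (one_div_le_one_div_of_le hr hrs)])
  simp only [Fin.prod_univ_three, Matrix.cons_val,
    ← mul_eq_rpow_mul_rpow_mul_rpow hp hps hr hrs] at hholder
  refine (ENNReal.rpow_le_rpow hholder hs.le).trans_eq ?_
  rw [ENNReal.mul_rpow_of_nonneg _ _ hs.le, ENNReal.mul_rpow_of_nonneg _ _ hs.le]
  simp only [← ENNReal.rpow_mul]
  rw [one_div_mul_cancel hs.ne', ENNReal.rpow_one,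
    show (1 / p - 1 / s) * s = s / p - 1 by field_simp,
    show (1 / r - 1 / s) * s = s / r - 1 by field_simp]

theorem lintegral_rpow_lintegral_mul_le {μ : Measure α} {ν : Measure β} [SFinite μ] [SFinite ν]
    (hp : 0 < p) (hps : p ≤ s) (hr : 0 < r) (hrs : r ≤ s) (hprs : 1 / p + 1 / r = 1 + 1 / s)
    {κ : α → β → ℝ≥0∞} (hκ : Measurable (Function.uncurry κ)) {h : β → ℝ≥0∞}
    (hh : AEMeasurable h ν) {A B : ℝ≥0∞} (hA : ∀ x, ∫⁻ y, κ x y ^ r ∂ν ≤ A)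
    (hB : ∀ y, ∫⁻ x, κ x y ^ r ∂μ ≤ B) :
    ∫⁻ x, (∫⁻ y, κ x y * h y ∂ν) ^ s ∂μ
      ≤ A ^ (s / r - 1) * B * (∫⁻ y, h y ^ p ∂ν) ^ (s / p) := by
  have hsr : 0 ≤ s / r - 1 := sub_nonneg.2 ((one_le_div hr).2 hrs)
  have hsp : 0 ≤ s / p - 1 := sub_nonneg.2 ((one_le_div hp).2 hps)
  have hκ_right : ∀ x, Measurable (κ x) := fun x => hκ.comp measurable_prodMk_left
  have hκ_left : ∀ y, Measurable fun x => κ x y := fun y => hκ.comp measurable_prodMk_right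
  set H := ∫⁻ y, h y ^ p ∂ν
  have hmeas : AEMeasurable (fun z : α × β => κ z.1 z.2 ^ r * h z.2 ^ p) (μ.prod ν) :=
    (hκ.pow_const r).aemeasurable.mul (hh.pow_const p).comp_snd
  have hfubini : ∫⁻ x, ∫⁻ y, κ x y ^ r * h y ^ p ∂ν ∂μ ≤ B * H := by
    rw [lintegral_lintegral_swap hmeas, ← lintegral_const_mul'' _ (hh.pow_const p)]
    refine lintegral_mono fun y => ?_
    rw [lintegral_mul_const _ ((hκ_left y).pow_const r)]
    gcongr
    exact hB y
  calc ∫⁻ x, (∫⁻ y, κ x y * h y ∂ν) ^ s ∂μ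
      ≤ ∫⁻ x, (∫⁻ y, κ x y ^ r * h y ^ p ∂ν) * (H ^ (s / p - 1) * A ^ (s / r - 1)) ∂μ := by
        refine lintegral_mono fun x => (rpow_lintegral_mul_le hp hps hr hrs hprs
          (hκ_right x).aemeasurable hh).trans ?_
        rw [mul_assoc]
        gcongr
        exact hA x
    _ = (∫⁻ x, ∫⁻ y, κ x y ^ r * h y ^ p ∂ν ∂μ) * (H ^ (s / p - 1) * A ^ (s / r - 1)) :=
        lintegral_mul_const'' _ hmeas.lintegral_prod_right'
    _ ≤ B * H * (H ^ (s / p - 1) * A ^ (s / r - 1)) := by gcongr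
    _ = A ^ (s / r - 1) * B * (H * H ^ (s / p - 1)) := by ring
    _ = A ^ (s / r - 1) * B * H ^ (s / p) := by
        congr 1
        nth_rw 1 [← ENNReal.rpow_one H]
        rw [← ENNReal.rpow_add_of_nonneg _ _ zero_le_one hsp, add_sub_cancel]

end Young

section WeightedYoung

variable {N : ℕ} {m c : ℝ}

lemma sqrt_weight_le (hm : 0 ≤ m) (hc : 0 ≤ c) (hc1 : c ≤ 1) (ξ η : E N) :
    √(weight N m ξ) ≤ 2 ^ m * (√(weight N m (ξ - c • η)) * √(weight N m η)) := by
  have hnorm : ‖c • η‖ ≤ ‖η‖ := by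
    rw [norm_smul, Real.norm_of_nonneg hc]
    exact mul_le_of_le_one_left (norm_nonneg η) hc1
  have hweight : weight N m ξ ≤ (2 ^ m) ^ 2 * (weight N m (ξ - c • η) * weight N m η) := by
    have h := weight_add_le hm (ξ - c • η) (c • η)
    rw [sub_add_cancel, mul_comm 2 m, Real.rpow_mul zero_le_two, Real.rpow_two] at h
    refine h.trans ?_
    have := (weight_pos N m (ξ - c • η)).le
    gcongr
    exact weight_mono hm hnorm
  calc √(weight N m ξ) ≤ √((2 ^ m) ^ 2 * (weight N m (ξ - c • η) * weight N m η)) :=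
        Real.sqrt_le_sqrt hweight
    _ = _ := by
        rw [Real.sqrt_mul (by positivity), Real.sqrt_sq (by positivity),
          Real.sqrt_mul (weight_pos N m _).le]

lemma lintegral_comp_sub_smul (hc : 0 < c) {k : E N → ℝ≥0∞} (hk : Measurable k) (ξ : E N) :
    ∫⁻ η, k (ξ - c • η) = ENNReal.ofReal (c ^ N)⁻¹ * ∫⁻ z, k z := by
  have hmap := Measure.map_addHaar_smul (volume : Measure (E N)) hc.ne'
  rw [finrank_euclideanSpace, Fintype.card_fin, abs_of_pos (by positivity)] at hmap
  calc ∫⁻ η, k (ξ - c • η)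
      = ∫⁻ z, k (ξ - z) ∂(Measure.map (c • ·) volume) :=
        (lintegral_map (hk.comp (measurable_const_sub ξ)) (measurable_const_smul c)).symm
    _ = _ := by
        rw [hmap, lintegral_smul_measure, lintegral_sub_left_eq_self k, smul_eq_mul]

lemma ofReal_sqrt_weight_rpow_le {p : ℝ} (hp0 : 0 ≤ p) (hp2 : p ≤ 2) (ξ : E N) :
    ENNReal.ofReal √(weight N m ξ) ^ p ≤ ENNReal.ofReal (weight N m ξ) := by
  rw [ENNReal.ofReal_rpow_of_nonneg (Real.sqrt_nonneg _) hp0]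
  refine ENNReal.ofReal_le_ofReal ?_
  calc √(weight N m ξ) ^ p ≤ √(weight N m ξ) ^ (2 : ℝ) :=
        Real.rpow_le_rpow_of_exponent_le (Real.one_le_sqrt.2 (one_le_weight N m ξ)) hp2
    _ = weight N m ξ := by rw [Real.rpow_two, Real.sq_sqrt (weight_pos N m ξ).le]

lemma lintegral_sqrt_weight_mul_rpow_le {p : ℝ} (hp0 : 0 ≤ p) (hp2 : p ≤ 2) (f : E N → ℝ≥0∞) :
    ∫⁻ ξ, (ENNReal.ofReal √(weight N m ξ) * f ξ) ^ p ≤ ∫⁻ ξ, f ξ ^ p ∂weightMeasure N m := by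
  rw [lintegral_weightMeasure]
  refine lintegral_mono fun ξ => ?_
  rw [ENNReal.mul_rpow_of_nonneg _ _ hp0]
  gcongr
  exact ofReal_sqrt_weight_rpow_le hp0 hp2 ξ

lemma sqrt_weight_mul_lintegral_le (hm : 0 ≤ m) (hc : 0 ≤ c) (hc1 : c ≤ 1) (k f : E N → ℝ≥0∞)
    (ξ : E N) :
    ENNReal.ofReal √(weight N m ξ) * ∫⁻ η, k (ξ - c • η) * f η
      ≤ ENNReal.ofReal (2 ^ m) * ∫⁻ η, ENNReal.ofReal √(weight N m (ξ - c • η)) * k (ξ - c • η)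
        * (ENNReal.ofReal √(weight N m η) * f η) := by
  rw [← lintegral_const_mul' _ _ ENNReal.ofReal_ne_top,
    ← lintegral_const_mul' _ _ ENNReal.ofReal_ne_top]
  refine lintegral_mono fun η => ?_
  have hweight := ENNReal.ofReal_le_ofReal (sqrt_weight_le hm hc hc1 ξ η)
  rw [ENNReal.ofReal_mul (by positivity), ENNReal.ofReal_mul (by positivity)] at hweight
  calc _ ≤ _ * (k (ξ - c • η) * f η) := mul_le_mul_left hweight _
    _ = _ := by ring

lemma ofReal_weight_eq_sqrt_rpow_two (ξ : E N) :
    ENNReal.ofReal (weight N m ξ) = ENNReal.ofReal √(weight N m ξ) ^ (2 : ℝ) := by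
  rw [ENNReal.rpow_two, ← ENNReal.ofReal_pow (Real.sqrt_nonneg _),
    Real.sq_sqrt (weight_pos N m ξ).le]

lemma young_exponent_mem_Ioc {p r : ℝ} (hp1 : 1 ≤ p) (hp2 : p ≤ 2) (hpr : 1 / p + 1 / r = 3 / 2) :
    r ∈ Ioc 0 2 := by
  have hp0 : 0 < p := one_pos.trans_le hp1
  have hp_inv : 1 / 2 ≤ 1 / p ∧ 1 / p ≤ 1 :=
    ⟨one_div_le_one_div_of_le hp0 hp2, (div_le_one hp0).2 hp1⟩
  have hr0 : 0 < r := one_div_pos.1 (by linarith)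
  exact ⟨hr0, (one_div_le_one_div two_pos hr0).1 (by linarith)⟩

lemma mul_rpow_sub_one_mul (A I : ℝ≥0∞) {s : ℝ} (hs : 1 ≤ s) :
    (A * I) ^ (s - 1) * I = A ^ (s - 1) * I ^ s := by
  rw [ENNReal.mul_rpow_of_nonneg _ _ (sub_nonneg.2 hs), mul_assoc]
  nth_rw 2 [← ENNReal.rpow_one I]
  rw [← ENNReal.rpow_add_of_nonneg _ _ (sub_nonneg.2 hs) zero_le_one, sub_add_cancel]

lemma lintegral_sq_weight_le (hm : 0 ≤ m) (hc : 0 < c) (hc1 : c ≤ 1) {p r : ℝ} (hp1 : 1 ≤ p)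
    (hp2 : p ≤ 2) (hpr : 1 / p + 1 / r = 3 / 2) {k f : E N → ℝ≥0∞} (hk : Measurable k)
    (hf : AEMeasurable f) :
    ∫⁻ ξ, (∫⁻ η, k (ξ - c • η) * f η) ^ (2 : ℝ) ∂weightMeasure N m
      ≤ ENNReal.ofReal (2 ^ m) ^ (2 : ℝ) * (ENNReal.ofReal (c ^ N)⁻¹ ^ (2 / r - 1)
        * (∫⁻ z, (ENNReal.ofReal √(weight N m z) * k z) ^ r) ^ (2 / r)
        * (∫⁻ η, f η ^ p ∂weightMeasure N m) ^ (2 / p)) := by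
  have hp0 : 0 < p := one_pos.trans_le hp1
  obtain ⟨hr0, hr2⟩ := young_exponent_mem_Ioc hp1 hp2 hpr
  have hw : Measurable fun z : E N => ENNReal.ofReal √(weight N m z) :=
    (measurable_weight N m).sqrt.ennreal_ofReal
  set k' : E N → ℝ≥0∞ := fun z => ENNReal.ofReal √(weight N m z) * k z
  have hk' : Measurable k' := hw.mul hk
  set I := ∫⁻ z, k' z ^ r
  have hyoung := lintegral_rpow_lintegral_mul_le (μ := volume) (ν := volume) (s := 2)
    (κ := fun ξ η => k' (ξ - c • η)) hp0 hp2 hr0 hr2 (by linarith)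
    (hk'.comp (by fun_prop : Measurable fun z : E N × E N => z.1 - c • z.2))
    (hw.aemeasurable.mul hf) (fun ξ => (lintegral_comp_sub_smul hc (hk'.pow_const r) ξ).le)
    (fun η => (lintegral_sub_right_eq_self (fun z => k' z ^ r) (c • η)).le)
  rw [lintegral_weightMeasure]
  calc ∫⁻ ξ, ENNReal.ofReal (weight N m ξ) * (∫⁻ η, k (ξ - c • η) * f η) ^ (2 : ℝ)
      ≤ ∫⁻ ξ, ENNReal.ofReal (2 ^ m) ^ (2 : ℝ) * (∫⁻ η, k' (ξ - c • η) *
          (ENNReal.ofReal √(weight N m η) * f η)) ^ (2 : ℝ) := by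
        refine lintegral_mono fun ξ => ?_
        rw [ofReal_weight_eq_sqrt_rpow_two, ← ENNReal.mul_rpow_of_nonneg _ _ zero_le_two,
          ← ENNReal.mul_rpow_of_nonneg _ _ zero_le_two]
        exact ENNReal.rpow_le_rpow (sqrt_weight_mul_lintegral_le hm hc.le hc1 k f ξ) zero_le_two
    _ = ENNReal.ofReal (2 ^ m) ^ (2 : ℝ) * ∫⁻ ξ, (∫⁻ η, k' (ξ - c • η) *
          (ENNReal.ofReal √(weight N m η) * f η)) ^ (2 : ℝ) :=
        lintegral_const_mul' _ _ (by finiteness)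
    _ ≤ _ := by
        gcongr
        refine hyoung.trans ?_
        rw [mul_rpow_sub_one_mul _ _ ((one_le_div hr0).2 hr2)]
        exact mul_le_mul_right (ENNReal.rpow_le_rpow
          (lintegral_sqrt_weight_mul_rpow_le hp0.le hp2 f) (by positivity)) _

theorem eLpNorm_weightMeasure_le_of_enorm_le_lintegral (hm : 0 ≤ m) (hc : 0 < c) (hc1 : c ≤ 1)
    {p : ℝ≥0∞} {r : ℝ} (hp1 : 1 ≤ p) (hp2 : p ≤ 2) (hpr : 1 / p.toReal + 1 / r = 3 / 2)
    {F G : Type*} [NormedAddCommGroup F] [NormedAddCommGroup G] {k : E N → ℝ≥0∞}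
    (hk : Measurable k) {f : E N → F} (hf : AEStronglyMeasurable f) {g : E N → G}
    (hg : ∀ ξ, ‖g ξ‖ₑ ≤ ∫⁻ η, k (ξ - c • η) * ‖f η‖ₑ) :
    eLpNorm g 2 (weightMeasure N m)
      ≤ ENNReal.ofReal (2 ^ m) * (ENNReal.ofReal (c ^ N)⁻¹ ^ (1 / r - 1 / 2)
        * (∫⁻ z, (ENNReal.ofReal √(weight N m z) * k z) ^ r) ^ (1 / r)
        * eLpNorm f p (weightMeasure N m)) := by
  have hp_top : p ≠ ⊤ := ne_top_of_le_ne_top ENNReal.ofNat_ne_top hp2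
  have hp1' : 1 ≤ p.toReal := by
    simpa using ENNReal.toReal_mono hp_top hp1
  have hp2' : p.toReal ≤ 2 := ENNReal.toReal_le_of_le_ofReal zero_le_two (by simpa using hp2)
  have hsq : ∫⁻ ξ, ‖g ξ‖ₑ ^ (2 : ℝ) ∂weightMeasure N m ≤ _ :=
    (lintegral_mono fun ξ => ENNReal.rpow_le_rpow (hg ξ) zero_le_two).trans
      (lintegral_sq_weight_le hm hc hc1 hp1' hp2' hpr hk hf.enorm)
  rw [eLpNorm_eq_lintegral_rpow_enorm_toReal two_ne_zero ENNReal.ofNat_ne_top,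
    eLpNorm_eq_lintegral_rpow_enorm_toReal (one_pos.trans_le hp1).ne' hp_top,
    ENNReal.toReal_ofNat]
  refine (ENNReal.rpow_le_rpow hsq one_half_pos.le).trans_eq ?_
  simp only [ENNReal.mul_rpow_of_nonneg _ _ one_half_pos.le, ← ENNReal.rpow_mul]
  rw [mul_one_div_cancel two_ne_zero, ENNReal.rpow_one,
    show (2 / r - 1) * (1 / 2) = 1 / r - 1 / 2 by ring, show 2 / r * (1 / 2) = 1 / r by ring,
    show 2 / p.toReal * (1 / 2) = 1 / p.toReal by ring]

end WeightedYoung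

section SmoothingEstimate

variable {N : ℕ} {m b c r D : ℝ} {p : ℝ≥0∞}

lemma lintegral_gaussian_rpow_le (hD : 0 ≤ D) (hb : 0 < b) (hr : 1 ≤ r) :
    (∫⁻ z : E N, ENNReal.ofReal (D * Real.exp (-‖z‖ ^ 2 / b)) ^ r) ^ (1 / r)
      ≤ ENNReal.ofReal (D * ((Real.pi * b) ^ ((N : ℝ) / 2)) ^ (1 / r)) := by
  have hr0 : 0 < r := one_pos.trans_le hr
  have hexp (z : E N) : ENNReal.ofReal (Real.exp (-‖z‖ ^ 2 / b)) ≤ 1 :=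
    ENNReal.ofReal_le_one.2 (Real.exp_le_one_iff.2
      (div_nonpos_of_nonpos_of_nonneg (neg_nonpos.2 (sq_nonneg _)) hb.le))
  have hpow (z : E N) : ENNReal.ofReal (D * Real.exp (-‖z‖ ^ 2 / b)) ^ r
      ≤ ENNReal.ofReal D ^ r * ENNReal.ofReal (Real.exp (-‖z‖ ^ 2 / b)) := by
    rw [ENNReal.ofReal_mul hD, ENNReal.mul_rpow_of_nonneg _ _ hr0.le]
    exact mul_le_mul_right (ENNReal.rpow_le_self_of_le_one (hexp z) hr) _
  have hgauss : ∫⁻ z : E N, ENNReal.ofReal (Real.exp (-‖z‖ ^ 2 / b))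
      = ENNReal.ofReal ((Real.pi * b) ^ ((N : ℝ) / 2)) := by
    rw [← integral_exp_neg_norm_sq_div hb, ofReal_integral_eq_lintegral_ofReal
      (integrable_exp_neg_norm_sq_div hb) (.of_forall fun _ => (Real.exp_pos _).le)]
  calc (∫⁻ z : E N, ENNReal.ofReal (D * Real.exp (-‖z‖ ^ 2 / b)) ^ r) ^ (1 / r)
      ≤ (ENNReal.ofReal D ^ r * ENNReal.ofReal ((Real.pi * b) ^ ((N : ℝ) / 2))) ^ (1 / r) := by
        rw [← hgauss, ← lintegral_const_mul' _ _ (by finiteness)]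
        exact ENNReal.rpow_le_rpow (lintegral_mono hpow) (by positivity)
    _ = ENNReal.ofReal (D * ((Real.pi * b) ^ ((N : ℝ) / 2)) ^ (1 / r)) := by
        rw [ENNReal.mul_rpow_of_nonneg _ _ (by positivity), ← ENNReal.rpow_mul,
          mul_one_div_cancel hr0.ne', ENNReal.rpow_one, ENNReal.ofReal_mul hD,
          ENNReal.ofReal_rpow_of_nonneg (by positivity) (by positivity)]

lemma one_div_toReal_mem_Icc (hp1 : 1 ≤ p) (hp2 : p ≤ 2) :
    1 / p.toReal ∈ Icc (1 / 2 : ℝ) 1 := by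
  have hp_top : p ≠ ⊤ := ne_top_of_le_ne_top ENNReal.ofNat_ne_top hp2
  have hp1' : 1 ≤ p.toReal := by simpa using ENNReal.toReal_mono hp_top hp1
  have hp2' : p.toReal ≤ 2 := ENNReal.toReal_le_of_le_ofReal zero_le_two (by simpa using hp2)
  have hp0 : 0 < p.toReal := one_pos.trans_le hp1'
  exact ⟨one_div_le_one_div_of_le hp0 hp2', (div_le_one hp0).2 hp1'⟩

theorem eLpNorm_weightMeasure_le_of_kernel_le_gaussian (hm : 0 ≤ m) (hp1 : 1 ≤ p) (hp2 : p ≤ 2)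
    (hc : 0 < c) (hc1 : c ≤ 1) (hD : 0 ≤ D) (hb : 0 < b) {V F G : Type*} [NormedAddCommGroup V]
    [NormedAddCommGroup F] [NormedAddCommGroup G] {k : E N → V} (hk : Continuous k)
    (hkD : ∀ z, √(weight N m z) * ‖k z‖ ≤ D * Real.exp (-‖z‖ ^ 2 / b)) {f : E N → F}
    (hf : AEStronglyMeasurable f) {g : E N → G}
    (hg : ∀ ξ, ‖g ξ‖ₑ ≤ ∫⁻ η, ‖k (ξ - c • η)‖ₑ * ‖f η‖ₑ) :
    eLpNorm g 2 (weightMeasure N m)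
      ≤ ENNReal.ofReal (2 ^ m * ((c ^ N)⁻¹ ^ (1 - 1 / p.toReal)
          * (D * ((Real.pi * b) ^ ((N : ℝ) / 2)) ^ (3 / 2 - 1 / p.toReal))))
        * eLpNorm f p (weightMeasure N m) := by
  obtain ⟨hp_half, hp_one⟩ := one_div_toReal_mem_Icc hp1 hp2
  have hr : 1 ≤ (3 / 2 - 1 / p.toReal)⁻¹ := (one_le_inv₀ (by linarith)).2 (by linarith)
  have hyoung := eLpNorm_weightMeasure_le_of_enorm_le_lintegral hm hc hc1 hp1 hp2
    (r := (3 / 2 - 1 / p.toReal)⁻¹) (by rw [one_div (_⁻¹), inv_inv]; ring)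
    hk.enorm.measurable hf hg
  have hkernel : (∫⁻ z, (ENNReal.ofReal √(weight N m z) * ‖k z‖ₑ) ^ (3 / 2 - 1 / p.toReal)⁻¹)
      ^ (1 / (3 / 2 - 1 / p.toReal)⁻¹)
      ≤ ENNReal.ofReal (D * ((Real.pi * b) ^ ((N : ℝ) / 2)) ^ (1 / (3 / 2 - 1 / p.toReal)⁻¹)) := by
    refine le_trans (ENNReal.rpow_le_rpow (lintegral_mono fun z => ENNReal.rpow_le_rpow ?_
      (by positivity)) (by positivity)) (lintegral_gaussian_rpow_le hD hb hr)
    rw [← ofReal_norm, ← ENNReal.ofReal_mul (Real.sqrt_nonneg _)]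
    exact ENNReal.ofReal_le_ofReal (hkD z)
  rw [one_div (_⁻¹), inv_inv] at hyoung hkernel
  refine hyoung.trans ?_
  rw [show 3 / 2 - 1 / p.toReal - 1 / 2 = 1 - 1 / p.toReal by ring,
    ENNReal.ofReal_rpow_of_nonneg (by positivity) (by linarith), ENNReal.ofReal_mul (by positivity),
    ENNReal.ofReal_mul (by positivity), ← mul_assoc]
  gcongr

/-- The rate of the estimate for `e^{τ𝓛}` from the weighted `L^p` space to `H¹_m`: as `τ → 0` the
norm grows no faster than `τ ^ (-(1/2 + (N/2)(1/p - 1/2)))`. -/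
def smoothingRate (N : ℕ) (p : ℝ≥0∞) (τ : ℝ) : ℝ :=
  Real.exp (τ / 2) ^ N * (1 - Real.exp (-τ)) ^ (-(1 / 2 + (N : ℝ) / 2 * (1 / p.toReal - 1 / 2)))

lemma smoothingRate_nonneg {τ : ℝ} (hτ : 0 < τ) : 0 ≤ smoothingRate N p τ := by
  have := one_sub_exp_neg_pos hτ
  unfold smoothingRate
  positivity

lemma kernelConst_le_smoothingRate (hp1 : 1 ≤ p) (hp2 : p ≤ 2) {τ : ℝ} (hτ : 0 < τ) :
    (Real.exp (-τ / 2) ^ N)⁻¹ ^ (1 - 1 / p.toReal) * ((1 - Real.exp (-τ)) ^ (-((N : ℝ) + 1) / 2)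
        * ((Real.pi * (8 * (1 - Real.exp (-τ)))) ^ ((N : ℝ) / 2)) ^ (3 / 2 - 1 / p.toReal))
      ≤ ((Real.pi * 8) ^ ((N : ℝ) / 2)) ^ (3 / 2 - 1 / p.toReal) * smoothingRate N p τ := by
  obtain ⟨_, _⟩ := one_div_toReal_mem_Icc hp1 hp2
  have ha := one_sub_exp_neg_pos hτ
  have hinv : (Real.exp (-τ / 2) ^ N)⁻¹ = Real.exp (τ / 2) ^ N := by
    rw [← inv_pow, ← Real.exp_neg, neg_div, neg_neg]
  have hexp : (Real.exp (τ / 2) ^ N) ^ (1 - 1 / p.toReal) ≤ Real.exp (τ / 2) ^ N :=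
    Real.rpow_le_self_of_one_le (one_le_pow₀ (Real.one_le_exp (by positivity))) (by linarith)
  rw [hinv, smoothingRate]
  generalize 1 - Real.exp (-τ) = a at ha ⊢
  have hpow : a ^ (-((N : ℝ) + 1) / 2)
      * ((Real.pi * (8 * a)) ^ ((N : ℝ) / 2)) ^ (3 / 2 - 1 / p.toReal)
      = ((Real.pi * 8) ^ ((N : ℝ) / 2)) ^ (3 / 2 - 1 / p.toReal)
        * a ^ (-(1 / 2 + (N : ℝ) / 2 * (1 / p.toReal - 1 / 2))) := by
    rw [← mul_assoc Real.pi, Real.mul_rpow (by positivity) ha.le,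
      Real.mul_rpow (by positivity) (by positivity), ← Real.rpow_mul ha.le, mul_left_comm,
      ← Real.rpow_add ha]
    ring_nf
  rw [hpow, mul_left_comm]
  gcongr

theorem exists_eLpNorm_expL_le (N : ℕ) (hm : 0 ≤ m) (hp1 : 1 ≤ p) (hp2 : p ≤ 2) :
    ∃ C : ℝ, 0 ≤ C ∧ ∀ τ, 0 < τ → ∀ f : E N → ℝ, AEStronglyMeasurable f →
      eLpNorm (expL τ f) 2 (weightMeasure N m)
        ≤ ENNReal.ofReal (C * smoothingRate N p τ) * eLpNorm f p (weightMeasure N m) ∧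
      eLpNorm (gradExpL τ f) 2 (weightMeasure N m)
        ≤ ENNReal.ofReal (C * smoothingRate N p τ) * eLpNorm f p (weightMeasure N m) := by
  obtain ⟨C, hC, hCle⟩ := exists_sqrt_weight_mul_norm_kernel_le N hm
  refine ⟨2 ^ m * (C * ((Real.pi * 8) ^ ((N : ℝ) / 2)) ^ (3 / 2 - 1 / p.toReal)), by positivity,
    fun τ hτ f hf => ?_⟩
  have ha := one_sub_exp_neg_pos hτ
  have hkernel {V G : Type} [NormedAddCommGroup V] [NormedAddCommGroup G] {k : E N → V}
      (hk : Continuous k) (hkD : ∀ z, √(weight N m z) * ‖k z‖ ≤ C * (1 - Real.exp (-τ)) ^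
        (-((N : ℝ) + 1) / 2) * Real.exp (-‖z‖ ^ 2 / (8 * (1 - Real.exp (-τ))))) {g : E N → G}
      (hg : ∀ ξ, ‖g ξ‖ₑ ≤ ∫⁻ η, ‖k (ξ - Real.exp (-τ / 2) • η)‖ₑ * ‖f η‖ₑ) :
      eLpNorm g 2 (weightMeasure N m) ≤ ENNReal.ofReal (2 ^ m * (C * ((Real.pi * 8) ^
        ((N : ℝ) / 2)) ^ (3 / 2 - 1 / p.toReal)) * smoothingRate N p τ)
          * eLpNorm f p (weightMeasure N m) := by
    refine (eLpNorm_weightMeasure_le_of_kernel_le_gaussian hm hp1 hp2 (Real.exp_pos _)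
      (Real.exp_le_one_iff.2 (by linarith)) (by positivity) (by positivity) hk hkD hf hg).trans
      (mul_le_mul_left (ENNReal.ofReal_le_ofReal ?_) _)
    calc _ = 2 ^ m * C * _ := by ring
      _ ≤ 2 ^ m * C * _ := mul_le_mul_of_nonneg_left (kernelConst_le_smoothingRate (N := N)
          hp1 hp2 hτ) (by positivity)
      _ = _ := by ring
  have ha1 := one_sub_exp_neg_le_one τ
  refine ⟨hkernel (continuous_heatKernel _) (fun z => (hCle _ ha ha1 z).1) fun ξ => ?_,
    hkernel (continuous_gradHeatKernel _) (fun z => (hCle _ ha ha1 z).2) fun ξ => ?_⟩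
  · rw [expL_of_pos hτ]
    simpa only [enorm_mul] using enorm_integral_le_lintegral_enorm
      fun η => heatKernel (1 - Real.exp (-τ)) (ξ - Real.exp (-τ / 2) • η) * f η
  · simpa only [gradExpL, enorm_smul, mul_comm ‖f _‖ₑ] using enorm_integral_le_lintegral_enorm
      fun η => f η • gradHeatKernel (1 - Real.exp (-τ)) (ξ - Real.exp (-τ / 2) • η)

end SmoothingEstimate

section SmoothingOperator

variable {N : ℕ} {m τ : ℝ} {p : ℝ≥0∞}

lemma integrable_Lp_weightMeasure (hm : (N : ℝ) / 2 < m) (hp1 : 1 ≤ p) (hp2 : p ≤ 2)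
    (f : Lp ℝ p (weightMeasure N m)) : Integrable f :=
  integrable_of_memLp_weightMeasure hm hp1 hp2 (Lp.memLp f)

lemma memLp_expL (hm : (N : ℝ) / 2 < m) (hp1 : 1 ≤ p) (hp2 : p ≤ 2) (hτ : 0 < τ)
    (f : Lp ℝ p (weightMeasure N m)) : MemLp (expL τ f) 2 (weightMeasure N m) := by
  obtain ⟨C, -, hC⟩ := exists_eLpNorm_expL_le N (nonneg_of_half_lt hm) hp1 hp2
  have hf := integrable_Lp_weightMeasure hm hp1 hp2 f
  exact ⟨(integrable_expL hτ.le hf).1.mono_ac weightMeasure_absolutelyContinuous_volume,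
    (hC τ hτ f hf.1).1.trans_lt (ENNReal.mul_lt_top ENNReal.ofReal_lt_top (Lp.memLp f).2)⟩

lemma memLp_gradExpL (hm : (N : ℝ) / 2 < m) (hp1 : 1 ≤ p) (hp2 : p ≤ 2) (hτ : 0 < τ)
    (f : Lp ℝ p (weightMeasure N m)) : MemLp (gradExpL τ f) 2 (weightMeasure N m) := by
  obtain ⟨C, -, hC⟩ := exists_eLpNorm_expL_le N (nonneg_of_half_lt hm) hp1 hp2
  have hf := integrable_Lp_weightMeasure hm hp1 hp2 f
  exact ⟨(integrable_gradExpL hτ hf).1.mono_ac weightMeasure_absolutelyContinuous_volume,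
    (hC τ hτ f hf.1).2.trans_lt (ENNReal.mul_lt_top ENNReal.ofReal_lt_top (Lp.memLp f).2)⟩

/-- `e^{τ𝓛} f` as an element of `H¹_m`, for `f` in the weighted `L^p` space. -/
def smoothingFun (hm : (N : ℝ) / 2 < m) (hp1 : 1 ≤ p) (hp2 : p ≤ 2) (hτ : 0 < τ)
    (f : Lp ℝ p (weightMeasure N m)) : H1m N m :=
  ⟨WithLp.toLp 2 ((memLp_expL hm hp1 hp2 hτ f).toLp, (memLp_gradExpL hm hp1 hp2 hτ f).toLp),
    (isWeakGradient_expL hτ (integrable_Lp_weightMeasure hm hp1 hp2 f)).congr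
      (volume_absolutelyContinuous_weightMeasure.ae_le
        (memLp_expL hm hp1 hp2 hτ f).coeFn_toLp)
      (volume_absolutelyContinuous_weightMeasure.ae_le
        (memLp_gradExpL hm hp1 hp2 hτ f).coeFn_toLp)⟩

lemma fn_smoothingFun (hm : (N : ℝ) / 2 < m) (hp1 : 1 ≤ p) (hp2 : p ≤ 2) (hτ : 0 < τ)
    (f : Lp ℝ p (weightMeasure N m)) :
    H1m.fn (smoothingFun hm hp1 hp2 hτ f) =ᵐ[volume] expL τ f :=
  volume_absolutelyContinuous_weightMeasure.ae_le
    (memLp_expL hm hp1 hp2 hτ f).coeFn_toLp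

lemma H1m.norm_le_add (v : H1m N m) : ‖v‖ ≤ ‖H1m.fnL N m v‖ + ‖H1m.gradL N m v‖ := by
  refine le_of_sq_le_sq ?_ (by positivity)
  rw [H1m.norm_sq_eq, add_sq]
  linarith [mul_nonneg (norm_nonneg (H1m.fnL N m v)) (norm_nonneg (H1m.gradL N m v))]

lemma exists_norm_smoothingFun_le (hm : (N : ℝ) / 2 < m) (hp1 : 1 ≤ p) (hp2 : p ≤ 2) :
    ∃ C : ℝ, 0 ≤ C ∧ ∀ τ (hτ : 0 < τ) (f : Lp ℝ p (weightMeasure N m)),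
      ‖smoothingFun hm hp1 hp2 hτ f‖ ≤ C * smoothingRate N p τ * ‖f‖ := by
  obtain ⟨C, hC0, hC⟩ := exists_eLpNorm_expL_le N (nonneg_of_half_lt hm) hp1 hp2
  refine ⟨2 * C, by positivity, fun τ hτ f => ?_⟩
  obtain ⟨hfn, hgrad⟩ := hC τ hτ f (integrable_Lp_weightMeasure hm hp1 hp2 f).1
  have hrate : 0 ≤ C * smoothingRate N p τ := mul_nonneg hC0 (smoothingRate_nonneg hτ)
  have htoReal {x : ℝ≥0∞} (hx : x ≤ ENNReal.ofReal (C * smoothingRate N p τ) *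
      eLpNorm f p (weightMeasure N m)) : x.toReal ≤ C * smoothingRate N p τ * ‖f‖ := by
    refine (ENNReal.toReal_mono (ENNReal.mul_ne_top ENNReal.ofReal_ne_top
      (Lp.memLp f).2.ne) hx).trans_eq ?_
    rw [ENNReal.toReal_mul, ENNReal.toReal_ofReal hrate, Lp.norm_def]
  have hfn' : ‖H1m.fnL N m (smoothingFun hm hp1 hp2 hτ f)‖ ≤ C * smoothingRate N p τ * ‖f‖ :=
    (Lp.norm_toLp _ (memLp_expL hm hp1 hp2 hτ f)).trans_le (htoReal hfn)
  have hgrad' : ‖H1m.gradL N m (smoothingFun hm hp1 hp2 hτ f)‖ ≤ C * smoothingRate N p τ * ‖f‖ :=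
    (Lp.norm_toLp _ (memLp_gradExpL hm hp1 hp2 hτ f)).trans_le (htoReal hgrad)
  linarith [H1m.norm_le_add (smoothingFun hm hp1 hp2 hτ f)]

lemma expL_add (hτ : 0 < τ) {f g : E N → ℝ} (hf : Integrable f) (hg : Integrable g) :
    expL τ (f + g) = expL τ f + expL τ g := by
  have ha := one_sub_exp_neg_pos hτ
  funext ξ
  simp only [Pi.add_apply, expL_of_pos hτ, mul_add]
  exact integral_add (integrable_heatKernel_sub_smul_mul ha hf _ ξ)
    (integrable_heatKernel_sub_smul_mul ha hg _ ξ)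

lemma expL_smul (hτ : 0 < τ) (a : ℝ) (f : E N → ℝ) : expL τ (a • f) = a • expL τ f := by
  funext ξ
  simp only [Pi.smul_apply, expL_of_pos hτ, smul_eq_mul, mul_left_comm _ a, integral_const_mul]

lemma H1m.fn_add (v w : H1m N m) : H1m.fn (v + w) =ᵐ[volume] H1m.fn v + H1m.fn w :=
  volume_absolutelyContinuous_weightMeasure.ae_le
    (Lp.coeFn_add (H1m.fnL N m v) (H1m.fnL N m w))

lemma H1m.fn_smul (a : ℝ) (v : H1m N m) : H1m.fn (a • v) =ᵐ[volume] a • H1m.fn v :=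
  volume_absolutelyContinuous_weightMeasure.ae_le (Lp.coeFn_smul a (H1m.fnL N m v))

variable [Fact (1 ≤ p)]

/-- The operator `e^{τ𝓛}` from the weighted `L^p` space to `H¹_m`, set to zero for `τ ≤ 0`. -/
def smoothing (hm : (N : ℝ) / 2 < m) (hp2 : p ≤ 2) (τ : ℝ) :
    Lp ℝ p (weightMeasure N m) →L[ℝ] H1m N m :=
  if hτ : 0 < τ then
    LinearMap.mkContinuousOfExistsBound
      { toFun := smoothingFun hm Fact.out hp2 hτ
        map_add' := fun f g => H1m.ext_fn <| by
          calc H1m.fn (smoothingFun hm Fact.out hp2 hτ (f + g))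
              =ᵐ[volume] expL τ (f + g : Lp ℝ p (weightMeasure N m)) := fn_smoothingFun ..
            _ =ᵐ[volume] expL τ (⇑f + ⇑g) := expL_congr_ae hτ.le
                (volume_absolutelyContinuous_weightMeasure.ae_le (Lp.coeFn_add f g))
            _ = expL τ f + expL τ g := expL_add hτ
                (integrable_Lp_weightMeasure hm Fact.out hp2 f)
                (integrable_Lp_weightMeasure hm Fact.out hp2 g)
            _ =ᵐ[volume] _ := ((fn_smoothingFun ..).add (fn_smoothingFun ..)).symm
            _ =ᵐ[volume] _ := (H1m.fn_add _ _).symm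
        map_smul' := fun a f => H1m.ext_fn <| by
          calc H1m.fn (smoothingFun hm Fact.out hp2 hτ (a • f))
              =ᵐ[volume] expL τ (a • f : Lp ℝ p (weightMeasure N m)) := fn_smoothingFun ..
            _ =ᵐ[volume] expL τ (a • ⇑f) := expL_congr_ae hτ.le
                (volume_absolutelyContinuous_weightMeasure.ae_le (Lp.coeFn_smul a f))
            _ = a • expL τ f := expL_smul hτ a f
            _ =ᵐ[volume] _ := ((fn_smoothingFun ..).const_smul a).symm
            _ =ᵐ[volume] _ := (H1m.fn_smul a _).symm }
      ((exists_norm_smoothingFun_le hm Fact.out hp2).imp' (· * smoothingRate N p τ)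
        fun _ hC f => hC.2 τ hτ f)
  else 0

lemma smoothing_apply (hm : (N : ℝ) / 2 < m) (hp2 : p ≤ 2) (hτ : 0 < τ)
    (f : Lp ℝ p (weightMeasure N m)) :
    smoothing hm hp2 τ f = smoothingFun hm Fact.out hp2 hτ f := by
  rw [smoothing, dif_pos hτ]
  rfl

lemma fn_smoothing (hm : (N : ℝ) / 2 < m) (hp2 : p ≤ 2) (hτ : 0 < τ)
    (f : Lp ℝ p (weightMeasure N m)) : H1m.fn (smoothing hm hp2 τ f) =ᵐ[volume] expL τ f := by
  rw [smoothing_apply hm hp2 hτ]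
  exact fn_smoothingFun hm Fact.out hp2 hτ f

lemma mul_exp_neg_le_one_sub_exp_neg {τ t : ℝ} (hτ : 0 ≤ τ) (ht : τ ≤ t) :
    τ * Real.exp (-t) ≤ 1 - Real.exp (-τ) :=
  calc τ * Real.exp (-t) ≤ τ * Real.exp (-τ) := by gcongr
    _ ≤ (Real.exp τ - 1) * Real.exp (-τ) := by
        gcongr
        linarith [Real.add_one_le_exp τ]
    _ = 1 - Real.exp (-τ) := by rw [sub_mul, ← Real.exp_add, add_neg_cancel, Real.exp_zero, one_mul]

omit [Fact (1 ≤ p)] in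
lemma smoothingRate_le (hp1 : 1 ≤ p) (hp2 : p ≤ 2) {t : ℝ} (hτ : τ ∈ Ioc 0 t) :
    smoothingRate N p τ
      ≤ Real.exp (t / 2) ^ N * Real.exp (-t) ^ (-(1 / 2 + (N : ℝ) / 2 * (1 / p.toReal - 1 / 2)))
        * τ ^ (-(1 / 2 + (N : ℝ) / 2 * (1 / p.toReal - 1 / 2))) := by
  have hτ0 : 0 < τ := hτ.1
  have hp : 0 ≤ (N : ℝ) / 2 * (1 / p.toReal - 1 / 2) :=
    mul_nonneg (by positivity) (sub_nonneg.2 (one_div_toReal_mem_Icc hp1 hp2).1)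
  rw [smoothingRate, mul_assoc, ← Real.mul_rpow (Real.exp_pos _).le hτ0.le, mul_comm _ τ]
  have ha := one_sub_exp_neg_pos hτ0
  refine mul_le_mul (by gcongr; exact hτ.2) ?_ (by positivity) (by positivity)
  exact Real.rpow_le_rpow_of_nonpos (by positivity)
    (mul_exp_neg_le_one_sub_exp_neg hτ0.le hτ.2) (by linarith)

theorem isSmoothingSemigroup_heat (hm : (N : ℝ) / 2 < m) (hp2 : p ≤ 2)
    (hNp : N * (1 / p.toReal - 1 / 2) < 1) :
    IsSmoothingSemigroup (heat (N := N) (nonneg_of_half_lt hm)) (smoothing hm hp2) where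
  zero := heat_zero _
  add := heat_add hm
  continuous := continuous_heat _
  comp σ τ hτ f := by
    have hf := integrable_Lp_weightMeasure hm Fact.out hp2 f
    rcases eq_or_ne σ 0 with rfl | hσ
    · rw [heat_zero, NNReal.coe_zero, zero_add]
    have hσ : 0 < (σ : ℝ) := NNReal.coe_pos.2 (pos_iff_ne_zero.2 hσ)
    refine H1m.ext_fn ?_
    calc H1m.fn (heat _ σ (smoothing hm hp2 τ f))
        =ᵐ[volume] expL σ (H1m.fn (smoothing hm hp2 τ f)) := fn_heat hm σ _
      _ =ᵐ[volume] expL σ (expL τ f) := expL_congr_ae hσ.le (fn_smoothing hm hp2 hτ f)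
      _ = expL (σ + τ) f := expL_expL hσ hτ hf
      _ =ᵐ[volume] _ := (fn_smoothing hm hp2 (add_pos hσ hτ) f).symm
  bound t := by
    obtain ⟨C, hC0, hC⟩ := exists_norm_smoothingFun_le (p := p) hm Fact.out hp2
    have hexponent : -1 < -(1 / 2 + (N : ℝ) / 2 * (1 / p.toReal - 1 / 2)) := by linarith
    have hintegrable := (intervalIntegral.intervalIntegrable_rpow' (a := 0) (b := t) hexponent).1
    refine ⟨_, (hintegrable.const_mul (Real.exp (t / 2) ^ N * Real.exp (-t) ^
      (-(1 / 2 + (N : ℝ) / 2 * (1 / p.toReal - 1 / 2))))).const_mul C, fun τ hτ => ?_⟩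
    refine ContinuousLinearMap.opNorm_le_bound _ ?_ fun f => ?_
    · have : 0 < τ := hτ.1
      positivity
    · rw [smoothing_apply hm hp2 hτ.1]
      refine (hC τ hτ.1 f).trans (mul_le_mul_of_nonneg_right ?_ (norm_nonneg f))
      exact mul_le_mul_of_nonneg_left (smoothingRate_le Fact.out hp2 hτ) hC0

end SmoothingOperator

section TruncatedPower

variable {N : ℕ} {m q : ℝ} {θ : ℝ → ℝ}

lemma one_le_two_div_ofReal (hq : 0 < q) (hq2 : q ≤ 2) : 1 ≤ 2 / ENNReal.ofReal q := by
  rw [ENNReal.le_div_iff_mul_le (.inl (ENNReal.ofReal_pos.2 hq).ne') (.inl ENNReal.ofReal_ne_top),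
    one_mul]
  exact ENNReal.ofReal_le_ofNat.2 hq2

lemma two_div_ofReal_le_two (hq : 1 ≤ q) : 2 / ENNReal.ofReal q ≤ 2 :=
  ENNReal.div_le_of_le_mul (le_mul_of_one_le_right' (ENNReal.one_le_ofReal.2 hq))

lemma one_div_toReal_two_div_ofReal (hq : 0 ≤ q) : 1 / (2 / ENNReal.ofReal q).toReal = q / 2 := by
  rw [ENNReal.toReal_div, ENNReal.toReal_ofReal hq, ENNReal.toReal_ofNat, one_div_div]

/-- The Nemytskii operator of the truncated nonlinearity: `v ↦ θ(‖v‖_m²) |∇v|^q`, with values in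
the weighted `L^{2/q}` space. -/
def truncatedPower (θ : ℝ → ℝ) (hq : 0 < q) (v : H1m N m) :
    Lp ℝ (2 / ENNReal.ofReal q) (weightMeasure N m) :=
  θ (‖v‖ ^ 2) • powOp hq (H1m.gradL N m v)

lemma coeFn_truncatedPower (hq : 0 < q) (v : H1m N m) :
    truncatedPower θ hq v =ᵐ[volume] fun ξ => θ (‖v‖ ^ 2) * ‖H1m.grad v ξ‖ ^ q := by
  have hac := volume_absolutelyContinuous_weightMeasure (N := N) (m := m)
  filter_upwards [hac.ae_le (Lp.coeFn_smul (θ (‖v‖ ^ 2)) (powOp hq (H1m.gradL N m v))),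
    hac.ae_le (coeFn_powOp hq (H1m.gradL N m v))] with ξ hsmul hpow
  rw [truncatedPower, hsmul, Pi.smul_apply, hpow]
  rfl

variable [Fact (1 ≤ 2 / ENNReal.ofReal q)]

lemma contDiff_powOp_gradL (hq : 1 < q) (hq2 : q ≤ 2) :
    ContDiff ℝ 1 fun v : H1m N m => powOp (zero_lt_one.trans hq) (H1m.gradL N m v) := by
  have hpow : ContDiff ℝ 1 (powOp (p := 2) (V := E N) (μ := weightMeasure N m)
      (zero_lt_one.trans hq)) :=
    contDiff_one_iff_hasFDerivAt.2 ⟨_, continuous_powOpDeriv hq hq2, hasFDerivAt_powOp hq hq2⟩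
  exact hpow.comp (H1m.gradL N m).contDiff

lemma norm_fderiv_powOp_gradL_le (hq : 1 < q) (hq2 : q ≤ 2) (v : H1m N m) :
    ‖fderiv ℝ (fun v : H1m N m => powOp (zero_lt_one.trans hq) (H1m.gradL N m v)) v‖
      ≤ q * ‖v‖ ^ (q - 1) := by
  have hderiv := (hasFDerivAt_powOp hq hq2 (H1m.gradL N m v)).comp v
    (H1m.gradL N m).hasFDerivAt
  have hgrad : ‖H1m.gradL N m‖ ≤ 1 :=
    ContinuousLinearMap.opNorm_le_bound _ zero_le_one fun w => by
      simpa only [one_mul] using H1m.norm_gradL_le w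
  calc _ = ‖(powOpDeriv hq hq2 (H1m.gradL N m v)).comp (H1m.gradL N m)‖ :=
        congrArg norm hderiv.fderiv
    _ ≤ ‖powOpDeriv hq hq2 (H1m.gradL N m v)‖ * ‖H1m.gradL N m‖ :=
        ContinuousLinearMap.opNorm_comp_le _ _
    _ ≤ q * ‖H1m.gradL N m v‖ ^ (q - 1) * 1 := by
        gcongr
        exact norm_powOpDeriv_le hq hq2 _
    _ ≤ q * ‖v‖ ^ (q - 1) := by
        rw [mul_one]
        gcongr
        exact H1m.norm_gradL_le v

lemma contDiff_truncatedPower (hq : 1 < q) (hq2 : q ≤ 2) (hθ : ContDiffOn ℝ 1 θ (Ici 0)) :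
    ContDiff ℝ 1 (truncatedPower (N := N) (m := m) θ (zero_lt_one.trans hq)) :=
  contDiff_truncation hθ (contDiff_powOp_gradL hq hq2)

lemma exists_lipschitzWith_truncatedPower (hq : 1 < q) (hq2 : q ≤ 2)
    (hθ : ContDiffOn ℝ 1 θ (Ici 0)) {R : ℝ} (hθR : ∀ r, R ≤ r → θ r = 0) :
    ∃ L : ℝ≥0, LipschitzWith L
      (truncatedPower (N := N) (m := m) θ (zero_lt_one.trans hq)) := by
  have hq0 : 0 < q := zero_lt_one.trans hq
  refine exists_lipschitzWith_truncation hθ hθR (contDiff_powOp_gradL hq hq2)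
    (M := √R ^ q) (M' := q * √R ^ (q - 1)) (fun v hv => ?_) (fun v hv => ?_)
  · refine (norm_powOp_le hq0 _).trans ?_
    gcongr
    exact (H1m.norm_gradL_le v).trans (Real.le_sqrt_of_sq_le hv)
  · refine (norm_fderiv_powOp_gradL_le hq hq2 v).trans ?_
    gcongr
    exact Real.le_sqrt_of_sq_le hv

end TruncatedPower

section MildSolutionFor

variable {N : ℕ} {m : ℝ}

/-- `v` is a mild solution of `∂_τ v = 𝓛v - F(v)`, `v(0) = v₀`, in the sense of `IsMildSolution`
but for an arbitrary nonlinearity `F` assigning a function to each element of `H¹_m`. -/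
def IsMildSolutionFor (F : H1m N m → E N → ℝ) (v₀ : H1m N m) (v : C(ℝ≥0, H1m N m)) : Prop :=
  ∀ τ : ℝ≥0, ∃ (w : H1m N m) (g : ℝ → H1m N m),
    H1m.fn w =ᵐ[volume] expL τ (H1m.fn v₀) ∧
    (∀ s : ℝ≥0, s < τ → H1m.fn (g s) =ᵐ[volume] expL ((τ : ℝ) - s) (F (v s))) ∧
    IntervalIntegrable g volume 0 τ ∧
    v τ = w - ∫ s in (0 : ℝ)..τ, g s

variable {p : ℝ≥0∞} [Fact (1 ≤ p)] {F : H1m N m → E N → ℝ}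
  {G : C(H1m N m, Lp ℝ p (weightMeasure N m))} {v₀ : H1m N m} {v : C(ℝ≥0, H1m N m)}

lemma fn_smoothing_comp (hm : (N : ℝ) / 2 < m) (hp2 : p ≤ 2) (hG : ∀ v, G v =ᵐ[volume] F v)
    {s τ : ℝ≥0} (hs : s < τ) (x : H1m N m) :
    H1m.fn (smoothing hm hp2 (τ - s) (G x)) =ᵐ[volume] expL ((τ : ℝ) - s) (F x) :=
  have hpos : 0 < (τ : ℝ) - s := sub_pos.2 (NNReal.coe_lt_coe.2 hs)
  (fn_smoothing hm hp2 hpos _).trans (expL_congr_ae hpos.le (hG x))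

lemma isMildSolutionFor_iff_isMild (hm : (N : ℝ) / 2 < m) (hp2 : p ≤ 2)
    (hNp : N * (1 / p.toReal - 1 / 2) < 1) (hG : ∀ v, G v =ᵐ[volume] F v) :
    IsMildSolutionFor F v₀ v ↔ IsMild (heat (nonneg_of_half_lt hm)) (smoothing hm hp2) G v₀ v := by
  refine forall_congr' fun τ => ⟨?_, fun h => ?_⟩
  · rintro ⟨w, g, hw, hg, -, hv⟩
    rw [hv]
    congr 1
    · exact H1m.ext_fn (hw.trans (fn_heat hm τ v₀).symm)
    · refine intervalIntegral.integral_congr_ae ?_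
      filter_upwards [Measure.ae_ne volume (τ : ℝ)] with s hne hs
      rw [uIoc_of_le τ.coe_nonneg] at hs
      have hs0 : ((s.toNNReal : ℝ≥0) : ℝ) = s := Real.coe_toNNReal s hs.1.le
      have hlt : s.toNNReal < τ := NNReal.coe_lt_coe.1 (hs0.symm ▸ hs.2.lt_of_ne hne)
      have h := (hg _ hlt).trans (fn_smoothing_comp hm hp2 hG hlt _).symm
      rw [hs0] at h
      exact H1m.ext_fn h
  · obtain ⟨b, hb⟩ := (isSmoothingSemigroup_heat hm hp2 hNp).exists_isVolterraKernel τ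
    have hcont : Continuous fun s : ℝ => G (v s.toNNReal) := by fun_prop
    refine ⟨_, fun s => smoothing hm hp2 (τ - s) (G (v s.toNNReal)), fn_heat hm τ v₀,
      fun s hs => ?_, hb.intervalIntegrable (right_mem_Icc.2 τ.coe_nonneg) hcont.continuousOn, h⟩
    simp only [Real.toNNReal_coe]
    exact fn_smoothing_comp hm hp2 hG hs (v s)

end MildSolutionFor

section CriticalExponent

lemma one_lt_qStar (N : ℕ) : 1 < qStar N := by
  rw [qStar, one_lt_div (by positivity)]
  linarith

lemma qStar_lt_two {N : ℕ} (hN : 1 ≤ N) : qStar N < 2 := by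
  have : (1 : ℝ) ≤ N := Nat.one_le_cast.2 hN
  rw [qStar, div_lt_iff₀ (by positivity)]
  linarith

lemma mul_qStar_sub_one_lt_two (N : ℕ) : N * (qStar N - 1) < 2 := by
  have h : qStar N - 1 = 1 / (N + 1) := by
    rw [qStar]
    field_simp
    ring
  rw [h, mul_one_div, div_lt_iff₀ (by positivity)]
  linarith [N.cast_nonneg (α := ℝ)]

end CriticalExponent

end ViscousHJ

end

open Set ViscousHJ in
theorem mainTheorem3_general {N : ℕ} {m q R : ℝ} (hm : (N : ℝ) / 2 < m) (hq : 1 < q) (hq2 : q ≤ 2)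
    (hNq : N * (q - 1) < 2) {θ : ℝ → ℝ} (hθ : ContDiffOn ℝ 1 θ (Ici 0))
    (hθR : ∀ r, R ≤ r → θ r = 0) {F : H1m N m → E N → ℝ}
    (hF : ∀ v ξ, F v ξ = θ (‖v‖ ^ 2) * ‖H1m.grad v ξ‖ ^ q) :
    (∀ v₀, ∃! v, IsMildSolutionFor F v₀ v) ∧
    ∃ φ : ℝ≥0 → H1m N m → H1m N m,
      (∀ v₀ v, IsMildSolutionFor F v₀ v → ∀ τ, φ τ v₀ = v τ) ∧
      (∀ T : ℝ≥0, ∃ K : ℝ≥0, ∀ τ ≤ T, LipschitzWith K (φ τ)) ∧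
      IsC1Semiflow φ := by
  have hq0 : 0 < q := zero_lt_one.trans hq
  have : Fact (1 ≤ 2 / ENNReal.ofReal q) := ⟨one_le_two_div_ofReal hq0 hq2⟩
  have hp2 : 2 / ENNReal.ofReal q ≤ 2 := two_div_ofReal_le_two hq.le
  have hexponent : N * (1 / (2 / ENNReal.ofReal q).toReal - 1 / 2) < 1 := by
    rw [one_div_toReal_two_div_ofReal hq0.le]
    linarith
  have hsmoothing := isSmoothingSemigroup_heat (N := N) hm hp2 hexponent
  have hG : ContDiff ℝ 1 (truncatedPower (N := N) (m := m) θ hq0) :=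
    contDiff_truncatedPower hq hq2 hθ
  let G : C(H1m N m, _) := ⟨_, hG.continuous⟩
  obtain ⟨L, hL⟩ : ∃ L : ℝ≥0, LipschitzWith L G := exists_lipschitzWith_truncatedPower hq hq2 hθ hθR
  have hGF (v : H1m N m) : G v =ᵐ[volume] F v := funext (hF v) ▸ coeFn_truncatedPower hq0 v
  simp only [isMildSolutionFor_iff_isMild hm hp2 hexponent hGF]
  exact ⟨hsmoothing.existsUnique_isMild hG hL, hsmoothing.flow hG hL,
    fun v₀ v hv τ => ((hsmoothing.isMild_iff_eq_flow hG hL).1 hv τ).symm,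
    hsmoothing.exists_lipschitzWith_flow hG hL, hsmoothing.isC1Semiflow_flow hG hL⟩

theorem mainTheorem3 (N : ℕ) (hN : 1 ≤ N) (m : ℝ) (hm : (N : ℝ) / 2 < m)
    (χ : ℝ → ℝ) (hχ : ViscousHJ.IsCutoff χ) (ρ : ℝ) (hρ0 : 0 < ρ) (hρ1 : ρ < 1) :
    (∀ v₀ : ViscousHJ.H1m N m, ∃! v : C(ℝ≥0, ViscousHJ.H1m N m),
      ViscousHJ.IsMildSolution χ ρ v₀ v) ∧
    ∃ φ : ℝ≥0 → ViscousHJ.H1m N m → ViscousHJ.H1m N m,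
      (∀ (v₀ : ViscousHJ.H1m N m) (v : C(ℝ≥0, ViscousHJ.H1m N m)),
        ViscousHJ.IsMildSolution χ ρ v₀ v → ∀ τ, φ τ v₀ = v τ) ∧
      (∀ T : ℝ≥0, ∃ K : ℝ≥0, ∀ τ ≤ T, LipschitzWith K (φ τ)) ∧
      ViscousHJ.IsC1Semiflow φ :=
  mainTheorem3_general (θ := fun r => χ (r / ρ ^ 2)) (R := 4 * ρ ^ 2) hm (ViscousHJ.one_lt_qStar N)
    (ViscousHJ.qStar_lt_two hN).le (ViscousHJ.mul_qStar_sub_one_lt_two N)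
    ((hχ.smooth.of_le (mod_cast le_top)).comp (by fun_prop)
      fun r hr => div_nonneg hr (sq_nonneg ρ))
    (fun r hr => hχ.eq_zero _ ((le_div_iff₀ (by positivity)).2 hr)) fun _ _ => rfl
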